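/- **Setting.** Let $d\ge 2$, let $\mathcal J$ be an index set, $\|\cdot\|$ the norm of $\ell_2$. For $w\in\ell_2(\mathcal J)$ put $\|w\|_{\mathcal A_s}:=\sup_{\varepsilon>0}\varepsilon\,[\min\{N:\exists v,\ \#\operatorname{supp}v\le N,\ \|w-v\|\le\varepsilon\}]^s$. For $v\in\ell_2(\mathcal J^d)$ let $\pi_j(v)[x]:=(\sum_{\lambda:\lambda_j=x}|v_\lambda|^2)^{1/2}$, $\operatorname{supp}_j(v):=\operatorname{supp}\pi_j(v)$, and let $R_\Lambda$ be the restriction to $\Lambda$ (extended by zero). Put $\operatorname{tail}(v,\Lambda):=(\sum_j\sum_{x\notin\Lambda_j}|\pi_j(v)[x]|^2)^{1/2}$ for $\Lambda=\Lambda_1\times\dots\times\Lambda_d$. *Operator.* Let $\omega_{j,x}>0$ be weights ($H^1$-norms of one-dimensional wavelets), $t_\lambda:=\sum_j\omega_{j,\lambda_j}^2\ge1$, $\boldsymbol D:=\operatorname{diag}(t_\lambda^{1/2})$. For $\delta\in(0,1)$ let $0<h<\pi^2/(5(|\ln(\delta/2)|+4))$, $n^+\ge h^{-1}\max\{4/\sqrt\pi,\sqrt{|\ln(\delta/2)|}\}$,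 $\varphi_n(t):=\sum_{k=-n}^{n^+}h\frac{2}{\sqrt\pi}(1+e^{-kh})^{-1}e^{-t\ln^2(1+e^{kh})}$; $\boldsymbol S^{-1}(\delta,\eta)$ is the diagonal matrix with entries $\varphi_n(t_\lambda)$, where $n\ge h^{-1}(\ln\frac2{\sqrt\pi}+|\ln\min\{\delta/2,\eta\}|+\frac12\ln T)$ and $T>1$ bounds $t_\lambda$ on the indices that occur; $\boldsymbol S^{-1}(\delta)$ has entries $\varphi_\infty(t_\lambda)$. Let $\boldsymbol A=\sum_{n=1}^R\bigotimes_{j=1}^d\boldsymbol A_{n,j}$. Let $a_{n,j},b_{n,j}\in\{0,1\}$ be the orders of differentiation of test and trial functions, $\sum_ja_{n,j}\le1$, $\sum_jb_{n,j}\le1$, and assume that the scaled components $\hat{\boldsymbol A}_{n,j}:=(\omega_{j,x}^{-a_{n,j}}(\boldsymbol A_{n,j})_{xy}\,\omega_{j,y}^{-b_{n,j}})_{x,y}$ are bounded on $\ell_2(\mathcal J)$ and $s^*$-compressible: for each $0<s<s^*$ there are matrices $\hat{\boldsymbol A}_{n,j,[p]}$, $p\ge0$, with at most $\alpha_p2^p$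 nonzero entries per row and column and $\|\hat{\boldsymbol A}_{n,j}-\hat{\boldsymbol A}_{n,j,[p]}\|\le\beta_p2^{-sp}$, where $(\alpha_p),(\beta_p)$ are positive and summable. Assume that $\boldsymbol A^\delta:=\boldsymbol S^{-1}(\delta)\boldsymbol A\boldsymbol S^{-1}(\delta)$ is bounded and symmetric on $\ell_2(\mathcal J^d)$ with $\lambda_{\min}\|v\|^2\le\langle v,\boldsymbol A^\delta v\rangle\le\lambda_{\max}\|v\|^2$, $0<\lambda_{\min}\le\lambda_{\max}$; put $\kappa:=\lambda_{\max}/\lambda_{\min}$, $\boldsymbol f^\delta:=\boldsymbol S^{-1}(\delta)\boldsymbol f\in\ell_2(\mathcal J^d)$ and $\boldsymbol A^\delta\boldsymbol u^\delta=\boldsymbol f^\delta$. *Algorithm (HT-AWGM)*, with parameters $\omega_0,\dots,\omega_5>0$, $\omega_0\ge\|\boldsymbol f^\delta\|$, $\alpha\in(0,1)$, $M\in\mathbb N$, a finite product set $\Lambda^{(0,0)}\neq\emptyset$, a binary dimension tree, and target tolerance $\varepsilon>0$. Start with $\boldsymbol u^{(0,0)}=0$, $\|\boldsymbol r^{(0,0)}\|:=\omega_0$,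 and put $\omega_0^{(k)}:=(\omega_3+\omega_4+\omega_5)^k\omega_0$. In step $(k,m)$: (i) $\boldsymbol u^{(k,m+1)}$ is obtained by the truncated CG method for the Galerkin system on $\Lambda^{(k,m)}$, started at $\boldsymbol u^{(k,m)}$ and stopped once the Galerkin residual is $\le\omega_2\|\boldsymbol r^{(k,m)}\|$; (ii) $\boldsymbol r^{(k,m+1)}=\mathbf{RES}(\boldsymbol u^{(k,m+1)})$; (iii) if $(1+\omega_1)\|\boldsymbol r^{(k,m+1)}\|\le\varepsilon$, stop; (iv) if $(1+\omega_1)\|\boldsymbol r^{(k,m+1)}\|\le\omega_3\omega_0^{(k)}$ or $m=M$, then $\boldsymbol u^{(k+1,0)}:=\mathcal C(\mathcal T(\boldsymbol u^{(k,m+1)},\omega_4\lambda_{\min}^{-1}\omega_0^{(k)}),\omega_5\lambda_{\min}^{-1}\omega_0^{(k)})$, $\Lambda^{(k+1,0)}_j:=\operatorname{supp}_j(\boldsymbol u^{(k+1,0)})$, $\boldsymbol r^{(k+1,0)}:=\mathbf{RES}(\boldsymbol u^{(k+1,0)})$, and continue with $(k+1,0)$; (v) otherwise $\Lambda_j^{(k,m+1)}:=\Lambda_j^{(k,m)}\cup\Gamma_j$,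 where $\Gamma$ is a coarse set of $\boldsymbol r^{(k,m+1)}$ for the tolerance $\sqrt{1-\alpha^2}\,\|\boldsymbol r^{(k,m+1)}\|$, and continue with $(k,m+1)$. Here: - a coarse set of $v$ for the tolerance $\epsilon$ is a product set $\Lambda$ with $\operatorname{tail}(v,\Lambda)\le\epsilon$ whose total size $\sum_j\#\Lambda_j$ is minimal up to a fixed factor $K\ge1$, and $\mathcal C(v,\epsilon)=R_\Lambda v$ for such a $\Lambda$; - $\mathcal T(v,\epsilon)$ is a hierarchical HOSVD truncation of $v$ (projections onto the leading left singular vectors of the matricizations of $v$ for all non-root nodes of the tree, applied from the root to the leaves) with $\|v-\mathcal T(v,\epsilon)\|\le\epsilon$; - $\tilde{\boldsymbol r}=\mathbf{RES}(v)$ satisfies $\|(\boldsymbol f^\delta-\boldsymbol A^\delta v)-\tilde{\boldsymbol r}\|\le\omega_1\|\tilde{\boldsymbol r}\|$ and, unless $\boldsymbol f^\delta=\boldsymbol A^\delta v$ and $\tilde{\boldsymbol r}=0$, $\tilde{\boldsymbol r}=\boldsymbol S^{-1}(\delta,\eta)(\boldsymbol f_\epsilon-\boldsymbol A_\epsilon\boldsymbol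 S^{-1}(\delta,\eta)v)$ for some $\eta>0$, where $\epsilon=\mathit{tol}/(3(1+\delta)(2+\delta))$ and $\mathit{tol}>0$, $c\|\tilde{\boldsymbol r}\|\le\mathit{tol}\le\omega_1\|\tilde{\boldsymbol r}\|$ with a fixed $c\in(0,\omega_1]$. Here $\boldsymbol A_\epsilon=\sum_n\bigotimes_j\tilde{\boldsymbol A}_{n,j}$, where $\tilde{\boldsymbol A}_{n,j}$ is $\sum_{p=0}^{L}\hat{\boldsymbol A}_{n,j,[L-p]}R_{\Gamma_{j,p}\setminus\Gamma_{j,p-1}}$ with the scaling undone, the sets $\Gamma_{j,0}\subset\Gamma_{j,1}\subset\cdots$ are supports of best $2^p$-term approximations of $\pi_j(v)$ ($\Gamma_{j,-1}=\emptyset$), the compressed matrices are those for the rate $s$ below, and $L$ is minimal with $\|\boldsymbol D^{-1}(\boldsymbol A-\boldsymbol A_\epsilon)\boldsymbol D^{-1}v\|\le\epsilon$; - the truncated CG method for $Bx=b$ (here $B=\boldsymbol A^\delta$ and $b=\boldsymbol f^\delta$ restricted to $\Lambda^{(k,m)}$) is $r_i=b-Bx_i$, $p_0=r_0+e_0$,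 $x_{i+1}=x_i+\frac{\langle r_i,p_i\rangle}{\langle p_i,Bp_i\rangle}p_i+e'_{i+1}$, $p_{i+1}=r_{i+1}+b_ip_i+e_{i+1}$, $b_i=-\frac{\langle r_{i+1},Bp_i\rangle}{\langle p_i,Bp_i\rangle}$ (a quotient with denominator $0$ is read as $0$), with arbitrary perturbations subject to: there are bounds $0<l\le L$ of the spectrum of $B$ and, with $\kappa_B=L/l$, numbers $0<\tau<(1+\kappa_B^2)^{-1/2}$, $\delta_1,\delta_2>0$, $0<\gamma_B<1$, $\theta=(1-\gamma_B^2/(2\kappa_B))^{1/2}$, $0\le\mu<\theta^{-1}-1$ such that $\frac32\delta_1+\delta_2\le\tau^{-2}-(1+\kappa_B^2)$, $(1-\frac{\delta_1}2)\tau\ge\gamma_B$, $\|e_i\|\le\frac{\delta_1}2\|r_i\|$, $2|b_i|\|p_i\|\|e_{i+1}\|\le\delta_2\|r_{i+1}\|^2$ and $\|e'_{i+1}\|\le\theta\mu L^{-1}\|r_i\|$. **Proposition.** Let $0<s<s^*$, and assume: 1. $\pi_j(\boldsymbol u^\delta)\in\mathcal A_s$ for all $j$, and $\boldsymbol u^\delta\in\mathcal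 A(\gamma)$, i.e. $\sup_N\gamma(N)\inf\{\|\boldsymbol u^\delta-w\|: w\text{ has hierarchical ranks}\le N\}<\infty$, for a positive, strictly increasing sequence $\gamma$ with $\gamma(0)=1$ and $\sup_n\gamma(n)/\gamma(n-1)<\infty$; 2. $\omega_4>\sqrt{2d-3}\,\omega_3$, $\omega_5>\sqrt d(1+\sqrt{2d-3})\,\omega_3$, $\omega_3+\omega_4+\omega_5<1$; 3. $0<\omega_1<\alpha$, $\omega_2<\frac{(1-\omega_1)(\alpha-\omega_1)}{1+\omega_1}\kappa^{-1}$, and $M\ge\lceil|\ln(\omega_3\kappa^{-1/2})/\ln\vartheta|\rceil$ with $\vartheta=\big(1-(\frac{\alpha-\omega_1}{1+\omega_1})^2\kappa^{-1}+(\frac{\omega_2}{1-\omega_1})^2\kappa\big)^{1/2}$; 4. there are finitely supported $\boldsymbol f_\epsilon$, $\epsilon>0$, with $\|\boldsymbol D^{-1}(\boldsymbol f-\boldsymbol f_\epsilon)\|\le\epsilon$ and, for $\boldsymbol f^\delta_\epsilon=\boldsymbol S^{-1}(\delta)\boldsymbol f_\epsilon$ and a constant $C'$ independent of $\epsilon$,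 $\sum_j\#\operatorname{supp}_j(\boldsymbol f^\delta_\epsilon)\le C'\epsilon^{-1/s}(\sum_j\|\pi_j(\boldsymbol f^\delta)\|_{\mathcal A_s})^{1/s}$ and $\sum_j\|\pi_j(\boldsymbol f^\delta_\epsilon)\|_{\mathcal A_s}\le C'\sum_j\|\pi_j(\boldsymbol f^\delta)\|_{\mathcal A_s}$. Then there is a constant $C>0$, independent of $k$ and $m$ (and of $\varepsilon$ and of the choices made during the run), such that for every iteration $(k,m)$ reached by the algorithm with $\boldsymbol u^{(k,m)}\ne\boldsymbol u^\delta$ $$\sum_{j=1}^d\#\Lambda_j^{(k,m)}\le C\,\|\boldsymbol u^\delta-\boldsymbol u^{(k,m)}\|^{-1/s}\Big(\sum_{j=1}^d\|\pi_j(\boldsymbol u^\delta)\|_{\mathcal A_s}\Big)^{1/s}.$$ -/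

import Mathlib

open scoped ENNReal

noncomputable section

namespace HTAWGM

/-! ### Sequence spaces, restrictions, best `N`-term approximation -/

/-- The real sequence space `ℓ₂(ι)`. -/
abbrev L2 (ι : Type*) := lp (fun _ : ι => ℝ) 2

/-- `R_Λ v` (followed by extension by zero): all entries outside `Λ` are replaced by zero. -/
def restr {ι : Type*} (Λ : Set ι) (v : L2 ι) : L2 ι :=
  ⟨Λ.indicator v, by
    refine Memℓp.mono' (lp.memℓp v) fun i => ?_
    by_cases h : i ∈ Λ <;> simp [h]⟩

/-- `v` is supported in `Λ`, i.e. `v ∈ ℓ₂(Λ)`. -/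
def SuppIn {ι : Type*} (Λ : Set ι) (v : L2 ι) : Prop := ∀ i, i ∉ Λ → v i = 0

open Classical in
/-- The matrix entry with row `x` and column `y` of a bounded operator on `ℓ₂(ι)`. -/
def entry {ι : Type*} (B : L2 ι →L[ℝ] L2 ι) (x y : ι) : ℝ := B (lp.single 2 y (1 : ℝ)) x

/-- `min {N : ‖w - w_N‖ ≤ ε}`, with `w_N` a best `N`-term approximation of `w`. -/
def nterm {J : Type*} (w : L2 J) (ε : ℝ) : ℕ :=
  sInf {N : ℕ | ∃ v : L2 J, (Function.support v).encard ≤ N ∧ ‖w - v‖ ≤ ε}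

/-- The quasi-norm of the approximation class `𝒜_s`; `w ∈ 𝒜_s` means that it is finite. -/
def asNorm {J : Type*} (s : ℝ) (w : L2 J) : ℝ≥0∞ :=
  ⨆ (ε : ℝ) (_ : 0 < ε), ENNReal.ofReal (ε * (nterm w ε : ℝ) ^ s)

/-- `Γ p`, `p = 0, 1, …`, are nested supports of best `2^p`-term approximations of `w`. -/
def IsBestLayers {J : Type*} (w : L2 J) (Γ : ℕ → Finset J) : Prop :=
  Monotone Γ ∧ ∀ p, (Γ p).card ≤ 2 ^ p ∧ ∀ F : Finset J, F.card ≤ 2 ^ p →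
    ‖w - restr (Γ p : Set J) w‖ ≤ ‖w - restr (F : Set J) w‖

/-! ### Compressible matrices -/

/-- The matrices `Bp p` compress `B` at the rate `s`. -/
def IsCompressionScheme {J : Type*} (s : ℝ) (B : L2 J →L[ℝ] L2 J)
    (Bp : ℕ → L2 J →L[ℝ] L2 J) : Prop :=
  ∃ a b : ℕ → ℝ, (∀ p, 0 < a p) ∧ (∀ p, 0 < b p) ∧ Summable a ∧ Summable b ∧
    ∀ p : ℕ,
      (∀ x, {y | entry (Bp p) x y ≠ 0}.Finite ∧
        ({y | entry (Bp p) x y ≠ 0}.ncard : ℝ) ≤ a p * 2 ^ p) ∧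
      (∀ y, {x | entry (Bp p) x y ≠ 0}.Finite ∧
        ({x | entry (Bp p) x y ≠ 0}.ncard : ℝ) ≤ a p * 2 ^ p) ∧
      ‖B - Bp p‖ ≤ b p * (2 : ℝ) ^ (-(s * p))

/-- `B` is `sstar`-compressible. -/
def IsCompressible {J : Type*} (sstar : ℝ) (B : L2 J →L[ℝ] L2 J) : Prop :=
  ∀ s, 0 < s → s < sstar → ∃ Bp : ℕ → L2 J →L[ℝ] L2 J, IsCompressionScheme s B Bp

/-! ### Tensors and contractions -/

/-- Multi-indices: the index set of tensors of order `d`. -/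
abbrev MIdx (d : ℕ) (J : Type*) := Fin d → J

open Classical in
/-- The entries of the contraction `π_j(v)`. -/
def contractionFun {d : ℕ} {J : Type*} (j : Fin d) (v : L2 (MIdx d J)) (x : J) : ℝ :=
  √(∑' l : MIdx d J, if l j = x then v l ^ 2 else 0)

theorem contractionFun_memℓp {d : ℕ} {J : Type*} (j : Fin d) (v : L2 (MIdx d J)) :
    Memℓp (contractionFun j v) 2 := by
  classical
  have hs : Summable fun l : MIdx d J => v l ^ 2 := by
    have := (lp.memℓp v).summable (by norm_num)
    simpa using this
  have hs' : ∀ x : J, Summable fun l : MIdx d J => if l j = x then v l ^ 2 else 0 := fun x =>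
    Summable.of_nonneg_of_le (fun l => by split_ifs <;> positivity)
      (fun l => by split_ifs <;> first | exact le_rfl | positivity) hs
  refine memℓp_gen' (C := ∑' l, v l ^ 2) fun t => ?_
  have h1 : ∀ x ∈ t, ‖contractionFun j v x‖ ^ (2 : ℝ≥0∞).toReal
      = ∑' l : MIdx d J, if l j = x then v l ^ 2 else 0 := fun x _ => by
    have h0 : 0 ≤ ∑' l : MIdx d J, if l j = x then v l ^ 2 else 0 :=
      tsum_nonneg fun l => by split_ifs <;> positivity
    simp [contractionFun, Real.sq_sqrt h0]
  rw [Finset.sum_congr rfl h1, ← Summable.tsum_finsetSum fun x _ => hs' x]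
  refine Summable.tsum_le_tsum (fun l => ?_) (summable_sum fun x _ => hs' x) hs
  rw [Finset.sum_ite_eq]
  split_ifs <;> first | exact le_rfl | positivity

/-- The contraction `π_j(v) ∈ ℓ₂(J)` of a tensor `v ∈ ℓ₂(J^d)`. -/
def contraction {d : ℕ} {J : Type*} (j : Fin d) (v : L2 (MIdx d J)) : L2 J :=
  ⟨contractionFun j v, contractionFun_memℓp j v⟩

/-- The product index set `Λ₁ × ⋯ × Λ_d`. -/
def box {d : ℕ} {J : Type*} (Λ : Fin d → Finset J) : Set (MIdx d J) := {l | ∀ j, l j ∈ Λ j}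

/-- `(∑_j ∑_{x ∉ Λ_j} |π_j(v)[x]|²)^{1/2}`. -/
def tail {d : ℕ} {J : Type*} (v : L2 (MIdx d J)) (Λ : Fin d → Finset J) : ℝ :=
  √(∑ j, ‖contraction j v - restr (Λ j : Set J) (contraction j v)‖ ^ 2)

/-- `Λ` is a product set found by sorting the contractions of `v` to the tolerance `ε`: the
discarded part of the contractions has norm at most `ε`, and the total size `∑_j #Λ_j` is minimal
up to the factor `K` (`K = 1` for exact sorting, `K > 1` for approximate sorting into bins). -/
def IsCoarseSet {d : ℕ} {J : Type*} (K : ℝ) (v : L2 (MIdx d J)) (ε : ℝ)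
    (Λ : Fin d → Finset J) : Prop :=
  tail v Λ ≤ ε ∧ ∀ Λ' : Fin d → Finset J, tail v Λ' ≤ ε →
    (∑ j, ((Λ j).card : ℝ)) ≤ K * ∑ j, ((Λ' j).card : ℝ)

/-- `w` is a result of `COARSE(v, ε)`. -/
def IsCoarse {d : ℕ} {J : Type*} (K : ℝ) (v : L2 (MIdx d J)) (ε : ℝ) (w : L2 (MIdx d J)) : Prop :=
  ∃ Λ, IsCoarseSet K v ε Λ ∧ w = restr (box Λ) v

open Classical in
/-- `Λ'` is a result of `EXPAND(Λ, r, bulk)`: the old set is enlarged by a product set that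
captures the fraction `bulk` of `r` and is found by sorting contractions. -/
def IsExpand {d : ℕ} {J : Type*} (K : ℝ) (Λ : Fin d → Finset J) (r : L2 (MIdx d J)) (bulk : ℝ)
    (Λ' : Fin d → Finset J) : Prop :=
  ∃ Γ, IsCoarseSet K r (√(1 - bulk ^ 2) * ‖r‖) Γ ∧ ∀ j, Λ' j = Λ j ∪ Γ j

/-! ### The hierarchical Tucker format -/

/-- Binary dimension trees. -/
inductive DimTree (d : ℕ) : Type
  | leaf (j : Fin d) : DimTree d
  | node (l r : DimTree d) : DimTree d

namespace DimTree

/-- The set of modes at the root of a tree. -/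
def modes {d : ℕ} : DimTree d → Finset (Fin d)
  | leaf j => {j}
  | node l r => l.modes ∪ r.modes

/-- At every inner node the modes are split into two disjoint sets. -/
def Proper {d : ℕ} : DimTree d → Prop
  | leaf _ => True
  | node l r => Disjoint l.modes r.modes ∧ l.Proper ∧ r.Proper

/-- All mode sets that occur in a tree. -/
def nodes {d : ℕ} : DimTree d → Set (Finset (Fin d))
  | leaf j => {{j}}
  | node l r => {l.modes ∪ r.modes} ∪ l.nodes ∪ r.nodes

/-- A dimension tree for tensors of order `d`. -/
def IsDimTree {d : ℕ} (t : DimTree d) : Prop := t.modes = Finset.univ ∧ t.Proper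

/-- Apply the operators `P α` for all nodes `α` except the root, from the root to the leaves. -/
def applyAll {d : ℕ} {X : Type*} (P : Finset (Fin d) → X → X) : DimTree d → X → X
  | leaf _, x => x
  | node l r, x => r.applyAll P (l.applyAll P (P r.modes (P l.modes x)))

end DimTree

/-- The rank of the matricization of `w` with row indices in the modes `α`. -/
def matRank {d : ℕ} {J : Type*} (α : Finset (Fin d)) (w : MIdx d J → ℝ) : Cardinal :=
  Module.rank ℝ (Submodule.span ℝ (Set.range fun (x : MIdx d J) (y : MIdx d J) =>
    w fun i => if i ∈ α then x i else y i))

/-- Tensors with hierarchical ranks at most `N`. -/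
def htSet {d : ℕ} {J : Type*} (t : DimTree d) (N : ℕ) : Set (L2 (MIdx d J)) :=
  {w | ∀ α ∈ t.nodes, matRank α w ≤ N}

/-- `v ∈ 𝒜(γ)`. -/
def MemRankClass {d : ℕ} {J : Type*} (t : DimTree d) (γ : ℕ → ℝ) (v : L2 (MIdx d J)) : Prop :=
  ∃ B : ℝ, ∀ N : ℕ, γ N * Metric.infDist v (htSet t N) ≤ B

/-- The part of a multi-index in the modes `α`, and the remaining part. -/
def splitIdx {d : ℕ} {J : Type*} (α : Finset (Fin d)) :
    MIdx d J ≃ ({i // i ∈ α} → J) × ({i // i ∉ α} → J) :=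
  Equiv.piEquivPiSubtypeProd (fun i => i ∈ α) fun _ => J

/-- A singular value decomposition of the matricization of a finitely supported tensor `v` with
row indices in the modes `α`, with the (positive) singular values in decreasing order. -/
structure MatSVD {d : ℕ} {J : Type*} (α : Finset (Fin d)) (v : MIdx d J → ℝ) where
  /-- the number of positive singular values -/
  n : ℕ
  /-- the singular values -/
  σ : Fin n → ℝ
  /-- the left singular vectors -/
  left : Fin n → (({i // i ∈ α} → J) →₀ ℝ)
  /-- the right singular vectors -/
  right : Fin n → (({i // i ∉ α} → J) →₀ ℝ)
  pos : ∀ k, 0 < σ k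
  anti : Antitone σ
  left_orth : ∀ k l, ((left k).sum fun x c => c * left l x) = if k = l then 1 else 0
  right_orth : ∀ k l, ((right k).sum fun x c => c * right l x) = if k = l then 1 else 0
  eq_sum : ∀ m, v m = ∑ k, σ k * left k (splitIdx α m).1 * right k (splitIdx α m).2

/-- The orthogonal projection, acting on the modes `α`, onto the span of the first `ρ` left
singular vectors. -/
def MatSVD.proj {d : ℕ} {J : Type*} {α : Finset (Fin d)} {v : MIdx d J → ℝ} (S : MatSVD α v)
    (ρ : ℕ) (x : MIdx d J → ℝ) : MIdx d J → ℝ := fun m =>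
  ∑ k : Fin S.n, if (k : ℕ) < ρ then
    S.left k (splitIdx α m).1 *
      (S.left k).sum fun y c => c * x ((splitIdx α).symm (y, (splitIdx α m).2))
  else 0

/-- `w` is a result of the truncation `𝒯(v, ε)`: a hierarchical HOSVD truncation of `v` to some
ranks `ρ`, with an error of at most `ε`. -/
def IsTrunc {d : ℕ} {J : Type*} (t : DimTree d) (v : L2 (MIdx d J)) (ε : ℝ)
    (w : L2 (MIdx d J)) : Prop :=
  ∃ (S : ∀ α : Finset (Fin d), MatSVD (J := J) α v) (ρ : Finset (Fin d) → ℕ),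
    (∀ m, w m = t.applyAll (fun α => (S α).proj (ρ α)) (v : MIdx d J → ℝ) m) ∧ ‖v - w‖ ≤ ε

/-! ### The truncated conjugate gradient method -/

/-- Constants of the truncated conjugate gradient method. -/
structure CGParams where
  /-- lower bound of the spectrum -/
  lmin : ℝ
  /-- upper bound of the spectrum -/
  lmax : ℝ
  τ : ℝ
  δ₁ : ℝ
  δ₂ : ℝ
  γ : ℝ
  μ : ℝ

/-- The condition number. -/
def CGParams.κ (c : CGParams) : ℝ := c.lmax / c.lmin

/-- The error reduction factor of the unperturbed step. -/
def CGParams.θ (c : CGParams) : ℝ := √(1 - c.γ ^ 2 / (2 * c.κ))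

/-- The requirements on the constants, for the Galerkin matrix of `A` on the index set `Λ`. -/
structure CGParams.Valid {ι : Type*} (c : CGParams) (A : L2 ι →L[ℝ] L2 ι) (Λ : Set ι) : Prop where
  lmin_pos : 0 < c.lmin
  lmin_le : c.lmin ≤ c.lmax
  lower : ∀ v, SuppIn Λ v → c.lmin * ‖v‖ ^ 2 ≤ inner ℝ v (A v)
  upper : ∀ v, SuppIn Λ v → inner ℝ v (A v) ≤ c.lmax * ‖v‖ ^ 2
  τ_pos : 0 < c.τ
  τ_lt : c.τ < 1 / √(1 + c.κ ^ 2)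
  δ₁_pos : 0 < c.δ₁
  δ₂_pos : 0 < c.δ₂
  γ_pos : 0 < c.γ
  γ_lt : c.γ < 1
  δ_le : 3 / 2 * c.δ₁ + c.δ₂ ≤ 1 / c.τ ^ 2 - (1 + c.κ ^ 2)
  γ_le : c.γ ≤ (1 - c.δ₁ / 2) * c.τ
  μ_nonneg : 0 ≤ c.μ
  μ_lt : c.μ < c.θ⁻¹ - 1

/-- `x'` is a result of `PCG(A, f, x₀, Λ, tol)`: the truncated conjugate gradient iteration in
`ℓ₂(Λ)` for the Galerkin system on `Λ`, started at `x₀` and stopped as soon as the norm of the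
residual is at most `tol`. The perturbations `e₁`, `e₂` of the directions and of the iterates are
arbitrary elements of `ℓ₂(Λ)` that obey the tolerances of the method. -/
def IsPCG {ι : Type*} (A : L2 ι →L[ℝ] L2 ι) (f x₀ : L2 ι) (Λ : Set ι) (tol : ℝ)
    (x' : L2 ι) : Prop :=
  ∃ (c : CGParams) (I : ℕ) (x r p e₁ e₂ : ℕ → L2 ι) (a b : ℕ → ℝ),
    c.Valid A Λ ∧
    (∀ i, SuppIn Λ (e₁ i) ∧ SuppIn Λ (e₂ i)) ∧
    x 0 = x₀ ∧
    (∀ i, r i = restr Λ (f - A (x i))) ∧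
    p 0 = r 0 + e₁ 0 ∧
    (∀ i < I,
      a i = inner ℝ (r i) (p i) / inner ℝ (p i) (A (p i)) ∧
      x (i + 1) = x i + a i • p i + e₂ (i + 1) ∧
      b i = -(inner ℝ (r (i + 1)) (A (p i)) / inner ℝ (p i) (A (p i))) ∧
      p (i + 1) = r (i + 1) + b i • p i + e₁ (i + 1)) ∧
    ‖e₁ 0‖ ≤ c.δ₁ / 2 * ‖r 0‖ ∧
    (∀ i < I,
      ‖e₁ (i + 1)‖ ≤ c.δ₁ / 2 * ‖r (i + 1)‖ ∧
      2 * |b i| * ‖p i‖ * ‖e₁ (i + 1)‖ ≤ c.δ₂ * ‖r (i + 1)‖ ^ 2 ∧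
      ‖e₂ (i + 1)‖ ≤ c.θ * c.μ * c.lmax⁻¹ * ‖r i‖) ∧
    (∀ i < I, tol < ‖r i‖) ∧ ‖r I‖ ≤ tol ∧ x' = x I

/-! ### Separable scaling -/

/-- One term `h w(x) exp(-α(x) t)` of the exponential sum, at the node `x`, with
`w(x) = 2 / (√π (1 + e^{-x}))` and `α(x) = ln²(1 + e^x)`. -/
def expTerm (h x t : ℝ) : ℝ :=
  h * (2 / √Real.pi * (1 + Real.exp (-x))⁻¹) * Real.exp (-(Real.log (1 + Real.exp x) ^ 2 * t))

/-- The exponential sum over the nodes `k h`, `-n ≤ k ≤ n⁺`, which approximates `t ^ (-1/2)`. -/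
def expSum (h : ℝ) (nplus n : ℕ) (t : ℝ) : ℝ :=
  ∑ k ∈ Finset.Icc (-(n : ℤ)) (nplus : ℤ), expTerm h (k * h) t

/-- The limit `n → ∞` of `expSum`: the sum over all nodes `k h` with `k ≤ n⁺`. -/
def expSumLim (h : ℝ) (nplus : ℕ) (t : ℝ) : ℝ :=
  ∑' i : ℕ, expTerm h (((nplus : ℝ) - i) * h) t

/-! ### The discretized problem -/

/-- The data of the problem, of the separable preconditioner and of the residual evaluation. -/
structure Problem (d R : ℕ) (J : Type*) where
  /-- `‖ψ_x‖_{H¹}` for the one-dimensional basis function with index `x` in direction `j` -/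
  weight : Fin d → J → ℝ
  /-- the one-dimensional components: `A = ∑_n ⨂_j comp n j` -/
  comp : Fin R → Fin d → J → J → ℝ
  /-- order of differentiation of the test function in the component `(n, j)` -/
  testOrd : Fin R → Fin d → ℕ
  /-- order of differentiation of the trial function in the component `(n, j)` -/
  trialOrd : Fin R → Fin d → ℕ
  /-- the one-dimensional components, scaled to operators on `ℓ₂(J)` -/
  compHat : Fin R → Fin d → L2 J →L[ℝ] L2 J
  /-- compressed versions of the scaled components -/
  compressed : Fin R → Fin d → ℕ → L2 J →L[ℝ] L2 J
  /-- accuracy of the separable scaling -/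
  δ : ℝ
  /-- step size of the exponential sum -/
  h : ℝ
  /-- upper summation limit of the exponential sum -/
  nplus : ℕ
  /-- the right-hand side `f` -/
  f : MIdx d J → ℝ
  /-- the finitely supported approximations `f_ε` -/
  fApprox : ℝ → (MIdx d J →₀ ℝ)
  /-- the preconditioned operator `A^δ` -/
  Aδ : L2 (MIdx d J) →L[ℝ] L2 (MIdx d J)
  /-- the preconditioned right-hand side `f^δ` -/
  fδ : L2 (MIdx d J)
  /-- the solution `u^δ` -/
  uδ : L2 (MIdx d J)

namespace Problem

variable {d R : ℕ} {J : Type*} (P : Problem d R J)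

/-- The scaling weight `t = ∑_j ‖ψ_{λ_j}‖²_{H¹}`. -/
def t (l : MIdx d J) : ℝ := ∑ j, P.weight j (l j) ^ 2

/-- The diagonal of `D`. -/
def D (l : MIdx d J) : ℝ := √(P.t l)

/-- The diagonal of `S⁻¹(δ)`. -/
def Sinv (l : MIdx d J) : ℝ := expSumLim P.h P.nplus (P.t l)

/-- The diagonal of `S⁻¹(δ, η)`, where `η` determines the number `n`. -/
def SinvN (n : ℕ) (l : MIdx d J) : ℝ := expSum P.h P.nplus n (P.t l)

/-- The entries of the (unscaled) matrix `A`. -/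
def matA (l m : MIdx d J) : ℝ := ∑ n, ∏ j, P.comp n j (l j) (m j)

/-- The parameters of the separable scaling are chosen as required. -/
structure ScalingValid : Prop where
  weight_pos : ∀ j x, 0 < P.weight j x
  one_le_t : ∀ l, 1 ≤ P.t l
  δ_pos : 0 < P.δ
  δ_lt : P.δ < 1
  h_pos : 0 < P.h
  h_lt : P.h < Real.pi ^ 2 / (5 * (|Real.log (P.δ / 2)| + 4))
  nplus_ge : P.h⁻¹ * max (4 / √Real.pi) (√|Real.log (P.δ / 2)|) ≤ P.nplus

/-- `A` is separable with components which, scaled by the one-dimensional weights according to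
the orders of differentiation, are the matrices of the bounded operators `compHat n j`. In each
term the test and the trial function are differentiated at most once. -/
structure Separable : Prop where
  testOrd_le : ∀ n, ∑ j, P.testOrd n j ≤ 1
  trialOrd_le : ∀ n, ∑ j, P.trialOrd n j ≤ 1
  entry_eq : ∀ n j x y, entry (P.compHat n j) x y =
    (P.weight j x ^ P.testOrd n j)⁻¹ * P.comp n j x y * (P.weight j y ^ P.trialOrd n j)⁻¹

/-- `A^δ = S⁻¹(δ) A S⁻¹(δ)`, `f^δ = S⁻¹(δ) f` and `A^δ u^δ = f^δ`, where `A^δ` is a bounded,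
symmetric and positive definite operator with spectrum in `[lmin, lmax]`. -/
structure Equation (lmin lmax : ℝ) : Prop where
  entry_eq : ∀ l m, entry P.Aδ l m = P.Sinv l * P.matA l m * P.Sinv m
  symm : ∀ v w, inner ℝ (P.Aδ v) w = inner ℝ v (P.Aδ w)
  lmin_pos : 0 < lmin
  lmin_le : lmin ≤ lmax
  lower : ∀ v, lmin * ‖v‖ ^ 2 ≤ inner ℝ v (P.Aδ v)
  upper : ∀ v, inner ℝ v (P.Aδ v) ≤ lmax * ‖v‖ ^ 2
  rhs : ∀ l, P.fδ l = P.Sinv l * P.f l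
  solution : P.Aδ P.uδ = P.fδ

/-- Efficient approximability of the right-hand side: `‖D⁻¹ (f - f_ε)‖ ≤ ε`, and with
`f^δ_ε = S⁻¹(δ) f_ε` (the vector `g` below)
`∑_j #supp_j f^δ_ε ≤ C ε^{-1/s} (∑_j ‖π_j f^δ‖_{𝒜_s})^{1/s}` and
`∑_j ‖π_j f^δ_ε‖_{𝒜_s} ≤ C ∑_j ‖π_j f^δ‖_{𝒜_s}`, with `C` independent of `ε`. -/
def RhsApproximable (s : ℝ) : Prop :=
  ∃ C : ℝ, 0 < C ∧ ∀ ε : ℝ, 0 < ε →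
    (∃ e : L2 (MIdx d J), (∀ l, e l = (P.D l)⁻¹ * (P.f l - P.fApprox ε l)) ∧ ‖e‖ ≤ ε) ∧
    ∃ g : L2 (MIdx d J), (∀ l, g l = P.Sinv l * P.fApprox ε l) ∧
      (∑ j, ((Function.support (contraction j g)).encard : ℝ≥0∞)) ≤
        ENNReal.ofReal (C * ε ^ (-1 / s)) *
          (∑ j, asNorm s (contraction j P.fδ)) ^ (1 / s) ∧
      (∑ j, asNorm s (contraction j g)) ≤
        ENNReal.ofReal C * ∑ j, asNorm s (contraction j P.fδ)

/-! ### Residual evaluation -/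

open Classical in
/-- The entries of the adaptively compressed component `∑_{p ≤ L} A_{[L-p]} R_{Γ p \ Γ (p-1)}`
(with `Γ (-1) = ∅`), with the scaling undone. -/
def compL (Γ : ℕ → Finset J) (L : ℕ) (n : Fin R) (j : Fin d) (x y : J) : ℝ :=
  if y ∈ Γ L then
    P.weight j x ^ P.testOrd n j *
      entry (P.compressed n j (L - sInf {p | y ∈ Γ p})) x y * P.weight j y ^ P.trialOrd n j
  else 0

/-- The entries of the compressed operator built from the layers `Γ j` and the level `L`. -/
def matL (Γ : Fin d → ℕ → Finset J) (L : ℕ) (l m : MIdx d J) : ℝ :=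
  ∑ n, ∏ j, P.compL (Γ j) L n j (l j) (m j)

/-- `‖D⁻¹ (A - A_L) D⁻¹ v‖ ≤ ε` for the compressed operator `A_L` of level `L`. -/
def ApplyAccurate (Γ : Fin d → ℕ → Finset J) (v : L2 (MIdx d J)) (ε : ℝ) (L : ℕ) : Prop :=
  ∃ e : L2 (MIdx d J),
    (∀ l, e l = (P.D l)⁻¹ * ∑' m, (P.matA l m - P.matL Γ L l m) * ((P.D m)⁻¹ * v m)) ∧ ‖e‖ ≤ ε

/-- `r` is a result of `RES(v, ω₁)` for a finitely supported `v`: an approximate residual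
`r = S⁻¹(δ,η) (f_ε - A_ε S⁻¹(δ,η) v)` with relative accuracy `ω₁`. Here `tol` is the absolute
tolerance, which is comparable to `‖r‖`; `ε` is the corresponding tolerance for the data; `A_ε`
is the compressed operator, of the smallest level `L` that meets the tolerance `ε`; and `n` is
large enough for the accuracy `η` on all indices that occur. For an exact solution `v` the
residual is zero. -/
def IsRES (cRes ω₁ : ℝ) (v r : L2 (MIdx d J)) : Prop :=
  (P.fδ = P.Aδ v ∧ r = 0) ∨
  ‖P.fδ - P.Aδ v - r‖ ≤ ω₁ * ‖r‖ ∧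
  ∃ (tol ε η T : ℝ) (Γ : Fin d → ℕ → Finset J) (L n : ℕ) (g : MIdx d J → ℝ),
    0 < tol ∧ cRes * ‖r‖ ≤ tol ∧ tol ≤ ω₁ * ‖r‖ ∧
    ε = tol / (3 * (1 + P.δ) * (2 + P.δ)) ∧
    (∀ j, IsBestLayers (contraction j v) (Γ j)) ∧
    IsLeast {L | P.ApplyAccurate Γ v ε L} L ∧
    (∀ l, g l = ∑' m, P.matL Γ L l m * (P.SinvN n m * v m)) ∧
    0 < η ∧ 1 < T ∧
    (∀ l, (v l ≠ 0 ∨ P.fApprox ε l ≠ 0 ∨ g l ≠ 0) → P.t l ≤ T) ∧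
    P.h⁻¹ * (Real.log (2 / √Real.pi) + |Real.log (min (P.δ / 2) η)| + 1 / 2 * Real.log T) ≤ n ∧
    ∀ l, r l = P.SinvN n l * (P.fApprox ε l - g l)

end Problem

/-! ### The adaptive algorithm -/

/-- The parameters of the algorithm. -/
structure Params (d : ℕ) (J : Type*) where
  /-- the initial product index set -/
  Λ₀ : Fin d → Finset J
  /-- the dimension tree of the tensor format -/
  tree : DimTree d
  /-- the bulk parameter `α` -/
  bulk : ℝ
  ω₀ : ℝ
  ω₁ : ℝ
  ω₂ : ℝ
  ω₃ : ℝ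
  ω₄ : ℝ
  ω₅ : ℝ
  /-- the maximal number of inner iterations -/
  M : ℕ
  /-- lower spectral bound of `A^δ` -/
  lmin : ℝ
  /-- upper spectral bound of `A^δ` -/
  lmax : ℝ
  /-- quasi-optimality constant of `COARSE` -/
  K : ℝ
  /-- `RES` works with absolute tolerances between `cRes ‖r‖` and `ω₁ ‖r‖` -/
  cRes : ℝ

namespace Params

variable {d : ℕ} {J : Type*} (q : Params d J)

/-- The condition number of `A^δ`. -/
def κ : ℝ := q.lmax / q.lmin

/-- The tolerance `ω₀^{(k)} = (ω₃ + ω₄ + ω₅)^k ω₀`. -/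
def ω₀k (k : ℕ) : ℝ := (q.ω₃ + q.ω₄ + q.ω₅) ^ k * q.ω₀

/-- The error reduction factor of the inner iterations. -/
def ϑ : ℝ :=
  √(1 - ((q.bulk - q.ω₁) / (1 + q.ω₁)) ^ 2 * q.κ⁻¹ + (q.ω₂ / (1 - q.ω₁)) ^ 2 * q.κ)

/-- The requirements on the parameters for convergence. -/
structure Convergence : Prop where
  Λ₀_nonempty : ∀ j, (q.Λ₀ j).Nonempty
  tree : q.tree.IsDimTree
  bulk_lt : q.bulk < 1
  ω₀_pos : 0 < q.ω₀
  ω₁_pos : 0 < q.ω₁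
  ω₁_lt : q.ω₁ < q.bulk
  ω₂_pos : 0 < q.ω₂
  ω₂_lt : q.ω₂ < (1 - q.ω₁) * (q.bulk - q.ω₁) / (1 + q.ω₁) * q.κ⁻¹
  ω₃_pos : 0 < q.ω₃
  ω₄_pos : 0 < q.ω₄
  ω₅_pos : 0 < q.ω₅
  sum_lt : q.ω₃ + q.ω₄ + q.ω₅ < 1
  M_ge : ⌈|Real.log (q.ω₃ * q.κ ^ (-1 / 2 : ℝ)) / Real.log q.ϑ|⌉₊ ≤ q.M
  K_ge : 1 ≤ q.K
  cRes_pos : 0 < q.cRes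
  cRes_le : q.cRes ≤ q.ω₁

end Params

/-- `Reach P q ε k m Λ u ρ`: a run of the algorithm with the target tolerance `ε` arrives at the
iteration `(k, m)` with `Λ^{(k,m)} = Λ`, `u^{(k,m)} = u` and `‖r^{(k,m)}‖ = ρ`. -/
inductive Reach {d R : ℕ} {J : Type*} (P : Problem d R J) (q : Params d J) (ε : ℝ) :
    ℕ → ℕ → (Fin d → Finset J) → L2 (MIdx d J) → ℝ → Prop
  | init : Reach P q ε 0 0 q.Λ₀ 0 q.ω₀
  /-- solve, estimate, and expand the index set -/
  | inner {k m : ℕ} {Λ Λ' : Fin d → Finset J} {u u' r : L2 (MIdx d J)} {ρ : ℝ}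
      (prev : Reach P q ε k m Λ u ρ)
      (solve : IsPCG P.Aδ P.fδ u (box Λ) (q.ω₂ * ρ) u')
      (estimate : P.IsRES q.cRes q.ω₁ u' r)
      (not_done : ε < (1 + q.ω₁) * ‖r‖)
      (not_small : q.ω₃ * q.ω₀k k < (1 + q.ω₁) * ‖r‖) (not_last : m ≠ q.M)
      (expand : IsExpand q.K Λ r q.bulk Λ') :
      Reach P q ε k (m + 1) Λ' u' ‖r‖
  /-- solve, estimate, then truncate the ranks and coarsen -/
  | outer {k m : ℕ} {Λ Λ' : Fin d → Finset J} {u u' r w v r' : L2 (MIdx d J)} {ρ : ℝ}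
      (prev : Reach P q ε k m Λ u ρ)
      (solve : IsPCG P.Aδ P.fδ u (box Λ) (q.ω₂ * ρ) u')
      (estimate : P.IsRES q.cRes q.ω₁ u' r)
      (not_done : ε < (1 + q.ω₁) * ‖r‖)
      (finished : (1 + q.ω₁) * ‖r‖ ≤ q.ω₃ * q.ω₀k k ∨ m = q.M)
      (trunc : IsTrunc q.tree u' (q.ω₄ * q.lmin⁻¹ * q.ω₀k k) w)
      (coarse : IsCoarse q.K w (q.ω₅ * q.lmin⁻¹ * q.ω₀k k) v)
      (supp : ∀ j, (Λ' j : Set J) = Function.support (contraction j v))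
      (estimate' : P.IsRES q.cRes q.ω₁ v r') :
      Reach P q ε (k + 1) 0 Λ' v ‖r'‖

end HTAWGM

end

noncomputable section

namespace HTAWGM

/-!
Let `x_k = ω₀k k / lmin`. In the energy norm, one inner iteration is a Galerkin step on a set that
captures a fixed fraction of the residual, and it reduces the squared error by the factor `ϑ ^ 2`
up to the inexactness of the solver. Hence the error is at most a constant times `x_k` throughout
the `k`-th outer iteration and at most `9 / 5 * ω₃ * x_k` at its end. It then suffices to bound the
sizes of the index sets by `C * x_k ^ (-1 / s)`.

* At the start of an outer iteration, the truncation does not increase the tails of the contractions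
  of the iterate, since in each mode it acts as a contraction on the other modes. These tails are
  close to those of the solution, so that any sets adapted to the solution for a tolerance
  proportional to `x_k` compete with the coarse set.
* In an inner iteration, the new indices come from the support of the approximate residual. The
  contractions of the iterate decay like those of the solution on all layers that matter, so the
  compressed operator meets its tolerance at a level `L` with `2 ^ L` at most a constant times
  `x_k ^ (-1 / s)`, and its columns have few entries. As there are at most `M` inner iterations, the
  constants may deteriorate from one to the next.

The right-hand side lies in the same approximation class as the solution because it is the image of
the solution under the compressible operator. If the solution vanishes, the algorithm stops before
its first update.
-/

/-! ### Norms in `ℓ₂` and restrictions -/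

section Basics

variable {ι : Type*}

theorem summable_sq (v : L2 ι) : Summable fun i => v i ^ 2 := by
  simpa using (lp.memℓp v).summable (by norm_num)

theorem norm_sq_eq_tsum (v : L2 ι) : ‖v‖ ^ 2 = ∑' i, v i ^ 2 := by
  simpa using lp.norm_rpow_eq_tsum (p := 2) (by norm_num) v

theorem ofReal_norm_sq (v : L2 ι) :
    ENNReal.ofReal (‖v‖ ^ 2) = ∑' i, ENNReal.ofReal (v i ^ 2) := by
  rw [norm_sq_eq_tsum, ENNReal.ofReal_tsum_of_nonneg (fun i => sq_nonneg _) (summable_sq v)]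

theorem memℓp_of_tsum_ne_top {g : ι → ℝ} (h : ∑' i, ENNReal.ofReal (g i ^ 2) ≠ ⊤) :
    Memℓp g 2 := by
  refine memℓp_gen ((ENNReal.summable_toReal h).congr fun i => ?_)
  rw [ENNReal.toReal_ofReal (sq_nonneg _)]
  simp

theorem norm_le_of_tsum_le {v : L2 ι} {c : ℝ} (hc : 0 ≤ c)
    (h : ∑' i, ENNReal.ofReal (v i ^ 2) ≤ ENNReal.ofReal (c ^ 2)) : ‖v‖ ≤ c := by
  rw [← ofReal_norm_sq, ENNReal.ofReal_le_ofReal_iff (sq_nonneg _)] at h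
  exact le_of_sq_le_sq h hc

theorem exists_of_tsum_le {g : ι → ℝ} {c : ℝ} (hc : 0 ≤ c)
    (h : ∑' i, ENNReal.ofReal (g i ^ 2) ≤ ENNReal.ofReal (c ^ 2)) :
    ∃ e : L2 ι, (∀ i, e i = g i) ∧ ‖e‖ ≤ c :=
  ⟨⟨g, memℓp_of_tsum_ne_top (ne_top_of_le_ne_top ENNReal.ofReal_ne_top h)⟩, fun _ => rfl,
    norm_le_of_tsum_le hc h⟩

theorem exists_of_abs_le_mul {g : ι → ℝ} {c : ℝ} (hc : 0 ≤ c) (v : L2 ι)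
    (h : ∀ i, |g i| ≤ c * |v i|) : ∃ e : L2 ι, (∀ i, e i = g i) ∧ ‖e‖ ≤ c * ‖v‖ := by
  refine exists_of_tsum_le (mul_nonneg hc (norm_nonneg _)) ?_
  rw [mul_pow, ENNReal.ofReal_mul (sq_nonneg _), ofReal_norm_sq, ← ENNReal.tsum_mul_left]
  refine ENNReal.tsum_le_tsum fun i => ?_
  rw [← ENNReal.ofReal_mul (sq_nonneg _), ← mul_pow]
  refine ENNReal.ofReal_le_ofReal (sq_le_sq.2 ((h i).trans_eq ?_))
  rw [abs_mul, abs_of_nonneg hc]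

theorem norm_le_of_abs_le_mul {v w : L2 ι} {c : ℝ} (hc : 0 ≤ c) (h : ∀ i, |v i| ≤ c * |w i|) :
    ‖v‖ ≤ c * ‖w‖ := by
  obtain ⟨e, hev, he⟩ := exists_of_abs_le_mul hc w h
  rwa [lp.ext (funext hev)] at he

theorem norm_le_of_abs_le {v w : L2 ι} (h : ∀ i, |v i| ≤ |w i|) : ‖v‖ ≤ ‖w‖ := by
  simpa using norm_le_of_abs_le_mul zero_le_one (by simpa using h)

open Classical in
theorem restr_apply (Λ : Set ι) (v : L2 ι) (i : ι) :
    restr Λ v i = if i ∈ Λ then v i else 0 :=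
  Set.indicator_apply Λ (v : ι → ℝ) i

theorem restr_of_mem {Λ : Set ι} {i : ι} (h : i ∈ Λ) (v : L2 ι) : restr Λ v i = v i := by
  rw [restr_apply, if_pos h]

theorem restr_of_notMem {Λ : Set ι} {i : ι} (h : i ∉ Λ) (v : L2 ι) : restr Λ v i = 0 := by
  rw [restr_apply, if_neg h]

theorem suppIn_restr (Λ : Set ι) (v : L2 ι) : SuppIn Λ (restr Λ v) :=
  fun _ hi => restr_of_notMem hi v

theorem restr_eq_self {Λ : Set ι} {v : L2 ι} (h : SuppIn Λ v) : restr Λ v = v := by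
  ext i
  by_cases hi : i ∈ Λ
  · exact restr_of_mem hi v
  · rw [restr_of_notMem hi, h i hi]

theorem restr_univ (v : L2 ι) : restr Set.univ v = v :=
  restr_eq_self fun i hi => absurd (Set.mem_univ i) hi

theorem norm_restr_mono {Λ Λ' : Set ι} (h : Λ ⊆ Λ') (v : L2 ι) :
    ‖restr Λ v‖ ≤ ‖restr Λ' v‖ := by
  refine norm_le_of_abs_le fun i => ?_
  by_cases hi : i ∈ Λ
  · rw [restr_of_mem hi, restr_of_mem (h hi)]
  · simp [restr_of_notMem hi]

theorem inner_eq_tsum (v w : L2 ι) : inner ℝ v w = ∑' i, v i * w i := by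
  rw [lp.inner_eq_tsum]
  exact tsum_congr fun i => mul_comm _ _

/-- The closed subspace `ℓ₂(Λ)` of `ℓ₂(ι)`, whose orthogonal projection is `R_Λ`. -/
def suppSubmodule (Λ : Set ι) : Submodule ℝ (L2 ι) where
  carrier := {v | SuppIn Λ v}
  add_mem' hv hw i hi := by simp [hv i hi, hw i hi]
  zero_mem' _ _ := rfl
  smul_mem' c v hv i hi := by simp [hv i hi]

theorem sub_restr_mem_orthogonal (Λ : Set ι) (v : L2 ι) : v - restr Λ v ∈ (suppSubmodule Λ)ᗮ := by
  intro w hw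
  rw [inner_eq_tsum, ← tsum_zero]
  refine tsum_congr fun i => ?_
  by_cases hi : i ∈ Λ
  · simp [restr_of_mem hi]
  · simp [hw i hi]

instance hasOrthogonalProjection_suppSubmodule (Λ : Set ι) :
    (suppSubmodule Λ).HasOrthogonalProjection :=
  ⟨fun v => ⟨restr Λ v, suppIn_restr Λ v, sub_restr_mem_orthogonal Λ v⟩⟩

theorem starProjection_suppSubmodule (Λ : Set ι) (v : L2 ι) :
    (suppSubmodule Λ).starProjection v = restr Λ v :=
  Submodule.eq_starProjection_of_mem_orthogonal (suppIn_restr Λ v) (sub_restr_mem_orthogonal Λ v)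

/-- The restriction `R_Λ` as a bounded operator. -/
def restrL (Λ : Set ι) : L2 ι →L[ℝ] L2 ι := (suppSubmodule Λ).starProjection

@[simp]
theorem restrL_apply (Λ : Set ι) (v : L2 ι) : restrL Λ v = restr Λ v :=
  starProjection_suppSubmodule Λ v

theorem norm_restr_le (Λ : Set ι) (v : L2 ι) : ‖restr Λ v‖ ≤ ‖v‖ := by
  rw [← restrL_apply]
  exact Submodule.norm_starProjection_apply_le _ v

theorem restr_sub (Λ : Set ι) (v w : L2 ι) : restr Λ (v - w) = restr Λ v - restr Λ w := by
  simp only [← restrL_apply, map_sub]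

theorem sub_restr (Λ : Set ι) (v : L2 ι) : v - restr Λ v = restr Λᶜ v := by
  ext i
  by_cases hi : i ∈ Λ <;> simp [restr_apply, hi]

theorem norm_sq_restr_add (Λ : Set ι) (v : L2 ι) :
    ‖restr Λ v‖ ^ 2 + ‖v - restr Λ v‖ ^ 2 = ‖v‖ ^ 2 := by
  rw [Submodule.norm_sq_eq_add_norm_sq_starProjection v (suppSubmodule Λ),
    Submodule.starProjection_orthogonal_val, starProjection_suppSubmodule]

theorem SuppIn.mono {Λ Λ' : Set ι} (h : Λ ⊆ Λ') {v : L2 ι} (hv : SuppIn Λ v) : SuppIn Λ' v :=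
  fun i hi => hv i fun hi' => hi (h hi')

open Classical in
theorem restr_finset_eq_sum_single (F : Finset ι) (v : L2 ι) :
    restr (F : Set ι) v = ∑ y ∈ F, lp.single 2 y (v y) := by
  ext i
  rw [restr_apply, lp.coeFn_sum, Finset.sum_apply]
  simp [Pi.single_apply]

open Classical in
theorem apply_of_suppIn (B : L2 ι →L[ℝ] L2 ι) {F : Finset ι} {v : L2 ι}
    (hv : SuppIn (F : Set ι) v) (x : ι) : B v x = ∑ y ∈ F, entry B x y * v y := by
  have hsum : v = ∑ y ∈ F, v y • lp.single 2 y (1 : ℝ) := by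
    conv_lhs => rw [← restr_eq_self hv, restr_finset_eq_sum_single]
    simp [← lp.single_smul]
  conv_lhs => rw [hsum, map_sum, lp.coeFn_sum, Finset.sum_apply]
  refine Finset.sum_congr rfl fun y _ => ?_
  rw [map_smul]
  simp [entry, mul_comm]

theorem exists_finset_norm_sub_restr_le (w : L2 ι) {ε : ℝ} (hε : 0 < ε) :
    ∃ F : Finset ι, ‖w - restr (F : Set ι) w‖ ≤ ε := by
  classical
  obtain ⟨F, hF⟩ := (Metric.tendsto_nhds.1 (lp.hasSum_single (p := 2) (by norm_num) w) ε hε).exists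
  refine ⟨F, ?_⟩
  rw [restr_finset_eq_sum_single, ← dist_eq_norm, dist_comm]
  exact hF.le

end Basics

/-! ### Contractions and tails -/

section Contractions

variable {d : ℕ} {J : Type*}

open Classical in
theorem ofReal_contraction_sq (j : Fin d) (v : L2 (MIdx d J)) (x : J) :
    ENNReal.ofReal (contraction j v x ^ 2) =
      ∑' l : MIdx d J, if l j = x then ENNReal.ofReal (v l ^ 2) else 0 := by
  have nonneg : ∀ l : MIdx d J, 0 ≤ if l j = x then v l ^ 2 else 0 := fun l => by
    split_ifs <;> positivity
  have summable : Summable fun l : MIdx d J => if l j = x then v l ^ 2 else 0 :=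
    Summable.of_nonneg_of_le nonneg
      (fun l => by split_ifs <;> first | exact le_rfl | positivity) (summable_sq v)
  have hsq : contraction j v x ^ 2 = ∑' l : MIdx d J, if l j = x then v l ^ 2 else 0 :=
    Real.sq_sqrt (tsum_nonneg nonneg)
  rw [hsq, ENNReal.ofReal_tsum_of_nonneg nonneg summable]
  exact tsum_congr fun l => by split_ifs <;> simp

theorem norm_restr_contraction (j : Fin d) (S : Set J) (v : L2 (MIdx d J)) :
    ‖restr S (contraction j v)‖ = ‖restr {l : MIdx d J | l j ∈ S} v‖ := by
  classical
  rw [← sq_eq_sq₀ (norm_nonneg _) (norm_nonneg _), ← ENNReal.ofReal_eq_ofReal_iff (sq_nonneg _)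
    (sq_nonneg _), ofReal_norm_sq, ofReal_norm_sq]
  have hslice : ∀ x, ENNReal.ofReal (restr S (contraction j v) x ^ 2) =
      ∑' l : MIdx d J, if l j = x then (if x ∈ S then ENNReal.ofReal (v l ^ 2) else 0) else 0 := by
    intro x
    by_cases hx : x ∈ S
    · simp only [restr_of_mem hx, hx, if_true, ofReal_contraction_sq]
    · simp [restr_of_notMem hx, hx]
  simp_rw [hslice]
  rw [ENNReal.tsum_comm]
  refine tsum_congr fun l => ?_
  rw [tsum_eq_single (l j) fun x hx => if_neg hx.symm]
  by_cases hx : l j ∈ S <;> simp [restr_apply, hx]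

theorem norm_contraction_sub_restr (j : Fin d) (F : Finset J) (v : L2 (MIdx d J)) :
    ‖contraction j v - restr (F : Set J) (contraction j v)‖ =
      ‖restr {l : MIdx d J | l j ∉ F} v‖ := by
  rw [sub_restr, norm_restr_contraction]
  rfl

theorem norm_contraction (j : Fin d) (v : L2 (MIdx d J)) : ‖contraction j v‖ = ‖v‖ := by
  simpa [restr_univ] using norm_restr_contraction j Set.univ v

theorem contraction_ne_zero_iff (j : Fin d) (v : L2 (MIdx d J)) (x : J) :
    contraction j v x ≠ 0 ↔ ∃ l : MIdx d J, l j = x ∧ v l ≠ 0 := by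
  classical
  have hsq : ∀ a : ℝ, ENNReal.ofReal (a ^ 2) = 0 ↔ a = 0 := fun a => by
    rw [ENNReal.ofReal_eq_zero, sq_nonpos_iff]
  rw [Ne, ← hsq, ofReal_contraction_sq, ENNReal.tsum_eq_zero]
  simp [hsq]

theorem tail_sq (v : L2 (MIdx d J)) (Λ : Fin d → Finset J) :
    tail v Λ ^ 2 = ∑ j, ‖restr {l : MIdx d J | l j ∉ Λ j} v‖ ^ 2 := by
  rw [tail, Real.sq_sqrt (Finset.sum_nonneg fun j _ => sq_nonneg _)]
  simp_rw [norm_contraction_sub_restr]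

theorem tail_nonneg (v : L2 (MIdx d J)) (Λ : Fin d → Finset J) : 0 ≤ tail v Λ :=
  Real.sqrt_nonneg _

theorem tail_le (v : L2 (MIdx d J)) (Λ : Fin d → Finset J) {b : ℝ} (hb : 0 ≤ b)
    (h : ∀ j, ‖restr {l : MIdx d J | l j ∉ Λ j} v‖ ≤ b) : tail v Λ ≤ √d * b := by
  refine le_of_sq_le_sq ?_ (by positivity)
  rw [tail_sq, mul_pow, Real.sq_sqrt (Nat.cast_nonneg _)]
  refine (Finset.sum_le_sum fun j _ => pow_le_pow_left₀ (norm_nonneg _) (h j) 2).trans ?_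
  simp

theorem norm_sub_restr_box_le (v : L2 (MIdx d J)) (Λ : Fin d → Finset J) :
    ‖v - restr (box Λ) v‖ ≤ tail v Λ := by
  refine le_of_sq_le_sq ?_ (tail_nonneg _ _)
  rw [sub_restr, tail_sq, ← ENNReal.ofReal_le_ofReal_iff (by positivity),
    ENNReal.ofReal_sum_of_nonneg fun _ _ => sq_nonneg _]
  simp_rw [ofReal_norm_sq]
  rw [← Summable.tsum_finsetSum fun _ _ => ENNReal.summable]
  refine ENNReal.tsum_le_tsum fun l => ?_
  by_cases hl : l ∈ box Λ
  · simp [restr_of_notMem (show l ∉ (box Λ)ᶜ from fun h => h hl)]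
  · obtain ⟨j, hj⟩ : ∃ j, l j ∉ Λ j := not_forall.1 hl
    rw [restr_of_mem hl, ← restr_of_mem (Λ := {l : MIdx d J | l j ∉ Λ j}) hj v]
    exact Finset.single_le_sum (f := fun j : Fin d =>
      ENNReal.ofReal (restr {l : MIdx d J | l j ∉ Λ j} v l ^ 2)) (fun _ _ => zero_le)
      (Finset.mem_univ j)

theorem tail_eq_zero {v : L2 (MIdx d J)} {Λ : Fin d → Finset J} (h : SuppIn (box Λ) v) :
    tail v Λ = 0 := by
  refine le_antisymm ((tail_le v Λ le_rfl fun j => ?_).trans (by simp)) (tail_nonneg _ _)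
  refine (norm_le_of_abs_le_mul (w := v) le_rfl fun l => ?_).trans (by simp)
  by_cases hl : l j ∈ Λ j
  · simp [restr_apply, hl]
  · simp [restr_apply, h l fun hbox => hl (hbox j)]

theorem coe_piFinset_eq_box [DecidableEq (Fin d)] (Λ : Fin d → Finset J) :
    (Fintype.piFinset Λ : Set (MIdx d J)) = box Λ := by
  ext l
  simp [box]

end Contractions

/-! ### Energy estimates for approximate Galerkin solutions -/

section Energy

variable {E : Type*} [NormedAddCommGroup E] [InnerProductSpace ℝ E]

/-- `A` is symmetric with spectrum in `[lmin, lmax]`, where `lmin > 0`. -/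
structure SpectralBounds (A : E →L[ℝ] E) (lmin lmax : ℝ) : Prop where
  symm : ∀ v w, inner ℝ (A v) w = inner ℝ v (A w)
  lmin_pos : 0 < lmin
  lmin_le : lmin ≤ lmax
  lower : ∀ v, lmin * ‖v‖ ^ 2 ≤ inner ℝ v (A v)
  upper : ∀ v, inner ℝ v (A v) ≤ lmax * ‖v‖ ^ 2

/-- The squared energy norm `⟨e, A e⟩`. -/
def energy (A : E →L[ℝ] E) (e : E) : ℝ := inner ℝ e (A e)

theorem norm_starProjection_of_bulk (K : Submodule ℝ E) [K.HasOrthogonalProjection] {a r : E}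
    {α ω : ℝ} (hω : 0 < ω) (hα : ω < α) (har : ‖a - r‖ ≤ ω * ‖r‖)
    (hbulk : α * ‖r‖ ≤ ‖K.starProjection r‖) :
    (α - ω) / (1 + ω) * ‖a‖ ≤ ‖K.starProjection a‖ := by
  have hle : ‖a‖ ≤ (1 + ω) * ‖r‖ := by linarith [norm_le_norm_add_norm_sub' a r]
  have hproj : ‖K.starProjection r‖ - ‖K.starProjection a‖ ≤ ω * ‖r‖ := by
    refine (norm_sub_norm_le _ _).trans ?_
    rw [← map_sub, ← norm_neg, ← map_neg, neg_sub]
    exact (K.norm_starProjection_apply_le _).trans har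
  calc (α - ω) / (1 + ω) * ‖a‖ ≤ (α - ω) / (1 + ω) * ((1 + ω) * ‖r‖) :=
        mul_le_mul_of_nonneg_left hle (div_nonneg (by linarith) (by linarith))
    _ = (α - ω) * ‖r‖ := by field_simp
    _ ≤ ‖K.starProjection a‖ := by linarith

namespace SpectralBounds

variable {A : E →L[ℝ] E} {lmin lmax : ℝ}

theorem lmax_pos (h : SpectralBounds A lmin lmax) : 0 < lmax := h.lmin_pos.trans_le h.lmin_le

theorem energy_add (h : SpectralBounds A lmin lmax) (e w : E) :
    energy A (e + w) = energy A e + 2 * inner ℝ (A e) w + energy A w := by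
  rw [energy, map_add, inner_add_left, inner_add_right, inner_add_right, ← h.symm e w,
    real_inner_comm (A e) w, energy, energy]
  ring

theorem energy_nonneg (h : SpectralBounds A lmin lmax) (e : E) : 0 ≤ energy A e :=
  (mul_nonneg h.lmin_pos.le (sq_nonneg _)).trans (h.lower e)

-- Quasi-optimality in the energy norm: only the component of `z - x` along `K` enters, and it is
-- controlled by the Galerkin residual.
theorem energy_le_of_residual_le (h : SpectralBounds A lmin lmax) {K : Submodule ℝ E}
    [K.HasOrthogonalProjection] {u x z : E} {δ : ℝ} (hxz : x - z ∈ K)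
    (hres : ‖K.starProjection (A (u - x))‖ ≤ δ) :
    energy A (u - x) ≤ energy A (u - z) + δ ^ 2 / lmin := by
  have hlmin := h.lmin_pos
  have hcross : -(δ * ‖x - z‖) ≤ inner ℝ (A (u - x)) (x - z) := by
    rw [← K.starProjection_eq_self_iff.2 hxz, ← K.inner_starProjection_left_eq_right,
      K.starProjection_eq_self_iff.2 hxz]
    exact (neg_le_neg (mul_le_mul_of_nonneg_right hres (norm_nonneg _))).trans
      (abs_le.1 (abs_real_inner_le_norm _ _)).1
  have hsquare : 0 ≤ δ ^ 2 / lmin - 2 * (δ * ‖x - z‖) + lmin * ‖x - z‖ ^ 2 := by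
    rw [show δ ^ 2 / lmin - 2 * (δ * ‖x - z‖) + lmin * ‖x - z‖ ^ 2 =
      (δ - lmin * ‖x - z‖) ^ 2 / lmin by field_simp; ring]
    positivity
  have hlower : lmin * ‖x - z‖ ^ 2 ≤ energy A (x - z) := h.lower (x - z)
  rw [← sub_add_sub_cancel u x z, h.energy_add]
  linarith

theorem energy_descent (h : SpectralBounds A lmin lmax) (K : Submodule ℝ E)
    [K.HasOrthogonalProjection] (e : E) :
    energy A (e - lmax⁻¹ • K.starProjection (A e)) ≤
      energy A e - ‖K.starProjection (A e)‖ ^ 2 / lmax := by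
  have hlmax := h.lmax_pos
  have hinner : inner ℝ (A e) (K.starProjection (A e)) = ‖K.starProjection (A e)‖ ^ 2 := by
    rw [← real_inner_self_eq_norm_sq, K.inner_starProjection_left_eq_right,
      K.starProjection_eq_self_iff.2 (K.starProjection_apply_mem _)]
  have hupper : energy A (-(lmax⁻¹ • K.starProjection (A e))) ≤
      ‖K.starProjection (A e)‖ ^ 2 / lmax := by
    refine (h.upper _).trans_eq ?_
    rw [norm_neg, norm_smul, Real.norm_of_nonneg (inv_nonneg.2 hlmax.le)]
    field_simp
  rw [sub_eq_add_neg, h.energy_add, inner_neg_right, inner_smul_right, hinner, inv_mul_eq_div]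
  linarith

theorem norm_apply_sq_le (h : SpectralBounds A lmin lmax) (e : E) :
    ‖A e‖ ^ 2 ≤ lmax * energy A e := by
  have hdescent := (h.energy_nonneg _).trans (h.energy_descent ⊤ e)
  rw [Submodule.starProjection_top, ContinuousLinearMap.id_apply, sub_nonneg,
    div_le_iff₀ h.lmax_pos] at hdescent
  linarith

theorem lmin_mul_norm_le (h : SpectralBounds A lmin lmax) (e : E) : lmin * ‖e‖ ≤ ‖A e‖ := by
  rcases (norm_nonneg e).eq_or_lt with h0 | h0
  · simp [← h0]
  · exact le_of_mul_le_mul_left (by linarith [(h.lower e).trans (real_inner_le_norm e (A e))]) h0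

theorem lmin_mul_energy_le (h : SpectralBounds A lmin lmax) (e : E) :
    lmin * energy A e ≤ ‖A e‖ ^ 2 := calc
  lmin * energy A e ≤ lmin * (‖e‖ * ‖A e‖) :=
    mul_le_mul_of_nonneg_left (real_inner_le_norm e (A e)) h.lmin_pos.le
  _ = lmin * ‖e‖ * ‖A e‖ := by ring
  _ ≤ ‖A e‖ * ‖A e‖ := mul_le_mul_of_nonneg_right (h.lmin_mul_norm_le e) (norm_nonneg _)
  _ = ‖A e‖ ^ 2 := (sq _).symm

theorem mul_energy_le_of_bulk (h : SpectralBounds A lmin lmax) {K : Submodule ℝ E}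
    [K.HasOrthogonalProjection] {e : E} {β : ℝ} (hβ : 0 ≤ β)
    (hbulk : β * ‖A e‖ ≤ ‖K.starProjection (A e)‖) :
    β ^ 2 * (lmax / lmin)⁻¹ * energy A e ≤ ‖K.starProjection (A e)‖ ^ 2 / lmax := by
  have hlmin := h.lmin_pos
  have hlmax := h.lmax_pos
  rw [le_div_iff₀ hlmax]
  calc β ^ 2 * (lmax / lmin)⁻¹ * energy A e * lmax = β ^ 2 * (lmin * energy A e) := by field_simp
    _ ≤ β ^ 2 * ‖A e‖ ^ 2 := mul_le_mul_of_nonneg_left (h.lmin_mul_energy_le e) (sq_nonneg β)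
    _ = (β * ‖A e‖) ^ 2 := (mul_pow _ _ _).symm
    _ ≤ ‖K.starProjection (A e)‖ ^ 2 := pow_le_pow_left₀ (by positivity) hbulk 2

theorem sq_div_lmin_le_of_le_norm (h : SpectralBounds A lmin lmax) {e : E} {c ρ ω : ℝ}
    (hc : 0 < c) (hρ : 0 ≤ ρ) (hle : c * ρ ≤ ‖A e‖) :
    (ω * ρ) ^ 2 / lmin ≤ (ω / c) ^ 2 * (lmax / lmin) * energy A e := by
  have hlmin := h.lmin_pos
  calc (ω * ρ) ^ 2 / lmin = (ω / c) ^ 2 / lmin * (c * ρ) ^ 2 := by field_simp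
    _ ≤ (ω / c) ^ 2 / lmin * (lmax * energy A e) :=
      mul_le_mul_of_nonneg_left
        ((pow_le_pow_left₀ (by positivity) hle 2).trans (h.norm_apply_sq_le e)) (by positivity)
    _ = (ω / c) ^ 2 * (lmax / lmin) * energy A e := by ring

-- The Galerkin solution is at least as good as a gradient step projected to `K`, which captures
-- the fraction `(α - ω₁) / (1 + ω₁)` of the exact residual.
theorem energy_step (h : SpectralBounds A lmin lmax) {K : Submodule ℝ E}
    [K.HasOrthogonalProjection] {u x x' r : E} {α ω₁ ω₂ : ℝ} (hω₁ : 0 < ω₁) (hα : ω₁ < α)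
    (hω₁_lt : ω₁ < 1) (hx : x' - x ∈ K) (hr : ‖A (u - x) - r‖ ≤ ω₁ * ‖r‖)
    (hbulk : α * ‖r‖ ≤ ‖K.starProjection r‖)
    (hres : ‖K.starProjection (A (u - x'))‖ ≤ ω₂ * ‖r‖) :
    energy A (u - x') ≤ (1 - ((α - ω₁) / (1 + ω₁)) ^ 2 * (lmax / lmin)⁻¹ +
      (ω₂ / (1 - ω₁)) ^ 2 * (lmax / lmin)) * energy A (u - x) := by
  set e := u - x with he
  have hstep : x' - (x + lmax⁻¹ • K.starProjection (A e)) ∈ K := by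
    rw [← sub_sub]
    exact K.sub_mem hx (K.smul_mem _ (K.starProjection_apply_mem _))
  have hquasi := h.energy_le_of_residual_le hstep hres
  rw [← sub_sub, ← he] at hquasi
  have hdecrease := h.mul_energy_le_of_bulk (div_nonneg (by linarith) (by linarith))
    (norm_starProjection_of_bulk K hω₁ hα hr hbulk)
  have htol := h.sq_div_lmin_le_of_le_norm (c := 1 - ω₁) (ρ := ‖r‖) (ω := ω₂) (e := e)
    (by linarith) (norm_nonneg r) (by linarith [norm_le_norm_add_norm_sub (A e) r])
  linarith [h.energy_descent K e]

end SpectralBounds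

end Energy

/-! ### Truncated conjugate gradients -/

namespace IsPCG

variable {ι : Type*} {A : L2 ι →L[ℝ] L2 ι} {f x₀ x' : L2 ι} {Λ : Set ι} {tol : ℝ}

theorem suppIn (h : IsPCG A f x₀ Λ tol x') (h₀ : SuppIn Λ x₀) : SuppIn Λ x' := by
  obtain ⟨c, I, x, r, p, e₁, e₂, a, b, -, he, hx0, hr, hp0, hstep, -, -, -, -, rfl⟩ := h
  have hr' : ∀ i, SuppIn Λ (r i) := fun i => hr i ▸ suppIn_restr _ _
  let V := suppSubmodule Λ
  suffices ∀ i ≤ I, x i ∈ V ∧ p i ∈ V from (this I le_rfl).1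
  intro i
  induction i with
  | zero => exact fun _ => ⟨hx0 ▸ h₀, hp0 ▸ V.add_mem (hr' 0) (he 0).1⟩
  | succ i ih =>
    intro hi
    obtain ⟨hx, hp⟩ := ih (by lia)
    obtain ⟨-, hx', -, hp'⟩ := hstep i (by lia)
    exact ⟨hx' ▸ V.add_mem (V.add_mem hx (V.smul_mem _ hp)) (he (i + 1)).2,
      hp' ▸ V.add_mem (V.add_mem (hr' (i + 1)) (V.smul_mem _ hp)) (he (i + 1)).1⟩

theorem norm_residual_le (h : IsPCG A f x₀ Λ tol x') : ‖restr Λ (f - A x')‖ ≤ tol := by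
  obtain ⟨c, I, x, r, p, e₁, e₂, a, b, -, -, -, hr, -, -, -, -, -, hI, rfl⟩ := h
  rwa [← hr I]

theorem eq_of_residual_le (h : IsPCG A f x₀ Λ tol x') (h₀ : ‖restr Λ (f - A x₀)‖ ≤ tol) :
    x' = x₀ := by
  obtain ⟨c, I, x, r, p, e₁, e₂, a, b, -, -, hx0, hr, -, -, -, -, hlt, -, rfl⟩ := h
  rcases I.eq_zero_or_pos with rfl | hI
  · exact hx0
  · have hlarge := hlt 0 hI
    rw [hr 0, hx0] at hlarge
    exact absurd h₀ (not_le.2 hlarge)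

end IsPCG

/-! ### Projections acting on some of the modes -/

theorem norm_sum_inner_smul_le {E ι : Type*} [NormedAddCommGroup E] [InnerProductSpace ℝ E]
    {u : ι → E} (hu : Orthonormal ℝ u) (s : Finset ι) (x : E) :
    ‖∑ k ∈ s, inner ℝ (u k) x • u k‖ ≤ ‖x‖ := by
  refine le_of_sq_le_sq ?_ (norm_nonneg _)
  rw [← real_inner_self_eq_norm_sq, hu.inner_sum]
  simpa [sq] using hu.sum_inner_products_le x (s := s)

/-- A finitely supported function as an element of `ℓ₂`. -/
def ofFinsupp {X : Type*} (u : X →₀ ℝ) : L2 X :=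
  ⟨fun x => u x, (memℓp_zero u.hasFiniteSupport).of_exponent_ge zero_le⟩

theorem inner_ofFinsupp {X : Type*} (u : X →₀ ℝ) (F : L2 X) :
    inner ℝ (ofFinsupp u) F = u.sum fun x c => c * F x := by
  rw [inner_eq_tsum]
  exact tsum_eq_sum fun x hx =>
    mul_eq_zero_of_left (show ofFinsupp u x = 0 from Finsupp.notMem_support_iff.1 hx) _

/-- The finitely supported functions `U k` are orthonormal in `ℓ₂`; the sum defining their inner
products is finite. -/
def OrthonormalFinsupp {X ι : Type*} [DecidableEq ι] (U : ι → X →₀ ℝ) : Prop :=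
  ∀ k l, ((U k).sum fun x c => c * U l x) = if k = l then 1 else 0

theorem OrthonormalFinsupp.orthonormal {X ι : Type*} [DecidableEq ι] {U : ι → X →₀ ℝ}
    (hU : OrthonormalFinsupp U) : Orthonormal ℝ fun k => ofFinsupp (U k) :=
  orthonormal_iff_ite.2 fun k l => by
    rw [inner_ofFinsupp]
    exact hU k l

theorem OrthonormalFinsupp.tsum_sq_proj_le {X ι : Type*} [DecidableEq ι] {U : ι → X →₀ ℝ}
    (hU : OrthonormalFinsupp U) (s : Finset ι) (F : X → ℝ) :
    ∑' y, ENNReal.ofReal ((∑ k ∈ s, U k y * (U k).sum fun y' c => c * F y') ^ 2) ≤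
      ∑' y, ENNReal.ofReal (F y ^ 2) := by
  by_cases hF : ∑' y, ENNReal.ofReal (F y ^ 2) = ⊤
  · exact hF ▸ le_top
  · let x : L2 X := ⟨F, memℓp_of_tsum_ne_top hF⟩
    let w : L2 X := ∑ k ∈ s, inner ℝ (ofFinsupp (U k)) x • ofFinsupp (U k)
    have hw : ∀ y, w y = ∑ k ∈ s, U k y * (U k).sum fun y' c => c * F y' := fun y => by
      simp only [w, lp.coeFn_sum, Finset.sum_apply, inner_ofFinsupp, lp.coeFn_smul, Pi.smul_apply]
      exact Finset.sum_congr rfl fun k _ => mul_comm _ _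
    simp_rw [← hw]
    rw [← ofReal_norm_sq, show ∑' y, ENNReal.ofReal (F y ^ 2) = _ from (ofReal_norm_sq x).symm]
    exact ENNReal.ofReal_le_ofReal
      (pow_le_pow_left₀ (norm_nonneg _) (norm_sum_inner_smul_le hU.orthonormal s x) 2)

section ModeProjections

variable {d : ℕ} {J ι κ : Type*} {p q : Fin d → Prop} [DecidablePred p]

/-- Replace the entries of the multi-index `m` in the modes with property `p` by those of `y`. -/
def glue (p : Fin d → Prop) [DecidablePred p] (y : {i // p i} → J) (m : MIdx d J) : MIdx d J :=
  fun i => if h : p i then y ⟨i, h⟩ else m i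

/-- The part of a multi-index in the modes with property `p`. -/
def part (p : Fin d → Prop) (m : MIdx d J) : {i // p i} → J := fun i => m i

theorem part_glue (y : {i // p i} → J) (m : MIdx d J) : part p (glue p y m) = y := by
  funext i
  exact dif_pos i.2

theorem part_glue_of_disjoint (h : ∀ i, p i → ¬ q i) (y : {i // p i} → J) (m : MIdx d J) :
    part q (glue p y m) = part q m := by
  funext i
  exact dif_neg fun hp => h _ hp i.2

theorem glue_comm [DecidablePred q] (h : ∀ i, p i → ¬ q i) (y : {i // p i} → J)
    (z : {i // q i} → J) (m : MIdx d J) : glue p y (glue q z m) = glue q z (glue p y m) := by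
  funext i
  by_cases hp : p i
  · simp [glue, hp, h i hp]
  · simp [glue, hp]

/-- The operator `u ⊗ u`, acting on the modes with property `p`. -/
def modeRankOne (p : Fin d → Prop) [DecidablePred p] (u : ({i // p i} → J) →₀ ℝ) :
    Module.End ℝ (MIdx d J → ℝ) where
  toFun x m := u (part p m) * u.sum fun y c => c * x (glue p y m)
  map_add' x x' := by
    funext m
    simp [mul_add, Finsupp.sum_add]
  map_smul' a x := by
    funext m
    simp only [Pi.smul_apply, smul_eq_mul, RingHom.id_apply, Finsupp.sum, Finset.mul_sum]
    exact Finset.sum_congr rfl fun _ _ => by ring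

theorem modeRankOne_apply (u : ({i // p i} → J) →₀ ℝ) (x : MIdx d J → ℝ) (m : MIdx d J) :
    modeRankOne p u x m = u (part p m) * u.sum fun y c => c * x (glue p y m) :=
  rfl

theorem commute_modeRankOne [DecidablePred q] (h : ∀ i, p i → ¬ q i)
    (u : ({i // p i} → J) →₀ ℝ) (v : ({i // q i} → J) →₀ ℝ) :
    Commute (modeRankOne p u) (modeRankOne q v) := by
  refine LinearMap.ext fun x => funext fun m => ?_
  simp only [Module.End.mul_apply, modeRankOne_apply, Finsupp.sum, part_glue_of_disjoint h,
    part_glue_of_disjoint fun i hq hp => h i hp hq, Finset.mul_sum]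
  rw [Finset.sum_comm]
  refine Finset.sum_congr rfl fun z _ => Finset.sum_congr rfl fun y _ => ?_
  rw [glue_comm h]
  ring

/-- The operator `∑_{k ∈ s} U_k ⊗ U_k`, acting on the modes with property `p`. -/
def modeProj (p : Fin d → Prop) [DecidablePred p] (U : ι → ({i // p i} → J) →₀ ℝ)
    (s : Finset ι) : Module.End ℝ (MIdx d J → ℝ) :=
  ∑ k ∈ s, modeRankOne p (U k)

theorem modeProj_apply (U : ι → ({i // p i} → J) →₀ ℝ) (s : Finset ι) (x : MIdx d J → ℝ)
    (m : MIdx d J) : modeProj p U s x m = ∑ k ∈ s, modeRankOne p (U k) x m := by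
  simp [modeProj]

theorem commute_modeProj [DecidablePred q] (h : ∀ i, p i → ¬ q i)
    (U : ι → ({i // p i} → J) →₀ ℝ) (V : κ → ({i // q i} → J) →₀ ℝ) (s : Finset ι) (s' : Finset κ) :
    Commute (modeProj p U s) (modeProj q V s') :=
  Commute.sum_left _ _ _ fun k _ => Commute.sum_right _ _ _ fun l _ =>
    commute_modeRankOne h (U k) (V l)

open Classical in
/-- The sum of the squares of all entries with `j`-th index in `S`. -/
def slabSum (j : Fin d) (S : Set J) (x : MIdx d J → ℝ) : ℝ≥0∞ :=
  ∑' l : MIdx d J, if l j ∈ S then ENNReal.ofReal (x l ^ 2) else 0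

theorem ofReal_norm_restr_sq (j : Fin d) (S : Set J) (v : L2 (MIdx d J)) :
    ENNReal.ofReal (‖restr {l : MIdx d J | l j ∈ S} v‖ ^ 2) = slabSum j S v := by
  classical
  rw [ofReal_norm_sq]
  refine tsum_congr fun l => ?_
  by_cases hl : l j ∈ S <;> simp [restr_apply, hl]

theorem slabSum_modeProj_le [DecidableEq ι] {U : ι → ({i // p i} → J) →₀ ℝ}
    (hU : OrthonormalFinsupp U) (s : Finset ι) {j : Fin d} (hj : ¬ p j) (S : Set J)
    (x : MIdx d J → ℝ) : slabSum j S (modeProj p U s x) ≤ slabSum j S x := by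
  classical
  set e := Equiv.piEquivPiSubtypeProd p (fun _ : Fin d => J) with he
  have hej : ∀ y z, e.symm (y, z) j = z ⟨j, hj⟩ := fun y z => by
    simp [he, Equiv.piEquivPiSubtypeProd, hj]
  have hpart : ∀ y z, part p (e.symm (y, z)) = y := fun y z => by
    funext i
    simp [part, he, Equiv.piEquivPiSubtypeProd, i.2]
  have hglue : ∀ y y' z, glue p y' (e.symm (y, z)) = e.symm (y', z) := fun y y' z => by
    funext i
    by_cases hi : p i <;> simp [glue, he, Equiv.piEquivPiSubtypeProd, hi]
  have slabSum_eq : ∀ x' : MIdx d J → ℝ, slabSum j S x' =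
      ∑' z, ∑' y, if z ⟨j, hj⟩ ∈ S then ENNReal.ofReal (x' (e.symm (y, z)) ^ 2) else 0 :=
    fun x' => by
      rw [slabSum, ← e.symm.tsum_eq, ENNReal.tsum_prod', ENNReal.tsum_comm]
      simp_rw [hej]
  rw [slabSum_eq, slabSum_eq]
  refine ENNReal.tsum_le_tsum fun z => ?_
  by_cases hz : z ⟨j, hj⟩ ∈ S
  · simp only [hz, if_true, modeProj_apply, modeRankOne_apply, hpart, hglue]
    exact hU.tsum_sq_proj_le s fun y => x (e.symm (y, z))
  · simp [hz]

theorem modeRankOne_of_eq_sum (h : ∀ i, p i → ¬ q i) [Fintype ι] [DecidableEq ι]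
    {U : ι → ({i // p i} → J) →₀ ℝ} (hU : OrthonormalFinsupp U) {σ : ι → ℝ}
    {V : ι → ({i // q i} → J) → ℝ} {v : MIdx d J → ℝ}
    (hv : ∀ m, v m = ∑ l, σ l * U l (part p m) * V l (part q m)) (k : ι) (m : MIdx d J) :
    modeRankOne p (U k) v m = σ k * U k (part p m) * V k (part q m) := by
  have hU' : ∀ l, ∑ y ∈ (U k).support, U k y * U l y = if k = l then 1 else 0 := hU k
  have coeff : ∑ y ∈ (U k).support, U k y * v (glue p y m) = σ k * V k (part q m) :=
    calc ∑ y ∈ (U k).support, U k y * v (glue p y m)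
        = ∑ l, σ l * V l (part q m) * ∑ y ∈ (U k).support, U k y * U l y := by
          simp_rw [hv, part_glue, part_glue_of_disjoint h, Finset.mul_sum]
          rw [Finset.sum_comm]
          exact Finset.sum_congr rfl fun _ _ => Finset.sum_congr rfl fun _ _ => by ring
      _ = σ k * V k (part q m) := by simp [hU']
  rw [modeRankOne_apply, Finsupp.sum, coeff]
  ring

end ModeProjections

namespace MatSVD

variable {d : ℕ} {J : Type*} {α : Finset (Fin d)} {v : MIdx d J → ℝ}

theorem proj_eq_modeProj (S : MatSVD α v) (ρ : ℕ) (x : MIdx d J → ℝ) :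
    S.proj ρ x = modeProj (fun i => i ∈ α) S.left {k | (k : ℕ) < ρ} x := by
  funext m
  rw [modeProj_apply, Finset.sum_filter]
  rfl

/-- Both sides keep the first `ρ` terms of the singular value decomposition. -/
theorem proj_self (S : MatSVD α v) (ρ : ℕ) :
    S.proj ρ v = modeProj (fun i => i ∉ α) S.right {k | (k : ℕ) < ρ} v := by
  funext m
  rw [S.proj_eq_modeProj, modeProj_apply, modeProj_apply]
  refine Finset.sum_congr rfl fun k _ => ?_
  rw [modeRankOne_of_eq_sum (fun i hi => not_not.2 hi) S.left_orth S.eq_sum,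
    modeRankOne_of_eq_sum (fun i hi => hi) S.right_orth (σ := S.σ)
      (V := fun l => S.left l) fun m => (S.eq_sum m).trans
        (Finset.sum_congr rfl fun l _ => mul_right_comm _ _ _)]
  exact mul_right_comm _ _ _

end MatSVD

/-! ### Hierarchical HOSVD truncation and contractions -/

namespace DimTree

variable {d : ℕ} {X : Type*} {P Q : Finset (Fin d) → X → X} {N : X → ℝ≥0∞} {j : Fin d}

theorem applyAll_comm {W : X → X} :
    ∀ t : DimTree d, (∀ β ⊆ t.modes, Function.Commute (P β) W) →
      Function.Commute (t.applyAll P) W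
  | .leaf _, _, _ => rfl
  | .node l r, h, x => by
    have hl : l.modes ⊆ (DimTree.node l r).modes := Finset.subset_union_left
    have hr : r.modes ⊆ (DimTree.node l r).modes := Finset.subset_union_right
    simp only [applyAll]
    rw [h _ hl x, h _ hr, l.applyAll_comm fun β hβ => h β (hβ.trans hl),
      r.applyAll_comm fun β hβ => h β (hβ.trans hr)]

theorem applyAll_le (hP : ∀ α, j ∉ α → ∀ x, N (P α x) ≤ N x) :
    ∀ t : DimTree d, j ∉ t.modes → ∀ x, N (t.applyAll P x) ≤ N x
  | .leaf _, _, _ => le_rfl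
  | .node l r, h, x => by
    simp only [modes, Finset.mem_union, not_or] at h
    calc N (r.applyAll P (l.applyAll P (P r.modes (P l.modes x))))
        ≤ N (l.applyAll P (P r.modes (P l.modes x))) := r.applyAll_le hP h.2 _
      _ ≤ N (P r.modes (P l.modes x)) := l.applyAll_le hP h.1 _
      _ ≤ N (P l.modes x) := hP _ h.2 _
      _ ≤ N x := hP _ h.1 _

/-- Descending towards the leaf `j`, the projections for nodes that contain `j` are replaced by
projections on the complementary modes, which do not involve `j`. The operator `W` collects what
has been applied so far; it commutes with everything that follows. -/
theorem applyAll_le_self {v : X} (hPQ : ∀ α, P α v = Q α v)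
    (hP : ∀ α, j ∉ α → ∀ x, N (P α x) ≤ N x) (hQ : ∀ α, j ∈ α → ∀ x, N (Q α x) ≤ N x)
    (hPP : ∀ α β, Disjoint α β → Function.Commute (P α) (P β))
    (hPQc : ∀ α β, α ⊆ β → Function.Commute (P α) (Q β)) :
    ∀ t : DimTree d, t.Proper → j ∈ t.modes → ∀ W : X → X, (∀ x, N (W x) ≤ N x) →
      (∀ β ⊆ t.modes, Function.Commute (P β) W) → N (t.applyAll P (W v)) ≤ N v
  | .leaf _, _, _, _, hW, _ => hW v
  | .node l r, ht, hj, W, hW, hWc => by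
    obtain ⟨hdis, hlp, hrp⟩ := ht
    have hl : l.modes ⊆ (DimTree.node l r).modes := Finset.subset_union_left
    have hr : r.modes ⊆ (DimTree.node l r).modes := Finset.subset_union_right
    simp only [applyAll]
    rcases Finset.mem_union.1 hj with hjl | hjr
    · have hjr : j ∉ r.modes := Finset.disjoint_left.1 hdis hjl
      refine (r.applyAll_le hP hjr _).trans ?_
      rw [hWc _ hl, hPQ]
      refine l.applyAll_le_self hPQ hP hQ hPP hPQc hlp hjl (P r.modes ∘ W ∘ Q l.modes)
        (fun x => (hP _ hjr _).trans ((hW _).trans (hQ _ hjl _))) fun β hβ => ?_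
      exact (hPP β _ (Finset.disjoint_of_subset_left hβ hdis)).comp_right
        ((hWc β (hβ.trans hl)).comp_right (hPQc β _ hβ))
    · have hjl : j ∉ l.modes := Finset.disjoint_right.1 hdis hjr
      rw [hPP r.modes l.modes hdis.symm, hWc _ hr, hPQ]
      refine r.applyAll_le_self hPQ hP hQ hPP hPQc hrp hjr
        (l.applyAll P ∘ P l.modes ∘ W ∘ Q r.modes)
        (fun x => (l.applyAll_le hP hjl _).trans
          ((hP _ hjl _).trans ((hW _).trans (hQ _ hjr _)))) fun β hβ => ?_
      have hdisβ : ∀ α ⊆ l.modes, Disjoint α β := fun α hα =>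
        Finset.disjoint_of_subset_left hα (Finset.disjoint_of_subset_right hβ hdis)
      exact (l.applyAll_comm fun α hα => hPP α β (hdisβ α hα)).symm.comp_right
        ((hPP _ _ (hdisβ _ subset_rfl)).symm.comp_right
          ((hWc β (hβ.trans hr)).comp_right (hPQc β _ hβ)))

end DimTree

theorem IsTrunc.norm_restr_le {d : ℕ} {J : Type*} {t : DimTree d} (ht : t.IsDimTree)
    {v w : L2 (MIdx d J)} {ε : ℝ} (h : IsTrunc t v ε w) (j : Fin d) (S : Set J) :
    ‖restr {l : MIdx d J | l j ∈ S} w‖ ≤ ‖restr {l : MIdx d J | l j ∈ S} v‖ := by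
  obtain ⟨D, ρ, hw, -⟩ := h
  let P := fun α => modeProj (fun i => i ∈ α) (D α).left {k | (k : ℕ) < ρ α}
  let Q := fun α => modeProj (fun i => i ∉ α) (D α).right {k | (k : ℕ) < ρ α}
  have hproj : (fun α => (D α).proj (ρ α)) = fun α => ⇑(P α) :=
    funext fun α => funext ((D α).proj_eq_modeProj (ρ α))
  refine le_of_sq_le_sq ?_ (norm_nonneg _)
  rw [← ENNReal.ofReal_le_ofReal_iff (sq_nonneg _), ofReal_norm_restr_sq, ofReal_norm_restr_sq,
    show (w : MIdx d J → ℝ) = t.applyAll (fun α => P α) v from hproj ▸ funext hw]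
  refine DimTree.applyAll_le_self (Q := fun α => Q α) (N := slabSum j S) ?_ ?_ ?_ ?_ ?_ t ht.2
    (ht.1 ▸ Finset.mem_univ j) id (fun _ => le_rfl) fun _ _ => .id_right
  · exact fun α => ((D α).proj_eq_modeProj (ρ α) v).symm.trans ((D α).proj_self (ρ α))
  · exact fun α hα => slabSum_modeProj_le (D α).left_orth _ hα S
  · exact fun α hα => slabSum_modeProj_le (D α).right_orth _ (not_not.2 hα) S
  · exact fun α β hαβ => LinearMap.congr_fun
      (commute_modeProj (fun i hi => Finset.disjoint_left.1 hαβ hi) _ _ _ _)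
  · exact fun α β hαβ => LinearMap.congr_fun
      (commute_modeProj (fun i hi => not_not.2 (hαβ hi)) _ _ _ _)

/-! ### The exponential sum -/

theorem expTerm_pos {h : ℝ} (hh : 0 < h) (x t : ℝ) : 0 < expTerm h x t := by
  unfold expTerm
  positivity

theorem inv_one_add_exp_neg_le (x : ℝ) : (1 + Real.exp (-x))⁻¹ ≤ Real.exp x := by
  rw [← inv_inv (Real.exp x), ← Real.exp_neg]
  exact inv_anti₀ (Real.exp_pos _) (le_add_of_nonneg_left zero_le_one)

theorem exp_div_le_log_one_add_exp {x X : ℝ} (hx : x ≤ X) :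
    Real.exp x / (1 + Real.exp X) ≤ Real.log (1 + Real.exp x) :=
  calc Real.exp x / (1 + Real.exp X) ≤ Real.exp x / (1 + Real.exp x) := by gcongr
    _ = 1 - (1 + Real.exp x)⁻¹ := by field_simp; ring
    _ ≤ Real.log (1 + Real.exp x) := Real.one_sub_inv_le_log_of_pos (by positivity)

theorem exp_neg_sq_le {y : ℝ} (hy : 0 ≤ y) : Real.exp (-y ^ 2) ≤ 2 / (1 + y) ^ 2 := by
  rw [Real.exp_neg, inv_eq_one_div, div_le_div_iff₀ (Real.exp_pos _) (by positivity)]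
  nlinarith [sq_nonneg (1 - y), Real.add_one_le_exp (y ^ 2)]

theorem expTerm_le {h x X t : ℝ} (hh : 0 < h) (hx : x ≤ X) (ht : 0 < t) :
    expTerm h x t ≤ h * (4 / √Real.pi) * (1 + Real.exp X) / √t *
      ((Real.exp x * √t / (1 + Real.exp X)) / (1 + Real.exp x * √t / (1 + Real.exp X)) ^ 2) := by
  set y := Real.exp x * √t / (1 + Real.exp X) with hy
  have hy0 : 0 ≤ y := by positivity
  have y_sq_le : y ^ 2 ≤ Real.log (1 + Real.exp x) ^ 2 * t := by
    rw [hy, mul_div_right_comm, mul_pow, Real.sq_sqrt ht.le]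
    gcongr
    exact exp_div_le_log_one_add_exp hx
  calc expTerm h x t
      ≤ h * (2 / √Real.pi * Real.exp x) * Real.exp (-y ^ 2) := by
        unfold expTerm
        gcongr
        exact inv_one_add_exp_neg_le x
    _ ≤ h * (2 / √Real.pi * Real.exp x) * (2 / (1 + y) ^ 2) := by
        gcongr
        exact exp_neg_sq_le hy0
    _ = h * (4 / √Real.pi) * (1 + Real.exp X) / √t * (y / (1 + y) ^ 2) := by
        have hexp : Real.exp x = y * (1 + Real.exp X) / √t := by rw [hy]; field_simp
        rw [hexp]
        field_simp
        ring

theorem div_one_add_sq_le {q y : ℝ} (hq : 0 < q) (hq1 : q < 1) (hy : 0 < y) :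
    y / (1 + y) ^ 2 ≤ (1 - q)⁻¹ * (y / (1 + y) - q * y / (1 + q * y)) := by
  have hdiff : y / (1 + y) - q * y / (1 + q * y) = (1 - q) * (y / ((1 + y) * (1 + q * y))) := by
    field_simp
    ring
  rw [hdiff, inv_mul_cancel_left₀ (by linarith), sq]
  gcongr
  exact mul_le_of_le_one_left hy.le hq1.le

theorem sum_geometric_div_one_add_sq_le {q y : ℝ} (hq : 0 < q) (hq1 : q < 1) (hy : 0 < y)
    (N : ℕ) : ∑ i ∈ Finset.range N, (y * q ^ i) / (1 + y * q ^ i) ^ 2 ≤ (1 - q)⁻¹ := by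
  let F : ℕ → ℝ := fun i => y * q ^ i / (1 + y * q ^ i)
  calc ∑ i ∈ Finset.range N, (y * q ^ i) / (1 + y * q ^ i) ^ 2
      ≤ ∑ i ∈ Finset.range N, (1 - q)⁻¹ * (F i - F (i + 1)) :=
        Finset.sum_le_sum fun i _ => by
          simpa only [F, pow_succ', mul_left_comm] using
            div_one_add_sq_le hq hq1 (show 0 < y * q ^ i by positivity)
    _ = (1 - q)⁻¹ * (F 0 - F N) := by rw [← Finset.mul_sum, Finset.sum_range_sub']
    _ ≤ (1 - q)⁻¹ := by
        have hF0 : F 0 ≤ 1 := (div_le_one (by positivity)).2 (le_add_of_nonneg_left zero_le_one)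
        have hFN : 0 ≤ F N := by positivity
        exact mul_le_of_le_one_right (inv_nonneg.2 (by linarith)) (by linarith)

theorem exists_sum_expTerm_le {h : ℝ} (hh : 0 < h) (nplus : ℕ) :
    ∃ C : ℝ, 0 < C ∧ ∀ t : ℝ, 0 < t → ∀ N : ℕ,
      ∑ i ∈ Finset.range N, expTerm h (((nplus : ℝ) - i) * h) t ≤ C * (√t)⁻¹ := by
  set B := 1 + Real.exp (nplus * h) with hB
  have : 0 < B := by positivity
  have hq : Real.exp (-h) < 1 := Real.exp_lt_one_iff.2 (neg_lt_zero.2 hh)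
  refine ⟨h * (4 / √Real.pi) * B * (1 - Real.exp (-h))⁻¹,
    mul_pos (by positivity) (inv_pos.2 (sub_pos.2 hq)), fun t ht N => ?_⟩
  set y := Real.exp (nplus * h) * √t / B
  have term_le : ∀ i ∈ Finset.range N, expTerm h (((nplus : ℝ) - i) * h) t ≤
      h * (4 / √Real.pi) * B / √t *
        (y * Real.exp (-h) ^ i / (1 + y * Real.exp (-h) ^ i) ^ 2) := by
    intro i _
    have node_le : ((nplus : ℝ) - i) * h ≤ nplus * h := by gcongr; simp
    have hexp : Real.exp (((nplus : ℝ) - i) * h) * √t / B = y * Real.exp (-h) ^ i := by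
      rw [← Real.exp_nat_mul, show ((nplus : ℝ) - i) * h = nplus * h + i * -h by ring,
        Real.exp_add]
      ring
    simpa only [← hB, hexp] using expTerm_le hh node_le ht
  calc ∑ i ∈ Finset.range N, expTerm h (((nplus : ℝ) - i) * h) t
      ≤ h * (4 / √Real.pi) * B / √t * ∑ i ∈ Finset.range N,
          (y * Real.exp (-h) ^ i / (1 + y * Real.exp (-h) ^ i) ^ 2) := by
        rw [Finset.mul_sum]
        exact Finset.sum_le_sum term_le
    _ ≤ h * (4 / √Real.pi) * B / √t * (1 - Real.exp (-h))⁻¹ := by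
        gcongr
        exact sum_geometric_div_one_add_sq_le (Real.exp_pos _) hq (by positivity) N
    _ = h * (4 / √Real.pi) * B * (1 - Real.exp (-h))⁻¹ * (√t)⁻¹ := by ring

theorem exists_expSumLim_le {h : ℝ} (hh : 0 < h) (nplus : ℕ) :
    ∃ C : ℝ, 0 < C ∧ ∀ t : ℝ, 0 < t →
      0 < expSumLim h nplus t ∧ expSumLim h nplus t ≤ C * (√t)⁻¹ := by
  obtain ⟨C, hC, sum_le⟩ := exists_sum_expTerm_le hh nplus
  refine ⟨C, hC, fun t ht => ?_⟩
  have nonneg : ∀ i : ℕ, 0 ≤ expTerm h (((nplus : ℝ) - i) * h) t := fun i =>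
    (expTerm_pos hh _ t).le
  exact ⟨(summable_of_sum_range_le nonneg (sum_le t ht)).tsum_pos nonneg 0 (expTerm_pos hh _ t),
    Real.tsum_le_of_sum_range_le nonneg (sum_le t ht)⟩

namespace Problem

variable {d R : ℕ} {J : Type*} {P : Problem d R J}

theorem weight_le_D (P : Problem d R J) (j : Fin d) (l : MIdx d J) : P.weight j (l j) ≤ P.D l :=
  Real.le_sqrt_of_sq_le (Finset.single_le_sum (f := fun j => P.weight j (l j) ^ 2)
    (fun _ _ => sq_nonneg _) (Finset.mem_univ j))

namespace ScalingValid

theorem one_le_D (h : P.ScalingValid) (l : MIdx d J) : 1 ≤ P.D l :=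
  Real.one_le_sqrt.2 (h.one_le_t l)

theorem exists_Sinv_le (h : P.ScalingValid) :
    ∃ C : ℝ, 0 < C ∧ ∀ l, 0 < P.Sinv l ∧ P.Sinv l ≤ C * (P.D l)⁻¹ := by
  obtain ⟨C, hC, bound⟩ := exists_expSumLim_le h.h_pos P.nplus
  exact ⟨C, hC, fun l => bound _ (zero_lt_one.trans_le (h.one_le_t l))⟩

theorem prod_weight_le (h : P.ScalingValid) {o : Fin d → ℕ} (ho : ∑ j, o j ≤ 1)
    (l : MIdx d J) : ∏ j, P.weight j (l j) ^ o j ≤ P.D l := by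
  by_cases h0 : ∀ j, o j = 0
  · simp only [h0, pow_zero, Finset.prod_const_one]
    exact h.one_le_D l
  · push Not at h0
    obtain ⟨i, hi⟩ := h0
    have hsplit : o i + ∑ j ∈ Finset.univ.erase i, o j ≤ 1 := by
      rwa [Finset.add_sum_erase _ _ (Finset.mem_univ i)]
    have hoi : o i = 1 := by lia
    have hother : ∀ j, j ≠ i → o j = 0 := fun j hj =>
      Finset.sum_eq_zero_iff.1 (show ∑ j ∈ Finset.univ.erase i, o j = 0 by lia) j
        (Finset.mem_erase.2 ⟨hj, Finset.mem_univ j⟩)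
    rw [Finset.prod_eq_single i (fun j _ hj => by rw [hother j hj, pow_zero]) (by simp), hoi,
      pow_one]
    exact P.weight_le_D i l

end ScalingValid

end Problem

/-! ### Tensor products of operators -/

section ModeOperators

variable {d : ℕ} {J : Type*}

theorem memℓp_slice (i : Fin d) (l : MIdx d J) (v : L2 (MIdx d J)) :
    Memℓp (fun x : J => v (Function.update l i x)) 2 :=
  memℓp_gen <| ((summable_sq v).comp_injective (Function.update_injective l i)).congr fun x => by
    simp

/-- The fiber of a tensor in direction `i` through the multi-index `l`. -/
def slice (i : Fin d) (l : MIdx d J) (v : L2 (MIdx d J)) : L2 J :=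
  ⟨fun x => v (Function.update l i x), memℓp_slice i l v⟩

theorem slice_apply (i : Fin d) (l : MIdx d J) (v : L2 (MIdx d J)) (x : J) :
    slice i l v x = v (Function.update l i x) := rfl

theorem slice_update (i : Fin d) (l : MIdx d J) (v : L2 (MIdx d J)) (x : J) :
    slice i (Function.update l i x) v = slice i l v := by
  ext x'
  simp only [slice_apply, Function.update_idem]

theorem exists_tsum_eq_tsum_update [Nonempty J] (i : Fin d) :
    ∃ g : ({j // j ≠ i} → J) → MIdx d J, ∀ f : MIdx d J → ℝ≥0∞,
      ∑' l, f l = ∑' z, ∑' x, f (Function.update (g z) i x) := by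
  classical
  obtain ⟨x₀⟩ := ‹Nonempty J›
  let e := Equiv.funSplitAt i J
  have update_eq : ∀ x z, Function.update (e.symm (x₀, z)) i x = e.symm (x, z) := by
    intro x z
    funext k
    by_cases hk : k = i
    · subst hk
      simp [e, Equiv.funSplitAt, Equiv.piSplitAt]
    · simp [e, Equiv.funSplitAt, Equiv.piSplitAt, hk]
  refine ⟨fun z => e.symm (x₀, z), fun f => ?_⟩
  simp only [update_eq]
  rw [← e.symm.tsum_eq, ENNReal.tsum_prod', ENNReal.tsum_comm]

theorem tsum_slice_le (i : Fin d) (B : L2 J →L[ℝ] L2 J) (v : L2 (MIdx d J)) :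
    ∑' l : MIdx d J, ENNReal.ofReal (B (slice i l v) (l i) ^ 2) ≤
      ENNReal.ofReal ((‖B‖ * ‖v‖) ^ 2) := by
  rcases isEmpty_or_nonempty J with hJ | hJ
  · have : IsEmpty (MIdx d J) := ⟨fun l => hJ.elim (l i)⟩
    simp
  obtain ⟨g, tsum_eq⟩ := exists_tsum_eq_tsum_update (J := J) i
  rw [mul_pow, ENNReal.ofReal_mul (sq_nonneg _), ofReal_norm_sq v, tsum_eq, tsum_eq,
    ← ENNReal.tsum_mul_left]
  refine ENNReal.tsum_le_tsum fun z => ?_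
  simp only [slice_update, Function.update_self, ← slice_apply]
  rw [← ofReal_norm_sq, ← ofReal_norm_sq, ← ENNReal.ofReal_mul (sq_nonneg _), ← mul_pow]
  gcongr
  exact B.le_opNorm _

/-- The operator `B` acting on the `i`-th mode of a tensor, i.e. `id ⊗ ⋯ ⊗ B ⊗ ⋯ ⊗ id`. -/
def modeOp (i : Fin d) (B : L2 J →L[ℝ] L2 J) (v : L2 (MIdx d J)) : L2 (MIdx d J) :=
  ⟨fun l => B (slice i l v) (l i),
    memℓp_of_tsum_ne_top (ne_top_of_le_ne_top ENNReal.ofReal_ne_top (tsum_slice_le i B v))⟩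

theorem modeOp_apply (i : Fin d) (B : L2 J →L[ℝ] L2 J) (v : L2 (MIdx d J)) (l : MIdx d J) :
    modeOp i B v l = B (slice i l v) (l i) := rfl

theorem norm_modeOp_le (i : Fin d) (B : L2 J →L[ℝ] L2 J) (v : L2 (MIdx d J)) :
    ‖modeOp i B v‖ ≤ ‖B‖ * ‖v‖ :=
  norm_le_of_tsum_le (mul_nonneg (norm_nonneg _) (norm_nonneg _)) (tsum_slice_le i B v)

/-- The composition of the operators `B j` acting on the modes `j` in a list, the last entry of
the list acting first. -/
def modeOps (B : Fin d → L2 J →L[ℝ] L2 J) (S : List (Fin d)) (v : L2 (MIdx d J)) :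
    L2 (MIdx d J) :=
  S.foldr (fun i => modeOp i (B i)) v

theorem norm_modeOps_le {B : Fin d → L2 J →L[ℝ] L2 J} {c : ℝ} (S : List (Fin d))
    (hB : ∀ j ∈ S, ‖B j‖ ≤ c) (v : L2 (MIdx d J)) : ‖modeOps B S v‖ ≤ c ^ S.length * ‖v‖ := by
  induction S with
  | nil => simp [modeOps]
  | cons i S ih =>
    obtain ⟨hBi, hBS⟩ := List.forall_mem_cons.1 hB
    calc ‖modeOps B (i :: S) v‖ ≤ ‖B i‖ * ‖modeOps B S v‖ := norm_modeOp_le i (B i) _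
      _ ≤ c * (c ^ S.length * ‖v‖) :=
          mul_le_mul hBi (ih hBS) (norm_nonneg _) ((norm_nonneg _).trans hBi)
      _ = c ^ (i :: S).length * ‖v‖ := by rw [List.length_cons, pow_succ']; ring

open Classical in
/-- The product over the modes in `T` of the matrix entries of the operator that acts as `B j` on
the modes `j` in the list `S` and as the identity on all others. -/
def modeKernel (B : Fin d → L2 J →L[ℝ] L2 J) (S : List (Fin d)) (T : Finset (Fin d))
    (l m : MIdx d J) : ℝ :=
  ∏ j ∈ T, if j ∈ S then entry (B j) (l j) (m j) else if l j = m j then 1 else 0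

open Classical in
theorem modeKernel_nil (B : Fin d → L2 J →L[ℝ] L2 J) (l m : MIdx d J) :
    modeKernel B [] Finset.univ l m = if l = m then 1 else 0 := by
  simp only [modeKernel, List.not_mem_nil, if_false, Finset.prod_ite_zero, Finset.prod_const_one,
    Finset.mem_univ, forall_const, funext_iff]

open Classical in
theorem modeKernel_update {S : List (Fin d)} {i : Fin d} (hi : i ∉ S)
    (B : Fin d → L2 J →L[ℝ] L2 J) (l m : MIdx d J) (x : J) :
    modeKernel B S Finset.univ (Function.update l i x) m =
      (if x = m i then 1 else 0) * modeKernel B S (Finset.univ.erase i) l m := by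
  rw [modeKernel, ← Finset.mul_prod_erase _ _ (Finset.mem_univ i), if_neg hi, Function.update_self]
  congr 1
  refine Finset.prod_congr rfl fun j hj => ?_
  rw [Function.update_of_ne (Finset.ne_of_mem_erase hj)]

theorem modeKernel_cons (B : Fin d → L2 J →L[ℝ] L2 J) (i : Fin d) (S : List (Fin d))
    (l m : MIdx d J) : modeKernel B (i :: S) Finset.univ l m =
      entry (B i) (l i) (m i) * modeKernel B S (Finset.univ.erase i) l m := by
  rw [modeKernel, ← Finset.mul_prod_erase _ _ (Finset.mem_univ i), if_pos List.mem_cons_self]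
  congr 1
  refine Finset.prod_congr rfl fun j hj => ?_
  simp only [List.mem_cons, Finset.ne_of_mem_erase hj, false_or]

theorem modeOps_apply {B : Fin d → L2 J →L[ℝ] L2 J} {F : Finset (MIdx d J)} {v : L2 (MIdx d J)}
    (hv : SuppIn (F : Set (MIdx d J)) v) {S : List (Fin d)} (hS : S.Nodup) (l : MIdx d J) :
    modeOps B S v l = ∑ m ∈ F, modeKernel B S Finset.univ l m * v m := by
  classical
  induction S generalizing l with
  | nil =>
    simp only [modeKernel_nil, ite_mul, one_mul, zero_mul, Finset.sum_ite_eq]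
    split_ifs with hl
    · rfl
    · exact hv l (by simpa using hl)
  | cons i S ih =>
    obtain ⟨hi, hS⟩ := List.nodup_cons.1 hS
    have slice_eq : slice i l (modeOps B S v) = ∑ m ∈ F,
        (modeKernel B S (Finset.univ.erase i) l m * v m) • lp.single 2 (m i) (1 : ℝ) := by
      ext x
      rw [slice_apply, ih hS, lp.coeFn_sum, Finset.sum_apply]
      refine Finset.sum_congr rfl fun m _ => ?_
      by_cases hx : x = m i <;> simp [modeKernel_update hi, hx]
    change B i (slice i l (modeOps B S v)) (l i) = _
    rw [slice_eq, map_sum, lp.coeFn_sum, Finset.sum_apply]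
    refine Finset.sum_congr rfl fun m _ => ?_
    rw [modeKernel_cons, map_smul, lp.coeFn_smul, Pi.smul_apply, smul_eq_mul, ← entry]
    ring

theorem exists_tensor_apply {B : Fin d → L2 J →L[ℝ] L2 J} {F : Finset (MIdx d J)}
    {v : L2 (MIdx d J)} (hv : SuppIn (F : Set (MIdx d J)) v) {c : ℝ} (hc : 1 ≤ c) (i : Fin d)
    (hB : ∀ j, j ≠ i → ‖B j‖ ≤ c) :
    ∃ e : L2 (MIdx d J), (∀ l, e l = ∑ m ∈ F, (∏ j, entry (B j) (l j) (m j)) * v m) ∧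
      ‖e‖ ≤ c ^ d * ‖modeOp i (B i) v‖ := by
  classical
  set S := (Finset.univ.erase i).toList with hS
  have ne_of_mem : ∀ j ∈ S, j ≠ i := fun j hj =>
    Finset.ne_of_mem_erase (Finset.mem_toList.1 hj)
  have nodup : (S ++ [i]).Nodup :=
    List.nodup_append.2 ⟨Finset.nodup_toList _, List.nodup_singleton i, fun a ha b hb =>
      List.mem_singleton.1 hb ▸ ne_of_mem a ha⟩
  have mem : ∀ j, j ∈ S ++ [i] := fun j => by
    by_cases hj : j = i <;> simp [hS, hj]
  have length_le : S.length ≤ d := by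
    rw [hS, Finset.length_toList]
    exact Finset.card_erase_le.trans (Finset.card_fin d).le
  refine ⟨modeOps B (S ++ [i]) v, fun l => ?_, ?_⟩
  · simp only [modeOps_apply hv nodup, modeKernel, mem, if_true]
  · calc ‖modeOps B (S ++ [i]) v‖ = ‖modeOps B S (modeOp i (B i) v)‖ := by
          simp only [modeOps, List.foldr_append, List.foldr_cons, List.foldr_nil]
      _ ≤ c ^ S.length * ‖modeOp i (B i) v‖ :=
          norm_modeOps_le S (fun j hj => hB j (ne_of_mem j hj)) _
      _ ≤ c ^ d * ‖modeOp i (B i) v‖ := by gcongr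

end ModeOperators

/-! ### Adaptively compressed operators -/

section Compression

variable {d : ℕ} {J : Type*}

theorem slice_restr (i : Fin d) (S : Set J) (l : MIdx d J) (v : L2 (MIdx d J)) :
    slice i l (restr {l : MIdx d J | l i ∈ S} v) = restr S (slice i l v) := by
  classical
  ext x
  simp only [slice_apply, restr_apply, Set.mem_ofPred_eq, Function.update_self]

theorem modeOp_comp_restrL (i : Fin d) (B : L2 J →L[ℝ] L2 J) (S : Set J) (v : L2 (MIdx d J)) :
    modeOp i (B.comp (restrL S)) v = modeOp i B (restr {l : MIdx d J | l i ∈ S} v) := by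
  ext l
  rw [modeOp_apply, modeOp_apply, slice_restr, ContinuousLinearMap.comp_apply, restrL_apply]

theorem modeOp_add (i : Fin d) (B B' : L2 J →L[ℝ] L2 J) (v : L2 (MIdx d J)) :
    modeOp i (B + B') v = modeOp i B v + modeOp i B' v :=
  rfl

theorem modeOp_sum (i : Fin d) {κ : Type*} (s : Finset κ) (B : κ → L2 J →L[ℝ] L2 J)
    (v : L2 (MIdx d J)) : modeOp i (∑ k ∈ s, B k) v = ∑ k ∈ s, modeOp i (B k) v := by
  ext l
  rw [lp.coeFn_sum, Finset.sum_apply]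
  simp only [modeOp_apply, sum_apply, lp.coeFn_sum, Finset.sum_apply]

/-- The indices in `Γ L` which appear first in the layer `p`, i.e. `Γ p \ Γ (p - 1)` if `Γ` is
increasing and `p ≤ L`. -/
def newLayer (Γ : ℕ → Finset J) (L p : ℕ) : Set J := {y | y ∈ Γ L ∧ sInf {q | y ∈ Γ q} = p}

/-- The adaptively compressed operator `∑_{p ≤ L} B_{[L-p]} R_{Γ p \ Γ (p-1)}`. -/
def adaptive (Bp : ℕ → L2 J →L[ℝ] L2 J) (Γ : ℕ → Finset J) (L : ℕ) : L2 J →L[ℝ] L2 J :=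
  ∑ p ∈ Finset.range (L + 1), (Bp (L - p)).comp (restrL (newLayer Γ L p))

theorem sum_restr_newLayer (Γ : ℕ → Finset J) (L : ℕ) (w : L2 J) :
    ∑ p ∈ Finset.range (L + 1), restr (newLayer Γ L p) w = restr (Γ L : Set J) w := by
  classical
  ext y
  rw [lp.coeFn_sum, Finset.sum_apply]
  by_cases hy : y ∈ Γ L
  · rw [Finset.sum_eq_single (sInf {p | y ∈ Γ p})]
    · simp [restr_apply, newLayer, hy]
    · exact fun p _ hp => restr_of_notMem (fun h => hp h.2.symm) w
    · exact fun h => absurd (Finset.mem_range.2 (Nat.lt_succ_of_le (Nat.sInf_le hy))) h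
  · rw [restr_of_notMem (by simpa using hy)]
    exact Finset.sum_eq_zero fun p _ => restr_of_notMem (fun h => hy h.1) w

open Classical in
theorem restr_single (S : Set J) (y : J) :
    restr S (lp.single 2 y (1 : ℝ)) = if y ∈ S then lp.single 2 y (1 : ℝ) else 0 := by
  ext x
  by_cases hx : x = y
  · subst hx
    by_cases hS : x ∈ S <;> simp [restr_apply, hS]
  · by_cases hS : y ∈ S <;> simp [restr_apply, hS, hx]

open Classical in
theorem entry_adaptive (Bp : ℕ → L2 J →L[ℝ] L2 J) (Γ : ℕ → Finset J) (L : ℕ) (x y : J) :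
    entry (adaptive Bp Γ L) x y =
      if y ∈ Γ L then entry (Bp (L - sInf {p | y ∈ Γ p})) x y else 0 := by
  simp only [entry, adaptive, sum_apply, ContinuousLinearMap.comp_apply,
    restrL_apply, lp.coeFn_sum, Finset.sum_apply, restr_single, newLayer, Set.mem_ofPred_eq]
  by_cases hy : y ∈ Γ L
  · rw [Finset.sum_eq_single (sInf {p | y ∈ Γ p})]
    · simp [hy]
    · intro p _ hp
      rw [if_neg fun h => hp h.2.symm]
      simp
    · exact fun h => absurd (Finset.mem_range.2 (Nat.lt_succ_of_le (Nat.sInf_le hy))) h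
  · simp [hy]

theorem sub_adaptive (B : L2 J →L[ℝ] L2 J) (Bp : ℕ → L2 J →L[ℝ] L2 J) (Γ : ℕ → Finset J) (L : ℕ) :
    B - adaptive Bp Γ L = B.comp (restrL (Γ L : Set J)ᶜ) +
      ∑ p ∈ Finset.range (L + 1), (B - Bp (L - p)).comp (restrL (newLayer Γ L p)) := by
  refine ContinuousLinearMap.ext fun w => ?_
  simp only [adaptive, sub_apply, add_apply,
    sum_apply, ContinuousLinearMap.comp_apply, restrL_apply,
    Finset.sum_sub_distrib, ← map_sum, sum_restr_newLayer, ← sub_restr, map_sub]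
  abel

theorem sum_range_sub_le_tsum {b : ℕ → ℝ} (hb : ∀ q, 0 ≤ b q) (hbs : Summable b) (L : ℕ) :
    ∑ p ∈ Finset.range (L + 1), b (L - p) ≤ ∑' q, b q := by
  have reflect := Finset.sum_range_reflect b (L + 1)
  simp only [Nat.add_sub_cancel] at reflect
  exact reflect.trans_le (hbs.sum_le_tsum _ fun q _ => hb q)

theorem norm_comp_restrL_le (B : L2 J →L[ℝ] L2 J) (S : Set J) : ‖B.comp (restrL S)‖ ≤ ‖B‖ :=
  (B.opNorm_comp_le _).trans
    (mul_le_of_le_one_right (norm_nonneg _) (Submodule.starProjection_norm_le _))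

theorem norm_adaptive_le {B : L2 J →L[ℝ] L2 J} {Bp : ℕ → L2 J →L[ℝ] L2 J} {b : ℕ → ℝ}
    (hb : ∀ p, ‖B - Bp p‖ ≤ b p) (hbs : Summable b) (Γ : ℕ → Finset J) (L : ℕ) :
    ‖adaptive Bp Γ L‖ ≤ 2 * ‖B‖ + ∑' q, b q := by
  have error_le : ‖B - adaptive Bp Γ L‖ ≤ ‖B‖ + ∑' q, b q :=
    calc ‖B - adaptive Bp Γ L‖
        ≤ ‖B.comp (restrL (Γ L : Set J)ᶜ)‖ + ∑ p ∈ Finset.range (L + 1),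
            ‖(B - Bp (L - p)).comp (restrL (newLayer Γ L p))‖ := by
          rw [sub_adaptive]
          exact (norm_add_le _ _).trans (add_le_add_right (norm_sum_le _ _) _)
      _ ≤ ‖B‖ + ∑ p ∈ Finset.range (L + 1), b (L - p) :=
          add_le_add (norm_comp_restrL_le _ _)
            (Finset.sum_le_sum fun p _ => (norm_comp_restrL_le _ _).trans (hb _))
      _ ≤ ‖B‖ + ∑' q, b q := by
          gcongr
          exact sum_range_sub_le_tsum (fun q => (norm_nonneg _).trans (hb q)) hbs L
  have := norm_sub_norm_le (adaptive Bp Γ L) B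
  rw [norm_sub_rev] at this
  linarith

/-- In every direction `j`, the part of `v` outside the layer `Γ j p` decays like `2 ^ (-s p)`. -/
def LayerDecay (s M : ℝ) (Γ : Fin d → ℕ → Finset J) (v : L2 (MIdx d J)) : Prop :=
  ‖v‖ ≤ M ∧ ∀ j (p : ℕ), ‖restr {l : MIdx d J | l j ∉ Γ j p} v‖ ≤ M * (2 : ℝ) ^ (-(s * p))

theorem norm_restr_le_of_abs_le_mul {ι : Type*} {v w : L2 ι} {c : ℝ} (hc : 0 ≤ c)
    (h : ∀ i, |w i| ≤ c * |v i|) (S : Set ι) : ‖restr S w‖ ≤ c * ‖restr S v‖ := by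
  classical
  refine norm_le_of_abs_le_mul hc fun i => ?_
  by_cases hi : i ∈ S
  · simpa only [restr_of_mem hi] using h i
  · simp only [restr_of_notMem hi, abs_zero, mul_zero, le_refl]

namespace LayerDecay

variable {s M : ℝ} {Γ : Fin d → ℕ → Finset J} {v : L2 (MIdx d J)}

theorem nonneg (h : LayerDecay s M Γ v) : 0 ≤ M := (norm_nonneg v).trans h.1

theorem of_abs_le_mul (h : LayerDecay s M Γ v) {w : L2 (MIdx d J)} {c : ℝ} (hc : 0 ≤ c)
    (hw : ∀ l, |w l| ≤ c * |v l|) : LayerDecay s (c * M) Γ w := by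
  refine ⟨(norm_le_of_abs_le_mul hc hw).trans (mul_le_mul_of_nonneg_left h.1 hc), fun j p => ?_⟩
  rw [mul_assoc]
  exact (norm_restr_le_of_abs_le_mul hc hw _).trans (mul_le_mul_of_nonneg_left (h.2 j p) hc)

theorem norm_restr_newLayer_le (h : LayerDecay s M Γ v) (hs : 0 ≤ s) (i : Fin d) (L p : ℕ) :
    ‖restr {l : MIdx d J | l i ∈ newLayer (Γ i) L p} v‖ ≤ 2 ^ s * M * (2 : ℝ) ^ (-(s * p)) := by
  rcases p with _ | p
  · calc ‖restr {l : MIdx d J | l i ∈ newLayer (Γ i) L 0} v‖ ≤ M := (norm_restr_le _ _).trans h.1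
      _ ≤ 2 ^ s * M := le_mul_of_one_le_left h.nonneg (Real.one_le_rpow one_le_two hs)
      _ = _ := by simp
  · have subset : {l : MIdx d J | l i ∈ newLayer (Γ i) L (p + 1)} ⊆ {l | l i ∉ Γ i p} := by
      intro l hl hlp
      have first_eq : sInf {q | l i ∈ Γ i q} = p + 1 := hl.2
      have first_le : sInf {q | l i ∈ Γ i q} ≤ p := Nat.sInf_le hlp
      lia
    calc ‖restr {l : MIdx d J | l i ∈ newLayer (Γ i) L (p + 1)} v‖
        ≤ M * (2 : ℝ) ^ (-(s * p)) := (norm_restr_mono subset v).trans (h.2 i p)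
      _ = 2 ^ s * M * (2 : ℝ) ^ (-(s * (p + 1 : ℕ))) := by
        rw [mul_comm (2 ^ s) M, mul_assoc, ← Real.rpow_add two_pos]
        congr 2
        push_cast
        ring

theorem norm_modeOp_sub_adaptive_le (h : LayerDecay s M Γ v) (hs : 0 ≤ s) {B : L2 J →L[ℝ] L2 J}
    {Bp : ℕ → L2 J →L[ℝ] L2 J} {b : ℕ → ℝ} (hbs : Summable b)
    (hb : ∀ p : ℕ, ‖B - Bp p‖ ≤ b p * (2 : ℝ) ^ (-(s * p))) (i : Fin d) (L : ℕ) :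
    ‖modeOp i (B - adaptive Bp (Γ i) L) v‖ ≤
      (‖B‖ + 2 ^ s * ∑' q, b q) * M * (2 : ℝ) ^ (-(s * L)) := by
  have hM := h.nonneg
  have hb0 : ∀ q, 0 ≤ b q := fun q =>
    nonneg_of_mul_nonneg_left ((norm_nonneg _).trans (hb q)) (by positivity)
  have layer_le : ∀ p ∈ Finset.range (L + 1),
      ‖modeOp i (B - Bp (L - p)) (restr {l : MIdx d J | l i ∈ newLayer (Γ i) L p} v)‖ ≤
        2 ^ s * M * (2 : ℝ) ^ (-(s * L)) * b (L - p) := by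
    intro p hp
    obtain ⟨q, rfl⟩ := Nat.exists_eq_add_of_le (Finset.mem_range_succ_iff.1 hp)
    rw [Nat.add_sub_cancel_left]
    calc ‖modeOp i (B - Bp q) (restr {l : MIdx d J | l i ∈ newLayer (Γ i) (p + q) p} v)‖
        ≤ b q * (2 : ℝ) ^ (-(s * q)) * (2 ^ s * M * (2 : ℝ) ^ (-(s * p))) :=
          (norm_modeOp_le _ _ _).trans (mul_le_mul (hb q) (h.norm_restr_newLayer_le hs i _ p)
            (norm_nonneg _) (mul_nonneg (hb0 q) (by positivity)))
      _ = 2 ^ s * M * (2 : ℝ) ^ (-(s * (p + q : ℕ))) * b q := by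
          rw [show -(s * (p + q : ℕ)) = -(s * p) + -(s * q) by push_cast; ring,
            Real.rpow_add two_pos]
          ring
  calc ‖modeOp i (B - adaptive Bp (Γ i) L) v‖
      ≤ ‖B‖ * (M * (2 : ℝ) ^ (-(s * L))) +
          ∑ p ∈ Finset.range (L + 1), 2 ^ s * M * (2 : ℝ) ^ (-(s * L)) * b (L - p) := by
        simp only [sub_adaptive, modeOp_add, modeOp_sum, modeOp_comp_restrL]
        refine (norm_add_le _ _).trans (add_le_add ?_ (norm_sum_le_of_le _ layer_le))
        exact (norm_modeOp_le _ _ _).trans (mul_le_mul_of_nonneg_left (h.2 i L) (norm_nonneg _))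
    _ ≤ ‖B‖ * (M * (2 : ℝ) ^ (-(s * L))) + 2 ^ s * M * (2 : ℝ) ^ (-(s * L)) * ∑' q, b q := by
        rw [← Finset.mul_sum]
        gcongr
        exact sum_range_sub_le_tsum hb0 hbs L
    _ = (‖B‖ + 2 ^ s * ∑' q, b q) * M * (2 : ℝ) ^ (-(s * L)) := by ring

end LayerDecay

theorem card_biUnion_layers_le {X Y : Type*} [DecidableEq Y] {T : ℕ → X → Finset Y}
    {Γ : ℕ → Finset X} {a : ℕ → ℝ} {c : ℝ} (ha : ∀ q, 0 ≤ a q) (has : Summable a)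
    (hT : ∀ q x, ((T q x).card : ℝ) ≤ a q * 2 ^ q) (hc : 0 ≤ c)
    (hΓ : ∀ p, ((Γ p).card : ℝ) ≤ c * 2 ^ p) (L : ℕ) :
    (((Finset.range (L + 1)).biUnion fun p => (Γ p).biUnion (T (L - p))).card : ℝ) ≤
      (∑' q, a q) * c * 2 ^ L := by
  have layer_le : ∀ p ∈ Finset.range (L + 1),
      (((Γ p).biUnion (T (L - p))).card : ℝ) ≤ a (L - p) * (c * 2 ^ L) := by
    intro p hpL
    obtain ⟨q, rfl⟩ := Nat.exists_eq_add_of_le (Finset.mem_range_succ_iff.1 hpL)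
    rw [Nat.add_sub_cancel_left]
    calc (((Γ p).biUnion (T q)).card : ℝ)
        ≤ ∑ x ∈ Γ p, ((T q x).card : ℝ) := mod_cast Finset.card_biUnion_le
      _ ≤ (Γ p).card * (a q * 2 ^ q) := by
          rw [← nsmul_eq_mul]
          exact Finset.sum_le_card_nsmul _ _ _ fun x _ => hT q x
      _ ≤ c * 2 ^ p * (a q * 2 ^ q) :=
          mul_le_mul_of_nonneg_right (hΓ p) (mul_nonneg (ha q) (by positivity))
      _ = a q * (c * 2 ^ (p + q)) := by ring
  calc _ ≤ ∑ p ∈ Finset.range (L + 1), (((Γ p).biUnion (T (L - p))).card : ℝ) :=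
        mod_cast Finset.card_biUnion_le
    _ ≤ (∑ p ∈ Finset.range (L + 1), a (L - p)) * (c * 2 ^ L) := by
        rw [Finset.sum_mul]
        exact Finset.sum_le_sum layer_le
    _ ≤ (∑' q, a q) * (c * 2 ^ L) := by
        gcongr
        exact sum_range_sub_le_tsum ha has L
    _ = (∑' q, a q) * c * 2 ^ L := (mul_assoc _ _ _).symm

namespace IsCompressionScheme

variable {s : ℝ} {B : L2 J →L[ℝ] L2 J} {Bp : ℕ → L2 J →L[ℝ] L2 J}

theorem exists_norm_bound (hs : 0 ≤ s) (h : IsCompressionScheme s B Bp) (i : Fin d) :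
    ∃ c : ℝ, 0 ≤ c ∧ ‖B‖ ≤ c ∧ ∀ (Γ : Fin d → ℕ → Finset J) (L : ℕ),
      ‖adaptive Bp (Γ i) L‖ ≤ c ∧ ∀ (v : L2 (MIdx d J)) (M : ℝ), LayerDecay s M Γ v →
        ‖modeOp i (B - adaptive Bp (Γ i) L) v‖ ≤ c * M * (2 : ℝ) ^ (-(s * L)) := by
  obtain ⟨a, b, -, hb, -, hbs, hp⟩ := h
  have sum_nonneg : 0 ≤ ∑' q, b q := tsum_nonneg fun q => (hb q).le
  have one_le : 1 ≤ (2 : ℝ) ^ s := Real.one_le_rpow one_le_two hs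
  have sum_le : ∑' q, b q ≤ 2 ^ s * ∑' q, b q := le_mul_of_one_le_left sum_nonneg one_le
  have hB := norm_nonneg B
  refine ⟨2 * ‖B‖ + 2 ^ s * ∑' q, b q, by positivity, by linarith, fun Γ L => ⟨?_, ?_⟩⟩
  · refine (norm_adaptive_le (fun p => (hp p).2.2.trans ?_) hbs (Γ i) L).trans (by linarith)
    refine mul_le_of_le_one_right (hb p).le (Real.rpow_le_one_of_one_le_of_nonpos one_le_two ?_)
    exact neg_nonpos.2 (by positivity)
  · intro v M hv
    have hM := hv.nonneg
    refine (hv.norm_modeOp_sub_adaptive_le hs hbs (fun p => (hp p).2.2) i L).trans ?_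
    gcongr
    linarith

theorem exists_rows_bound (h : IsCompressionScheme s B Bp) :
    ∃ C : ℝ, 0 ≤ C ∧ ∀ (Γ : ℕ → Finset J) (L : ℕ) (c : ℝ), 0 ≤ c →
      (∀ p, ((Γ p).card : ℝ) ≤ c * 2 ^ p) → ∃ G : Finset J,
        (∀ x y, entry (adaptive Bp Γ L) x y ≠ 0 → x ∈ G) ∧ (G.card : ℝ) ≤ C * c * 2 ^ L := by
  classical
  obtain ⟨a, b, ha, -, has, -, hp⟩ := h
  have finite_col : ∀ p y, {x | entry (Bp p) x y ≠ 0}.Finite := fun p y => ((hp p).2.1 y).1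
  have card_col : ∀ p y, ((finite_col p y).toFinset.card : ℝ) ≤ a p * 2 ^ p := fun p y => by
    rw [← Set.ncard_eq_toFinset_card _ (finite_col p y)]
    exact ((hp p).2.1 y).2
  refine ⟨∑' q, a q, tsum_nonneg fun q => (ha q).le, fun Γ L c hc hΓ => ?_⟩
  refine ⟨(Finset.range (L + 1)).biUnion fun p => (Γ p).biUnion fun y =>
    (finite_col (L - p) y).toFinset, fun x y hxy => ?_,
    card_biUnion_layers_le (fun p => (ha p).le) has card_col hc hΓ L⟩
  rw [entry_adaptive] at hxy
  obtain ⟨hy, hxy⟩ := ite_ne_right_iff.1 hxy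
  have first_mem : y ∈ Γ (sInf {p | y ∈ Γ p}) := Nat.sInf_mem (s := {p | y ∈ Γ p}) ⟨L, hy⟩
  simp only [Finset.mem_biUnion, Finset.mem_range_succ_iff, Set.Finite.mem_toFinset]
  exact ⟨_, Nat.sInf_le hy, y, first_mem, hxy⟩

end IsCompressionScheme

end Compression

/-! ### The compressed operator -/

section Telescoping

theorem prod_sub_prod_eq_sum {ι A : Type*} [Fintype ι] [LinearOrder ι] [CommRing A] (a b : ι → A) :
    ∏ j, a j - ∏ j, b j =
      ∑ i, ∏ j, (if j < i then b j else if j = i then a j - b j else a j) := by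
  have telescope := Finset.prod_sub_ordered Finset.univ a fun j => a j - b j
  simp only [sub_sub_cancel] at telescope
  rw [telescope, sub_sub_cancel]
  refine Finset.sum_congr rfl fun i _ => ?_
  have filter_eq : (Finset.univ.filter fun j => ¬ j < i) =
      insert i (Finset.univ.filter fun j => i < j) := by
    ext j
    simp [le_iff_eq_or_lt, eq_comm]
  have prod_eq : ∏ j with i < j, (if j = i then a j - b j else a j) = ∏ j with i < j, a j :=
    Finset.prod_congr rfl fun j hj => if_neg (Finset.mem_filter.1 hj).2.ne'
  rw [Finset.prod_ite, filter_eq, Finset.prod_insert (by simp), if_pos rfl, prod_eq]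
  ring

variable {d : ℕ} {J : Type*}

theorem exists_tensor_sub_apply {B A : Fin d → L2 J →L[ℝ] L2 J} {F : Finset (MIdx d J)}
    {v : L2 (MIdx d J)} (hv : SuppIn (F : Set (MIdx d J)) v) {c r : ℝ} (hc : 1 ≤ c)
    (hB : ∀ j, ‖B j‖ ≤ c) (hA : ∀ j, ‖A j‖ ≤ c) (hr : ∀ i, ‖modeOp i (B i - A i) v‖ ≤ r) :
    ∃ e : L2 (MIdx d J), (∀ l, e l = ∑ m ∈ F,
        (∏ j, entry (B j) (l j) (m j) - ∏ j, entry (A j) (l j) (m j)) * v m) ∧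
      ‖e‖ ≤ d * (c ^ d * r) := by
  let T : Fin d → Fin d → L2 J →L[ℝ] L2 J := fun i j =>
    if j < i then A j else if j = i then B j - A j else B j
  have norm_le : ∀ i j, j ≠ i → ‖T i j‖ ≤ c := by
    intro i j hj
    simp only [T, if_neg hj]
    split_ifs
    exacts [hA j, hB j]
  have diag_eq : ∀ i, T i i = B i - A i := fun i => by
    simp only [T, lt_irrefl, if_false, if_true]
  choose E hE norm_E using fun i => exists_tensor_apply hv hc i (norm_le i)
  refine ⟨∑ i, E i, fun l => ?_, ?_⟩
  · simp only [lp.coeFn_sum, Finset.sum_apply, hE]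
    rw [Finset.sum_comm]
    refine Finset.sum_congr rfl fun m _ => ?_
    rw [← Finset.sum_mul, prod_sub_prod_eq_sum]
    congr 1
    refine Finset.sum_congr rfl fun i _ => Finset.prod_congr rfl fun j _ => ?_
    simp only [T]
    split_ifs <;> rfl
  · calc ‖∑ i, E i‖ ≤ ∑ _i : Fin d, c ^ d * r := norm_sum_le_of_le _ fun i _ =>
          (norm_E i).trans (by rw [diag_eq]; gcongr; exact hr i)
      _ = d * (c ^ d * r) := by simp

end Telescoping

namespace Problem

variable {d R : ℕ} {J : Type*} {P : Problem d R J}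

theorem ScalingValid.abs_prod_weight_mul_le (hscal : P.ScalingValid) {o : Fin d → ℕ}
    (ho : ∑ j, o j ≤ 1) {z : MIdx d J → ℝ} {c : ℝ} (hz : ∀ l, |z l| ≤ c * (P.D l)⁻¹)
    (l : MIdx d J) : |(∏ j, P.weight j (l j) ^ o j) * z l| ≤ c := by
  have D_pos : 0 < P.D l := zero_lt_one.trans_le (hscal.one_le_D l)
  have prod_nonneg : 0 ≤ ∏ j, P.weight j (l j) ^ o j :=
    Finset.prod_nonneg fun j _ => pow_nonneg (hscal.weight_pos j _).le _
  calc |(∏ j, P.weight j (l j) ^ o j) * z l| = (∏ j, P.weight j (l j) ^ o j) * |z l| := by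
        rw [abs_mul, abs_of_nonneg prod_nonneg]
    _ ≤ P.D l * (c * (P.D l)⁻¹) :=
        mul_le_mul (hscal.prod_weight_le ho l) (hz l) (abs_nonneg _) D_pos.le
    _ = c := by field_simp

theorem compL_eq (Γ : ℕ → Finset J) (L : ℕ) (n : Fin R) (j : Fin d) (x y : J) :
    P.compL Γ L n j x y = P.weight j x ^ P.testOrd n j *
      entry (adaptive (P.compressed n j) Γ L) x y * P.weight j y ^ P.trialOrd n j := by
  rw [entry_adaptive, compL]
  split_ifs <;> simp

theorem comp_eq (hscal : P.ScalingValid) (hsep : P.Separable) (n : Fin R) (j : Fin d) (x y : J) :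
    P.comp n j x y = P.weight j x ^ P.testOrd n j *
      entry (P.compHat n j) x y * P.weight j y ^ P.trialOrd n j := by
  have hx := (hscal.weight_pos j x).ne'
  have hy := (hscal.weight_pos j y).ne'
  rw [hsep.entry_eq]
  field_simp

theorem exists_term_error {s : ℝ} (hscal : P.ScalingValid) (hsep : P.Separable) (hs : 0 ≤ s)
    (n : Fin R) (hscheme : ∀ j, IsCompressionScheme s (P.compHat n j) (P.compressed n j)) :
    ∃ C : ℝ, 0 ≤ C ∧ ∀ (Γ : Fin d → ℕ → Finset J) (L : ℕ) (F : Finset (MIdx d J))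
      (v : L2 (MIdx d J)) (z₁ z₂ : MIdx d J → ℝ) (c M : ℝ), 0 ≤ c →
      (∀ l, |z₁ l| ≤ c * (P.D l)⁻¹) → (∀ l, |z₂ l| ≤ c * (P.D l)⁻¹) →
      SuppIn (F : Set (MIdx d J)) v → LayerDecay s M Γ v →
      ∃ e : L2 (MIdx d J), (∀ l, e l = z₁ l * ∑ m ∈ F, (∏ j, P.comp n j (l j) (m j) -
          ∏ j, P.compL (Γ j) L n j (l j) (m j)) * (z₂ m * v m)) ∧
        ‖e‖ ≤ C * c ^ 2 * M * (2 : ℝ) ^ (-(s * L)) := by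
  choose c₀ hc₀ hB hA using fun j => (hscheme j).exists_norm_bound hs j
  set c₁ : ℝ := 1 + ∑ j, c₀ j
  have one_le : 1 ≤ c₁ := le_add_of_nonneg_right (Finset.sum_nonneg fun j _ => hc₀ j)
  have le_c₁ : ∀ j, c₀ j ≤ c₁ := fun j =>
    (Finset.single_le_sum (fun j _ => hc₀ j) (Finset.mem_univ j)).trans
      (le_add_of_nonneg_left zero_le_one)
  refine ⟨d * c₁ ^ (d + 1), by positivity, ?_⟩
  intro Γ L F v z₁ z₂ c M hc hz₁ hz₂ hv hdecay
  have trial_le := hscal.abs_prod_weight_mul_le (hsep.trialOrd_le n) hz₂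
  have test_le := hscal.abs_prod_weight_mul_le (hsep.testOrd_le n) hz₁
  have hM := hdecay.nonneg
  have abs_le_mul {g : MIdx d J → ℝ} (hg : ∀ l, |g l| ≤ c) (w : L2 (MIdx d J)) (l : MIdx d J) :
      |g l * w l| ≤ c * |w l| := by
    rw [abs_mul]
    exact mul_le_mul_of_nonneg_right (hg l) (abs_nonneg _)
  obtain ⟨w, hw, -⟩ := exists_of_abs_le_mul hc v (abs_le_mul trial_le v)
  have supp_w : SuppIn (F : Set (MIdx d J)) w := fun l hl => by rw [hw, hv l hl, mul_zero]
  have decay_w : LayerDecay s (c * M) Γ w :=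
    hdecay.of_abs_le_mul hc fun l => by rw [hw]; exact abs_le_mul trial_le v l
  obtain ⟨E, hE, norm_E⟩ := exists_tensor_sub_apply supp_w one_le
    (fun j => (hB j).trans (le_c₁ j)) (fun j => (hA j Γ L).1.trans (le_c₁ j))
    (r := c₁ * (c * M) * (2 : ℝ) ^ (-(s * L))) fun i =>
      ((hA i Γ L).2 w _ decay_w).trans (by have := le_c₁ i; gcongr)
  obtain ⟨e, he, norm_e⟩ := exists_of_abs_le_mul hc E (abs_le_mul test_le E)
  refine ⟨e, fun l => ?_, ?_⟩
  · rw [he, hE, Finset.mul_sum, Finset.mul_sum]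
    refine Finset.sum_congr rfl fun m _ => ?_
    simp only [comp_eq hscal hsep, compL_eq, Finset.prod_mul_distrib, hw]
    ring
  · calc ‖e‖ ≤ c * (d * (c₁ ^ d * (c₁ * (c * M) * (2 : ℝ) ^ (-(s * L))))) :=
          norm_e.trans (mul_le_mul_of_nonneg_left norm_E hc)
      _ = d * c₁ ^ (d + 1) * c ^ 2 * M * (2 : ℝ) ^ (-(s * L)) := by ring

theorem exists_apply_error {s : ℝ} (hscal : P.ScalingValid) (hsep : P.Separable) (hs : 0 ≤ s)
    (hscheme : ∀ n j, IsCompressionScheme s (P.compHat n j) (P.compressed n j)) :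
    ∃ C : ℝ, 0 ≤ C ∧ ∀ (Γ : Fin d → ℕ → Finset J) (L : ℕ) (F : Finset (MIdx d J))
      (v : L2 (MIdx d J)) (z₁ z₂ : MIdx d J → ℝ) (c M : ℝ), 0 ≤ c →
      (∀ l, |z₁ l| ≤ c * (P.D l)⁻¹) → (∀ l, |z₂ l| ≤ c * (P.D l)⁻¹) →
      SuppIn (F : Set (MIdx d J)) v → LayerDecay s M Γ v →
      ∃ e : L2 (MIdx d J),
        (∀ l, e l = z₁ l * ∑' m, (P.matA l m - P.matL Γ L l m) * (z₂ m * v m)) ∧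
        ‖e‖ ≤ C * c ^ 2 * M * (2 : ℝ) ^ (-(s * L)) := by
  choose C hC term_error using fun n => exists_term_error hscal hsep hs n (hscheme n)
  refine ⟨∑ n, C n, Finset.sum_nonneg fun n _ => hC n, ?_⟩
  intro Γ L F v z₁ z₂ c M hc hz₁ hz₂ hv hdecay
  choose e he norm_e using fun n => term_error n Γ L F v z₁ z₂ c M hc hz₁ hz₂ hv hdecay
  refine ⟨∑ n, e n, fun l => ?_, ?_⟩
  · rw [lp.coeFn_sum, Finset.sum_apply, tsum_eq_sum (s := F) fun m hm => by
      rw [hv m (by simpa using hm), mul_zero, mul_zero]]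
    simp_rw [he]
    rw [← Finset.mul_sum, Finset.sum_comm]
    congr 1
    refine Finset.sum_congr rfl fun m _ => ?_
    rw [← Finset.sum_mul, matA, matL, Finset.sum_sub_distrib]
  · simpa only [Finset.sum_mul] using norm_sum_le_of_le Finset.univ fun n _ => norm_e n

theorem exists_rows_bound {s : ℝ}
    (hscheme : ∀ n j, IsCompressionScheme s (P.compHat n j) (P.compressed n j)) :
    ∃ C : ℝ, 0 ≤ C ∧ ∀ (Γ : Fin d → ℕ → Finset J) (L : ℕ) (c : ℝ), 0 ≤ c →
      (∀ j p, ((Γ j p).card : ℝ) ≤ c * 2 ^ p) → ∀ j, ∃ G : Finset J,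
        (∀ l m, P.matL Γ L l m ≠ 0 → l j ∈ G) ∧ (G.card : ℝ) ≤ C * c * 2 ^ L := by
  classical
  choose C hC rows_bound using fun n j => (hscheme n j).exists_rows_bound
  refine ⟨∑ n, ∑ j, C n j,
    Finset.sum_nonneg fun n _ => Finset.sum_nonneg fun j _ => hC n j, ?_⟩
  intro Γ L c hc hΓ j
  choose G mem_G card_G using fun n => rows_bound n j (Γ j) L c hc (hΓ j)
  refine ⟨Finset.univ.biUnion G, fun l m hlm => ?_, ?_⟩
  · obtain ⟨n, -, hn⟩ := Finset.exists_ne_zero_of_sum_ne_zero hlm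
    have comp_ne := Finset.prod_ne_zero_iff.1 hn j (Finset.mem_univ j)
    rw [compL_eq] at comp_ne
    exact Finset.mem_biUnion.2 ⟨n, Finset.mem_univ n,
      mem_G n _ _ (right_ne_zero_of_mul (left_ne_zero_of_mul comp_ne))⟩
  · calc ((Finset.univ.biUnion G).card : ℝ) ≤ ∑ n, ((G n).card : ℝ) :=
          mod_cast Finset.card_biUnion_le
      _ ≤ ∑ n, (∑ j, C n j) * (c * 2 ^ L) := Finset.sum_le_sum fun n _ => by
          rw [← mul_assoc]
          refine (card_G n).trans ?_
          gcongr
          exact Finset.single_le_sum (fun j _ => hC n j) (Finset.mem_univ j)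
      _ = (∑ n, ∑ j, C n j) * c * 2 ^ L := by rw [← Finset.sum_mul, mul_assoc]

end Problem

/-! ### Approximation classes -/

section ApproximationClasses

variable {J : Type*} {s : ℝ} {w : L2 J}

theorem encard_support_restr_le (F : Finset J) (w : L2 J) :
    (Function.support (restr (F : Set J) w)).encard ≤ F.card := by
  rw [← Set.encard_coe_eq_coe_finsetCard]
  exact Set.encard_le_encard fun x hx => by_contra fun hxF => hx (restr_of_notMem hxF w)

theorem nterm_le_card {F : Finset J} {ε : ℝ} (h : ‖w - restr (F : Set J) w‖ ≤ ε) :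
    nterm w ε ≤ F.card :=
  Nat.sInf_le ⟨restr (F : Set J) w, encard_support_restr_le F w, h⟩

theorem nterm_eq_zero_of_norm_le {ε : ℝ} (h : ‖w‖ ≤ ε) : nterm w ε = 0 :=
  Nat.le_zero.1 (Nat.sInf_le ⟨0, by simp [Function.support], by rwa [sub_zero]⟩)

theorem exists_finset_card_le_nterm (w : L2 J) {ε : ℝ} (hε : 0 < ε) :
    ∃ F : Finset J, ‖w - restr (F : Set J) w‖ ≤ ε ∧ F.card ≤ nterm w ε := by
  classical
  have nonempty :
      {N : ℕ | ∃ v : L2 J, (Function.support v).encard ≤ N ∧ ‖w - v‖ ≤ ε}.Nonempty := by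
    obtain ⟨F, hF⟩ := exists_finset_norm_sub_restr_le w hε
    exact ⟨F.card, restr (F : Set J) w, encard_support_restr_le F w, hF⟩
  obtain ⟨v, hv, hwv⟩ := Nat.sInf_mem nonempty
  have hfin : (Function.support v).Finite := Set.finite_of_encard_le_coe hv
  refine ⟨hfin.toFinset, (norm_le_of_abs_le fun i => ?_).trans hwv, ?_⟩
  · rw [lp.coeFn_sub, lp.coeFn_sub, Pi.sub_apply, Pi.sub_apply, restr_apply]
    by_cases hi : v i = 0 <;> simp [hi]
  · rw [hfin.encard_eq_coe_toFinset_card] at hv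
    exact_mod_cast hv

theorem exists_finset_of_asNorm_lt_top (hs : 0 ≤ s) (h : asNorm s w < ⊤) {ε : ℝ} (hε : 0 < ε) :
    ∃ F : Finset J, ‖w - restr (F : Set J) w‖ ≤ ε ∧
      ε * (F.card : ℝ) ^ s ≤ (asNorm s w).toReal := by
  obtain ⟨F, hF, hcard⟩ := exists_finset_card_le_nterm w hε
  have nterm_le : ENNReal.ofReal (ε * (nterm w ε : ℝ) ^ s) ≤ asNorm s w :=
    le_iSup₂ (f := fun (ε : ℝ) (_ : 0 < ε) => ENNReal.ofReal (ε * (nterm w ε : ℝ) ^ s)) ε hε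
  refine ⟨F, hF, le_trans ?_ ((ENNReal.ofReal_le_iff_le_toReal h.ne).1 nterm_le)⟩
  gcongr

theorem eq_zero_of_asNorm_eq_zero (hs : 0 ≤ s) (h : asNorm s w = 0) : w = 0 := by
  refine norm_le_zero_iff.1 (le_of_forall_pos_le_add fun ε hε => ?_)
  obtain ⟨F, hF, hcard⟩ := exists_finset_of_asNorm_lt_top hs (h ▸ ENNReal.zero_lt_top) hε
  have hF0 : F = ∅ := by
    by_contra hne
    have card_pos : 0 < (F.card : ℝ) :=
      mod_cast Finset.card_pos.2 (Finset.nonempty_of_ne_empty hne)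
    rw [h, ENNReal.toReal_zero] at hcard
    exact hcard.not_gt (by positivity)
  rwa [hF0, sub_restr, Finset.coe_empty, Set.compl_empty, restr_univ, ← zero_add ε] at hF

theorem exists_card_le_of_asNorm_lt_top (hs : 0 < s) (h : asNorm s w < ⊤) :
    ∃ c : ℝ, 0 < c ∧ ∀ ε : ℝ, 0 < ε → ∃ F : Finset J, ‖w - restr (F : Set J) w‖ ≤ ε ∧
      (F.card : ℝ) ≤ (c / ε) ^ (1 / s) := by
  refine ⟨(asNorm s w).toReal + 1, by positivity, fun ε hε => ?_⟩
  obtain ⟨F, hF, hcard⟩ := exists_finset_of_asNorm_lt_top hs.le h hε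
  refine ⟨F, hF, ?_⟩
  rw [one_div, Real.le_rpow_inv_iff_of_pos (by positivity) (by positivity) hs, le_div_iff₀ hε]
  linarith

theorem rpow_two_pow (s : ℝ) (p : ℕ) : ((2 : ℝ) ^ p) ^ s = (2 : ℝ) ^ (s * p) := by
  rw [← Real.rpow_natCast, ← Real.rpow_mul two_pos.le, mul_comm]

theorem exists_decay_of_asNorm_lt_top (hs : 0 < s) (h : asNorm s w < ⊤) :
    ∃ c : ℝ, 0 < c ∧ ∀ p : ℕ, ∃ F : Finset J, F.card ≤ 2 ^ p ∧
      ‖w - restr (F : Set J) w‖ ≤ c * (2 : ℝ) ^ (-(s * p)) := by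
  obtain ⟨c, hc, exists_card_le⟩ := exists_card_le_of_asNorm_lt_top hs h
  refine ⟨c, hc, fun p => ?_⟩
  obtain ⟨F, hF, hcard⟩ := exists_card_le (c * (2 : ℝ) ^ (-(s * p))) (by positivity)
  have size_eq : (c / (c * (2 : ℝ) ^ (-(s * p)))) ^ (1 / s) = (2 : ℝ) ^ p := by
    rw [div_mul_cancel_left₀ hc.ne', ← Real.rpow_neg two_pos.le, neg_neg, ← rpow_two_pow,
      one_div, Real.rpow_rpow_inv (by positivity) hs.ne']
  rw [size_eq] at hcard
  exact ⟨F, mod_cast hcard, hF⟩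

theorem exists_rpow_two_neg_le (hs : 0 < s) (c : ℝ) {ε : ℝ} (hε : 0 < ε) :
    ∃ p : ℕ, c * (2 : ℝ) ^ (-(s * p)) ≤ ε ∧ ε * (2 : ℝ) ^ (s * p) ≤ max ε (2 ^ s * c) := by
  have exists_le : ∃ p : ℕ, c * (2 : ℝ) ^ (-(s * p)) ≤ ε := by
    obtain ⟨p, hp⟩ := pow_unbounded_of_one_lt (c / ε) (Real.one_lt_rpow one_lt_two hs)
    refine ⟨p, ?_⟩
    rw [Real.rpow_neg two_pos.le, ← div_eq_mul_inv, div_le_comm₀ (by positivity) hε,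
      Real.rpow_mul two_pos.le, Real.rpow_natCast]
    exact hp.le
  classical
  refine ⟨Nat.find exists_le, Nat.find_spec exists_le, ?_⟩
  rcases hp : Nat.find exists_le with _ | q
  · simp
  · have lt_prev : ε < c * (2 : ℝ) ^ (-(s * q)) := not_le.1 (Nat.find_min exists_le (by lia))
    rw [Real.rpow_neg two_pos.le, ← div_eq_mul_inv, lt_div_iff₀ (by positivity)] at lt_prev
    refine le_max_of_le_right ?_
    calc ε * (2 : ℝ) ^ (s * (q + 1 : ℕ)) = 2 ^ s * (ε * 2 ^ (s * q)) := by
          rw [Nat.cast_succ, mul_add_one, Real.rpow_add two_pos]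
          ring
      _ ≤ 2 ^ s * c := by gcongr

theorem asNorm_lt_top_of_decay (hs : 0 < s) {c₁ c₂ : ℝ} (hc₁ : 0 ≤ c₁)
    (h : ∀ p : ℕ, ∃ F : Finset J, (F.card : ℝ) ≤ c₁ * 2 ^ p ∧
      ‖w - restr (F : Set J) w‖ ≤ c₂ * (2 : ℝ) ^ (-(s * p))) : asNorm s w < ⊤ := by
  refine lt_of_le_of_lt (b := ENNReal.ofReal (c₁ ^ s * max ‖w‖ (2 ^ s * c₂)))
    (iSup₂_le fun ε hε => ENNReal.ofReal_le_ofReal ?_) ENNReal.ofReal_lt_top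
  rcases le_or_gt ‖w‖ ε with hw | hw
  · rw [nterm_eq_zero_of_norm_le hw, Nat.cast_zero, Real.zero_rpow hs.ne', mul_zero]
    exact mul_nonneg (by positivity) (le_max_of_le_left (norm_nonneg w))
  · obtain ⟨p, error_le, level_le⟩ := exists_rpow_two_neg_le hs c₂ hε
    obtain ⟨F, hF, hFw⟩ := h p
    have nterm_le : (nterm w ε : ℝ) ≤ c₁ * 2 ^ p :=
      (Nat.cast_le.2 (nterm_le_card (hFw.trans error_le))).trans hF
    calc ε * (nterm w ε : ℝ) ^ s ≤ ε * (c₁ * 2 ^ p) ^ s := by gcongr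
      _ = c₁ ^ s * (ε * (2 : ℝ) ^ (s * p)) := by
          rw [Real.mul_rpow hc₁ (by positivity), rpow_two_pow]
          ring
      _ ≤ c₁ ^ s * max ε (2 ^ s * c₂) := by gcongr
      _ ≤ c₁ ^ s * max ‖w‖ (2 ^ s * c₂) := by gcongr

end ApproximationClasses

/-! ### Sparsity of the right-hand side -/

section LayerDecay

variable {d : ℕ} {J : Type*} {s M : ℝ} {Γ : Fin d → ℕ → Finset J} {v : L2 (MIdx d J)}

theorem LayerDecay.norm_sub_restr_layers_le (h : LayerDecay s M Γ v) (L : ℕ) :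
    ‖v - restr (box fun j => Γ j L) v‖ ≤ √d * (M * (2 : ℝ) ^ (-(s * L))) :=
  (norm_sub_restr_box_le _ _).trans
    (tail_le _ _ (mul_nonneg h.nonneg (by positivity)) fun j => h.2 j L)

theorem layerDecay_restr (h : LayerDecay s M Γ v) (S : Set (MIdx d J)) :
    LayerDecay s M Γ (restr S v) := by
  classical
  rw [← one_mul M]
  refine h.of_abs_le_mul zero_le_one fun l => ?_
  rw [restr_apply]
  split_ifs <;> simp

theorem exists_layerDecay (hs : 0 < s) (hv : ∀ j, asNorm s (contraction j v) < ⊤) :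
    ∃ (M : ℝ) (Γ : Fin d → ℕ → Finset J), (∀ j p, (Γ j p).card ≤ 2 ^ p) ∧
      LayerDecay s M Γ v := by
  choose c hc Γ hcard decay using fun j => exists_decay_of_asNorm_lt_top hs (hv j)
  have sum_nonneg : 0 ≤ ∑ j, c j := Finset.sum_nonneg fun j _ => (hc j).le
  refine ⟨‖v‖ + ∑ j, c j, Γ, hcard, by linarith, fun j p => ?_⟩
  rw [← norm_contraction_sub_restr]
  have le_sum : c j ≤ ∑ i, c i :=
    Finset.single_le_sum (fun i _ => (hc i).le) (Finset.mem_univ j)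
  refine (decay j p).trans (mul_le_mul_of_nonneg_right ?_ (by positivity))
  linarith [norm_nonneg v]

end LayerDecay

namespace Problem

variable {d R : ℕ} {J : Type*} {P : Problem d R J} {s lmin lmax : ℝ}

namespace Equation

theorem spectralBounds (h : P.Equation lmin lmax) : SpectralBounds P.Aδ lmin lmax :=
  ⟨h.symm, h.lmin_pos, h.lmin_le, h.lower, h.upper⟩

theorem apply_sub (h : P.Equation lmin lmax) (v : L2 (MIdx d J)) :
    P.Aδ (P.uδ - v) = P.fδ - P.Aδ v := by rw [map_sub, h.solution]

theorem apply_eq_of_matL_eq_zero (h : P.Equation lmin lmax) {F : Finset (MIdx d J)}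
    {v : L2 (MIdx d J)} (hv : SuppIn (F : Set (MIdx d J)) v) {Γ : Fin d → ℕ → Finset J} {L : ℕ}
    {l : MIdx d J} (hl : ∀ m, P.matL Γ L l m = 0) :
    P.Aδ v l = P.Sinv l * ∑' m, (P.matA l m - P.matL Γ L l m) * (P.Sinv m * v m) := by
  rw [apply_of_suppIn P.Aδ hv, tsum_eq_sum (s := F) fun m hm => by rw [hv m hm]; simp,
    Finset.mul_sum]
  refine Finset.sum_congr rfl fun m _ => ?_
  rw [h.entry_eq, hl, sub_zero]
  ring

end Equation

theorem ScalingValid.exists_abs_Sinv_le (h : P.ScalingValid) :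
    ∃ c : ℝ, 0 ≤ c ∧ ∀ l, |P.Sinv l| ≤ c * (P.D l)⁻¹ := by
  obtain ⟨c, hc, bound⟩ := h.exists_Sinv_le
  exact ⟨c, hc.le, fun l => (abs_of_pos (bound l).1).trans_le (bound l).2⟩

/-- The approximations are obtained by applying the compressed operator of level `L` to the
restriction of the solution to its layers of level `L`. -/
theorem exists_restr_rhs_le (hscal : P.ScalingValid) (hsep : P.Separable)
    (heq : P.Equation lmin lmax) (hs : 0 < s)
    (hscheme : ∀ n j, IsCompressionScheme s (P.compHat n j) (P.compressed n j))
    (hu : ∀ j, asNorm s (contraction j P.uδ) < ⊤) :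
    ∃ c₁ c₂ : ℝ, 0 ≤ c₁ ∧ ∀ (j : Fin d) (L : ℕ), ∃ G : Finset J, (G.card : ℝ) ≤ c₁ * 2 ^ L ∧
      ‖restr {l : MIdx d J | l j ∉ G} P.fδ‖ ≤ c₂ * (2 : ℝ) ^ (-(s * L)) := by
  classical
  obtain ⟨M, Γ, hcard, decay⟩ := exists_layerDecay hs hu
  obtain ⟨CA, -, apply_error⟩ := exists_apply_error hscal hsep hs.le hscheme
  obtain ⟨CG, hCG, rows_bound⟩ := exists_rows_bound hscheme
  obtain ⟨c, hc, Sinv_le⟩ := hscal.exists_abs_Sinv_le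
  refine ⟨CG, ‖P.Aδ‖ * (√d * M) + CA * c ^ 2 * M, hCG, fun j L => ?_⟩
  set uL := restr (box fun j => Γ j L) P.uδ
  have uL_supp : SuppIn (Fintype.piFinset fun j => Γ j L : Set (MIdx d J)) uL := by
    rw [coe_piFinset_eq_box]
    exact suppIn_restr _ _
  obtain ⟨e, he, he_norm⟩ := apply_error Γ L _ uL P.Sinv P.Sinv c M hc Sinv_le Sinv_le uL_supp
    (layerDecay_restr decay _)
  obtain ⟨G, hG, G_card⟩ := rows_bound Γ L 1 zero_le_one
    (fun i p => by rw [one_mul]; exact_mod_cast hcard i p) j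
  refine ⟨G, by simpa using G_card, ?_⟩
  have rhs_eq : restr {l | l j ∉ G} P.fδ = restr {l | l j ∉ G} (P.Aδ (P.uδ - uL) + e) := by
    ext l
    rw [restr_apply, restr_apply]
    split_ifs with hl
    · have matL_eq_zero : ∀ m, P.matL Γ L l m = 0 := fun m => of_not_not fun h => hl (hG l m h)
      rw [heq.apply_sub, lp.coeFn_add, lp.coeFn_sub, Pi.add_apply, Pi.sub_apply, he,
        ← heq.apply_eq_of_matL_eq_zero uL_supp matL_eq_zero, sub_add_cancel]
    · rfl
  calc ‖restr {l | l j ∉ G} P.fδ‖ ≤ ‖P.Aδ (P.uδ - uL)‖ + ‖e‖ := by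
        rw [rhs_eq]
        exact (norm_restr_le _ _).trans (norm_add_le _ _)
    _ ≤ ‖P.Aδ‖ * (√d * (M * (2 : ℝ) ^ (-(s * L)))) + CA * c ^ 2 * M * (2 : ℝ) ^ (-(s * L)) :=
        add_le_add (P.Aδ.le_opNorm_of_le (decay.norm_sub_restr_layers_le L)) he_norm
    _ = _ := by ring

theorem asNorm_rhs_lt_top (hscal : P.ScalingValid) (hsep : P.Separable)
    (heq : P.Equation lmin lmax) (hs : 0 < s)
    (hscheme : ∀ n j, IsCompressionScheme s (P.compHat n j) (P.compressed n j))
    (hu : ∀ j, asNorm s (contraction j P.uδ) < ⊤) (j : Fin d) :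
    asNorm s (contraction j P.fδ) < ⊤ := by
  obtain ⟨c₁, c₂, hc₁, exists_rows⟩ := exists_restr_rhs_le hscal hsep heq hs hscheme hu
  refine asNorm_lt_top_of_decay hs hc₁ (c₂ := c₂) fun L => ?_
  obtain ⟨G, hG, decay⟩ := exists_rows j L
  exact ⟨G, hG, (norm_contraction_sub_restr _ _ _).trans_le decay⟩

theorem exists_card_of_encard_support_le {g : L2 (MIdx d J)} {x : ℝ} {X : ℝ≥0∞} (hx : 0 ≤ x)
    (hX : X ≠ ⊤) (h : ∑ j, ((Function.support (contraction j g)).encard : ℝ≥0∞) ≤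
      ENNReal.ofReal x * X) (j : Fin d) :
    ∃ G : Finset J, (∀ l, g l ≠ 0 → l j ∈ G) ∧ (G.card : ℝ) ≤ x * X.toReal := by
  have bound_ne_top : ENNReal.ofReal x * X ≠ ⊤ := ENNReal.mul_ne_top ENNReal.ofReal_ne_top hX
  have encard_le : ((Function.support (contraction j g)).encard : ℝ≥0∞) ≤
      ENNReal.ofReal x * X := le_trans (Finset.single_le_sum
    (f := fun j => ((Function.support (contraction j g)).encard : ℝ≥0∞))
    (fun _ _ => zero_le) (Finset.mem_univ j)) h
  have finite : (Function.support (contraction j g)).Finite := by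
    rw [← Set.encard_ne_top_iff]
    intro encard_eq_top
    rw [encard_eq_top, ENat.toENNReal_top, top_le_iff] at encard_le
    exact bound_ne_top encard_le
  refine ⟨finite.toFinset, fun l hl => ?_, ?_⟩
  · rw [Set.Finite.mem_toFinset, Function.mem_support]
    exact (contraction_ne_zero_iff j g (l j)).2 ⟨l, rfl, hl⟩
  · rw [finite.encard_eq_coe_toFinset_card] at encard_le
    have card_le := ENNReal.toReal_mono bound_ne_top encard_le
    rwa [ENNReal.toReal_mul, ENNReal.toReal_ofReal hx, ENat.toENNReal_coe,
      ENNReal.toReal_natCast] at card_le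

theorem exists_fApprox_support_bound (hscal : P.ScalingValid) (hs : 0 ≤ s)
    (hrhs : P.RhsApproximable s) (hf : ∀ j, asNorm s (contraction j P.fδ) < ⊤) :
    ∃ C : ℝ, 0 ≤ C ∧ ∀ ε : ℝ, 0 < ε → ∀ j, ∃ G : Finset J,
      (∀ l, P.fApprox ε l ≠ 0 → l j ∈ G) ∧ (G.card : ℝ) ≤ C * ε ^ (-1 / s) := by
  obtain ⟨C, hC, approx⟩ := hrhs
  obtain ⟨c, -, Sinv_pos⟩ := hscal.exists_Sinv_le
  set X : ℝ≥0∞ := (∑ j, asNorm s (contraction j P.fδ)) ^ (1 / s)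
  have hX : X ≠ ⊤ :=
    ENNReal.rpow_ne_top_of_nonneg (by positivity) (ENNReal.sum_ne_top.2 fun j _ => (hf j).ne)
  refine ⟨C * X.toReal, by positivity, fun ε hε j => ?_⟩
  obtain ⟨-, g, hg, hsupp, -⟩ := approx ε hε
  obtain ⟨G, hG, G_card⟩ := exists_card_of_encard_support_le (by positivity) hX hsupp j
  refine ⟨G, fun l hl => hG l ?_, G_card.trans_eq (by ring)⟩
  rw [hg]
  exact mul_ne_zero (Sinv_pos l).1.ne' hl

end Problem

/-! ### Sizes of approximate residuals -/

section Powers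

variable {s a x : ℝ} {p : ℕ}

theorem two_pow_le_div_rpow (hs : 0 < s) (ha : 0 ≤ a) (hx : 0 < x)
    (h : x ≤ a * (2 : ℝ) ^ (-(s * p))) : (2 : ℝ) ^ p ≤ (a / x) ^ (1 / s) := by
  rwa [one_div, Real.le_rpow_inv_iff_of_pos (by positivity) (by positivity) hs, rpow_two_pow,
    le_div_comm₀ (by positivity) hx, div_eq_mul_inv, ← Real.rpow_neg two_pos.le]

theorem le_rpow_mul_two_rpow_neg (hs : 0 < s) (ha : 0 ≤ a) (hx : 0 < x)
    (h : (2 : ℝ) ^ p ≤ a * x ^ (-1 / s)) : x ≤ a ^ s * (2 : ℝ) ^ (-(s * p)) := by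
  have two_rpow_le := Real.rpow_le_rpow (by positivity) h hs.le
  rwa [Real.mul_rpow ha (by positivity), ← Real.rpow_mul hx.le, div_mul_cancel₀ _ hs.ne',
    Real.rpow_neg_one, rpow_two_pow, ← div_eq_mul_inv, le_div_comm₀ (by positivity) hx,
    div_eq_mul_inv, ← Real.rpow_neg two_pos.le] at two_rpow_le

theorem one_le_rpow_mul_rpow_neg {W : ℝ} (hs : 0 < s) (hx : 0 < x) (hxW : x ≤ W) :
    1 ≤ W ^ (1 / s) * x ^ (-1 / s) := by
  rw [neg_div, Real.rpow_neg hx.le, ← div_eq_mul_inv, one_le_div (by positivity)]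
  exact Real.rpow_le_rpow hx.le hxW (by positivity)

theorem rpow_neg_le_of_mul_le {c y : ℝ} (hs : 0 < s) (hc : 0 < c) (hx : 0 < x) (h : c * x ≤ y) :
    y ^ (-1 / s) ≤ c ^ (-1 / s) * x ^ (-1 / s) := by
  rw [← Real.mul_rpow hc.le hx.le]
  exact Real.rpow_le_rpow_of_nonpos (by positivity) h
    (div_nonpos_of_nonpos_of_nonneg (by norm_num) hs.le)

end Powers

theorem restr_eq_zero_of_suppIn_box {d : ℕ} {J : Type*} {Λ : Fin d → Finset J}
    {v : L2 (MIdx d J)} (hv : SuppIn (box Λ) v) (j : Fin d) :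
    restr {l : MIdx d J | l j ∉ Λ j} v = 0 := by
  classical
  ext l
  rw [restr_apply]
  split_ifs with hl
  · exact hv l fun mem_box => hl (mem_box j)
  · rfl

theorem LayerDecay.of_isBestLayers {d : ℕ} {J : Type*} {s M c : ℝ} {F Γ : Fin d → ℕ → Finset J}
    {Λ : Fin d → Finset J} {u v : L2 (MIdx d J)} (h : LayerDecay s M F u)
    (hF : ∀ j p, (F j p).card ≤ 2 ^ p) (hv : SuppIn (box Λ) v) (hc : ‖u - v‖ ≤ c)
    (hclose : ∀ j (p : ℕ), 2 ^ p < (Λ j).card → ‖u - v‖ ≤ c * (2 : ℝ) ^ (-(s * p)))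
    (hΓ : ∀ j, IsBestLayers (contraction j v) (Γ j)) : LayerDecay s (M + c) Γ v := by
  refine ⟨?_, fun j p => ?_⟩
  · rw [← sub_sub_cancel u v]
    exact (norm_sub_le _ _).trans (add_le_add h.1 hc)
  have layer_best : ∀ G : Finset J, G.card ≤ 2 ^ p →
      ‖restr {l : MIdx d J | l j ∉ Γ j p} v‖ ≤ ‖restr {l : MIdx d J | l j ∉ G} v‖ := by
    intro G hG
    rw [← norm_contraction_sub_restr, ← norm_contraction_sub_restr]
    exact ((hΓ j).2 p).2 G hG
  have bound_nonneg : 0 ≤ (M + c) * (2 : ℝ) ^ (-(s * p)) :=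
    mul_nonneg (add_nonneg h.nonneg ((norm_nonneg _).trans hc)) (by positivity)
  rcases le_or_gt (Λ j).card (2 ^ p) with card_le | lt_card
  · refine (layer_best _ card_le).trans ?_
    rwa [restr_eq_zero_of_suppIn_box hv, norm_zero]
  · calc ‖restr {l : MIdx d J | l j ∉ Γ j p} v‖ ≤ ‖restr {l : MIdx d J | l j ∉ F j p} v‖ :=
          layer_best _ (hF j p)
      _ = ‖restr {l : MIdx d J | l j ∉ F j p} u - restr {l : MIdx d J | l j ∉ F j p} (u - v)‖ := by
          rw [restr_sub, sub_sub_cancel]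
      _ ≤ M * (2 : ℝ) ^ (-(s * p)) + c * (2 : ℝ) ^ (-(s * p)) :=
          (norm_sub_le _ _).trans
            (add_le_add (h.2 j p) ((norm_restr_le _ _).trans (hclose j p lt_card)))
      _ = (M + c) * (2 : ℝ) ^ (-(s * p)) := by ring

namespace Problem

variable {d R : ℕ} {J : Type*} {P : Problem d R J} {s : ℝ}

theorem exists_level_bound (hscal : P.ScalingValid) (hsep : P.Separable) (hs : 0 < s)
    (hscheme : ∀ n j, IsCompressionScheme s (P.compHat n j) (P.compressed n j)) :
    ∃ C : ℝ, 0 ≤ C ∧ ∀ (Γ : Fin d → ℕ → Finset J) (F : Finset (MIdx d J)) (v : L2 (MIdx d J))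
      (M ε : ℝ) (L : ℕ), SuppIn (F : Set (MIdx d J)) v → LayerDecay s M Γ v → 0 < ε →
      IsLeast {L | P.ApplyAccurate Γ v ε L} L → (2 : ℝ) ^ L ≤ 1 + 2 * (C * M / ε) ^ (1 / s) := by
  obtain ⟨C, hC, apply_error⟩ := exists_apply_error hscal hsep hs.le hscheme
  refine ⟨C, hC, fun Γ F v M ε L hv decay hε hL => ?_⟩
  have CM_nonneg : 0 ≤ C * M := mul_nonneg hC decay.nonneg
  rcases L with _ | q
  · rw [pow_zero, le_add_iff_nonneg_right]
    positivity
  have not_accurate : ¬ P.ApplyAccurate Γ v ε q := fun accurate => by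
    have := hL.2 accurate
    lia
  have Dinv_le : ∀ l, |(P.D l)⁻¹| ≤ 1 * (P.D l)⁻¹ := fun l => by
    rw [one_mul, abs_of_pos (inv_pos.2 (zero_lt_one.trans_le (hscal.one_le_D l)))]
  obtain ⟨e, he, he_norm⟩ := apply_error Γ q F v (fun l => (P.D l)⁻¹) (fun l => (P.D l)⁻¹) 1 M
    zero_le_one Dinv_le Dinv_le hv decay
  rw [one_pow, mul_one] at he_norm
  have tol_lt : ε < C * M * (2 : ℝ) ^ (-(s * q)) :=
    not_le.1 fun le_tol => not_accurate ⟨e, he, he_norm.trans le_tol⟩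
  rw [pow_succ']
  linarith [two_pow_le_div_rpow hs CM_nonneg hε tol_lt.le]

theorem exists_data_support_bound (hscal : P.ScalingValid) (hsep : P.Separable) (hs : 0 < s)
    (hscheme : ∀ n j, IsCompressionScheme s (P.compHat n j) (P.compressed n j))
    (hrhs : P.RhsApproximable s) (hf : ∀ j, asNorm s (contraction j P.fδ) < ⊤) (M : ℝ) :
    ∃ C : ℝ, 0 ≤ C ∧ ∀ (Γ : Fin d → ℕ → Finset J) (F : Finset (MIdx d J)) (v : L2 (MIdx d J))
      (ε : ℝ) (L : ℕ), SuppIn (F : Set (MIdx d J)) v → LayerDecay s M Γ v →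
      (∀ j p, (Γ j p).card ≤ 2 ^ p) → 0 < ε → IsLeast {L | P.ApplyAccurate Γ v ε L} L →
      ∃ G : Fin d → Finset J, (∀ l ∉ box G, P.fApprox ε l = 0 ∧ ∀ m, P.matL Γ L l m = 0) ∧
        ∀ j, ((G j).card : ℝ) ≤ C * (1 + ε ^ (-1 / s)) := by
  classical
  obtain ⟨CL, hCL, level_bound⟩ := exists_level_bound hscal hsep hs hscheme
  obtain ⟨CG, hCG, rows_bound⟩ := exists_rows_bound hscheme
  obtain ⟨Cf, hCf, fApprox_bound⟩ := exists_fApprox_support_bound hscal hs.le hrhs hf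
  set b : ℝ := 2 * |CL * M| ^ (1 / s)
  have : 0 ≤ b := by positivity
  refine ⟨Cf + CG * (1 + b), by positivity, fun Γ F v ε L hv decay hΓ hε hL => ?_⟩
  have level_le : (2 : ℝ) ^ L ≤ 1 + b * ε ^ (-1 / s) := by
    have CM_nonneg : 0 ≤ CL * M := mul_nonneg hCL decay.nonneg
    have := level_bound Γ F v M ε L hv decay hε hL
    rwa [Real.div_rpow CM_nonneg hε.le, div_eq_mul_inv, ← Real.rpow_neg hε.le, ← neg_div,
      ← mul_assoc, ← abs_of_nonneg CM_nonneg] at this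
  choose Gf hGf Gf_card using fApprox_bound ε hε
  choose GA hGA GA_card using rows_bound Γ L 1 zero_le_one fun j p => by
    rw [one_mul]; exact_mod_cast hΓ j p
  refine ⟨fun j => Gf j ∪ GA j, fun l hl => ⟨?_, fun m => ?_⟩, fun j => ?_⟩
  · by_contra h
    exact hl fun j => Finset.mem_union_left _ (hGf j l h)
  · by_contra h
    exact hl fun j => Finset.mem_union_right _ (hGA j l m h)
  calc ((Gf j ∪ GA j).card : ℝ) ≤ (Gf j).card + (GA j).card :=
        mod_cast Finset.card_union_le _ _
    _ ≤ Cf * ε ^ (-1 / s) + CG * (1 + b * ε ^ (-1 / s)) := by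
        refine add_le_add (Gf_card j) ((GA_card j).trans ?_)
        rw [mul_one]
        gcongr
    _ ≤ (Cf + CG * (1 + b)) * (1 + ε ^ (-1 / s)) := by
        have : 0 ≤ Cf + CG * b + CG * ε ^ (-1 / s) := by positivity
        linarith

theorem IsRES.exists_of_ne_zero {cRes ω₁ : ℝ} {v r : L2 (MIdx d J)} (h : P.IsRES cRes ω₁ v r)
    (hr : r ≠ 0) : ∃ (tol : ℝ) (Γ : Fin d → ℕ → Finset J) (L : ℕ), cRes * ‖r‖ ≤ tol ∧
      (∀ j, IsBestLayers (contraction j v) (Γ j)) ∧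
      IsLeast {L | P.ApplyAccurate Γ v (tol / (3 * (1 + P.δ) * (2 + P.δ))) L} L ∧
      ∀ l, P.fApprox (tol / (3 * (1 + P.δ) * (2 + P.δ))) l = 0 ∧ (∀ m, P.matL Γ L l m = 0) →
        r l = 0 := by
  rcases h with ⟨-, rfl⟩ | ⟨-, tol, _, η, T, Γ, L, n, g, -, htol, -, rfl, hΓ, hL, hg, -, -, -, -,
    hr_eq⟩
  · exact absurd rfl hr
  refine ⟨tol, Γ, L, htol, hΓ, hL, fun l ⟨hf, hmat⟩ => ?_⟩
  rw [hr_eq, hf, hg]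
  simp [hmat]

theorem exists_residual_support_le (hscal : P.ScalingValid) (hsep : P.Separable) (hs : 0 < s)
    (hscheme : ∀ n j, IsCompressionScheme s (P.compHat n j) (P.compressed n j))
    (hrhs : P.RhsApproximable s) (hf : ∀ j, asNorm s (contraction j P.fδ) < ⊤) {cRes : ℝ}
    (hcRes : 0 < cRes) (ω₁ M : ℝ) :
    ∃ C : ℝ, 0 ≤ C ∧ ∀ (F : Finset (MIdx d J)) (v r : L2 (MIdx d J)),
      SuppIn (F : Set (MIdx d J)) v →
      (∀ Γ : Fin d → ℕ → Finset J, (∀ j, IsBestLayers (contraction j v) (Γ j)) →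
        LayerDecay s M Γ v) →
      P.IsRES cRes ω₁ v r → r ≠ 0 →
      ∃ G : Fin d → Finset J, SuppIn (box G) r ∧
        ∑ j, ((G j).card : ℝ) ≤ C * (1 + ‖r‖ ^ (-1 / s)) := by
  obtain ⟨C, hC, support_bound⟩ := exists_data_support_bound hscal hsep hs hscheme hrhs hf M
  have hδ := hscal.δ_pos
  set a : ℝ := 3 * (1 + P.δ) * (2 + P.δ) with ha
  have : 0 < a := by positivity
  set b : ℝ := (cRes / a) ^ (-1 / s)
  refine ⟨d * (C * (1 + b)), by positivity, fun F v r hv decay hres hr => ?_⟩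
  obtain ⟨tol, Γ, L, htol, hΓ, hL, r_eq_zero⟩ := hres.exists_of_ne_zero hr
  rw [← ha] at hL r_eq_zero
  have r_pos : 0 < ‖r‖ := norm_pos_iff.2 hr
  have tol_pos : 0 < tol := (mul_pos hcRes r_pos).trans_le htol
  obtain ⟨G, hG, G_card⟩ := support_bound Γ F v (tol / a) L hv (decay Γ hΓ)
    (fun j p => ((hΓ j).2 p).1) (by positivity) hL
  refine ⟨G, fun l hl => r_eq_zero l (hG l hl), ?_⟩
  have tol_rpow_le : (tol / a) ^ (-1 / s) ≤ b * ‖r‖ ^ (-1 / s) :=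
    rpow_neg_le_of_mul_le hs (by positivity) r_pos (by rw [div_mul_eq_mul_div]; gcongr)
  have one_add_le : 1 + (tol / a) ^ (-1 / s) ≤ (1 + b) * (1 + ‖r‖ ^ (-1 / s)) := by
    have : 0 ≤ b + ‖r‖ ^ (-1 / s) := by positivity
    linarith
  calc ∑ j, ((G j).card : ℝ) ≤ ∑ _j : Fin d, C * ((1 + b) * (1 + ‖r‖ ^ (-1 / s))) :=
        Finset.sum_le_sum fun j _ =>
          (G_card j).trans (mul_le_mul_of_nonneg_left one_add_le hC)
    _ = _ := by
        rw [Finset.sum_const, Finset.card_univ, Fintype.card_fin, nsmul_eq_mul]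
        ring

theorem exists_residual_support_le_rpow (hscal : P.ScalingValid) (hsep : P.Separable) (hs : 0 < s)
    (hscheme : ∀ n j, IsCompressionScheme s (P.compHat n j) (P.compressed n j))
    (hrhs : P.RhsApproximable s) (hu : ∀ j, asNorm s (contraction j P.uδ) < ⊤)
    (hf : ∀ j, asNorm s (contraction j P.fδ) < ⊤) {cRes C₁ C₂ c₃ : ℝ} (hcRes : 0 < cRes)
    (hC₁ : 0 ≤ C₁) (hC₂ : 0 ≤ C₂) (hc₃ : 0 < c₃) (ω₁ : ℝ) {W : ℝ} (hW : 0 ≤ W) :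
    ∃ C : ℝ, 0 ≤ C ∧ ∀ (x : ℝ) (Λ : Fin d → Finset J) (v r : L2 (MIdx d J)), 0 < x → x ≤ W →
      SuppIn (box Λ) v → ∑ j, ((Λ j).card : ℝ) ≤ C₁ * x ^ (-1 / s) → ‖P.uδ - v‖ ≤ C₂ * x →
      P.IsRES cRes ω₁ v r → c₃ * x ≤ ‖r‖ →
      ∃ G : Fin d → Finset J, SuppIn (box G) r ∧ ∑ j, ((G j).card : ℝ) ≤ C * x ^ (-1 / s) := by
  classical
  obtain ⟨M₀, F, hF, decay⟩ := exists_layerDecay hs hu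
  set c := C₂ * W + C₂ * C₁ ^ s
  obtain ⟨C, hC, support_le⟩ :=
    exists_residual_support_le hscal hsep hs hscheme hrhs hf hcRes ω₁ (M₀ + c)
  refine ⟨C * (W ^ (1 / s) + c₃ ^ (-1 / s)), by positivity,
    fun x Λ v r hx hxW hv hcard herr hres hr => ?_⟩
  have close_of_lt_card : ∀ j (p : ℕ), 2 ^ p < (Λ j).card →
      ‖P.uδ - v‖ ≤ c * (2 : ℝ) ^ (-(s * p)) := fun j p hp => by
    have pow_le : (2 : ℝ) ^ p ≤ C₁ * x ^ (-1 / s) := calc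
      (2 : ℝ) ^ p ≤ (Λ j).card := mod_cast hp.le
      _ ≤ ∑ i, ((Λ i).card : ℝ) :=
        Finset.single_le_sum (f := fun i => ((Λ i).card : ℝ)) (fun _ _ => Nat.cast_nonneg _)
          (Finset.mem_univ j)
      _ ≤ C₁ * x ^ (-1 / s) := hcard
    calc ‖P.uδ - v‖ ≤ C₂ * (C₁ ^ s * (2 : ℝ) ^ (-(s * p))) :=
          herr.trans (mul_le_mul_of_nonneg_left (le_rpow_mul_two_rpow_neg hs hC₁ hx pow_le) hC₂)
      _ = C₂ * C₁ ^ s * (2 : ℝ) ^ (-(s * p)) := (mul_assoc _ _ _).symm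
      _ ≤ c * (2 : ℝ) ^ (-(s * p)) :=
        mul_le_mul_of_nonneg_right (le_add_of_nonneg_left (by positivity)) (by positivity)
  have close : ‖P.uδ - v‖ ≤ c := herr.trans ((mul_le_mul_of_nonneg_left hxW hC₂).trans
    (le_add_of_nonneg_right (by positivity)))
  have r_ne_zero : r ≠ 0 := norm_pos_iff.1 ((mul_pos hc₃ hx).trans_le hr)
  obtain ⟨G, hG, G_card⟩ := support_le (Fintype.piFinset Λ) v r (by rwa [coe_piFinset_eq_box])
    (fun Γ hΓ => decay.of_isBestLayers hF hv close close_of_lt_card hΓ) hres r_ne_zero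
  refine ⟨G, hG, G_card.trans ?_⟩
  rw [mul_assoc, add_mul]
  exact mul_le_mul_of_nonneg_left
    (add_le_add (one_le_rpow_mul_rpow_neg hs hx hxW) (rpow_neg_le_of_mul_le hs hc₃ hx hr)) hC

end Problem

/-! ### Convergence -/

theorem pow_le_of_ceil_abs_log_div_log_le {x y : ℝ} {M : ℕ} (hx : 0 < x) (hx_lt : x < 1)
    (hy : 0 < y) (hM : ⌈|Real.log y / Real.log x|⌉₊ ≤ M) : x ^ M ≤ y := by
  have quotient_le : Real.log y / Real.log x ≤ M :=
    (le_abs_self _).trans ((Nat.le_ceil _).trans (Nat.cast_le.2 hM))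
  rwa [← Real.log_le_log_iff (by positivity) hy, Real.log_pow,
    ← div_le_iff_of_neg (Real.log_neg hx hx_lt)]

namespace Params

variable {d : ℕ} {J : Type*} {q : Params d J}

theorem ω₀k_succ (k : ℕ) : q.ω₀k (k + 1) = (q.ω₃ + q.ω₄ + q.ω₅) * q.ω₀k k := by
  rw [ω₀k, ω₀k, pow_succ', mul_assoc]

namespace Convergence

theorem ω₀k_pos (h : q.Convergence) (k : ℕ) : 0 < q.ω₀k k :=
  mul_pos (pow_pos (add_pos (add_pos h.ω₃_pos h.ω₄_pos) h.ω₅_pos) k) h.ω₀_pos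

theorem ω₀k_succ_le (h : q.Convergence) (k : ℕ) : q.ω₀k (k + 1) ≤ q.ω₀k k := by
  rw [ω₀k_succ]
  exact mul_le_of_le_one_left (h.ω₀k_pos k).le h.sum_lt.le

theorem ω₀k_le (h : q.Convergence) (k : ℕ) : q.ω₀k k ≤ q.ω₀ := by
  simpa [ω₀k] using antitone_nat_of_succ_le h.ω₀k_succ_le (Nat.zero_le k)

theorem ω₁_lt_one (h : q.Convergence) : q.ω₁ < 1 := h.ω₁_lt.trans h.bulk_lt

theorem tol_quotient_pos (h : q.Convergence) : 0 < q.ω₂ / (1 - q.ω₁) :=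
  div_pos h.ω₂_pos (sub_pos.2 h.ω₁_lt_one)

theorem tol_quotient_lt (h : q.Convergence) :
    q.ω₂ / (1 - q.ω₁) < (q.bulk - q.ω₁) / (1 + q.ω₁) * q.κ⁻¹ := by
  rw [div_lt_iff₀ (sub_pos.2 h.ω₁_lt_one)]
  exact h.ω₂_lt.trans_eq (by ring)

theorem tol_sq_lt (h : q.Convergence) (hκ : 1 ≤ q.κ) :
    (q.ω₂ / (1 - q.ω₁)) ^ 2 * q.κ < ((q.bulk - q.ω₁) / (1 + q.ω₁)) ^ 2 * q.κ⁻¹ := by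
  have κ_pos : 0 < q.κ := one_pos.trans_le hκ
  calc (q.ω₂ / (1 - q.ω₁)) ^ 2 * q.κ
      < ((q.bulk - q.ω₁) / (1 + q.ω₁) * q.κ⁻¹) ^ 2 * q.κ :=
        mul_lt_mul_of_pos_right
          (pow_lt_pow_left₀ h.tol_quotient_lt h.tol_quotient_pos.le two_ne_zero) κ_pos
    _ = ((q.bulk - q.ω₁) / (1 + q.ω₁)) ^ 2 * q.κ⁻¹ := by field_simp

theorem bulk_sq_lt (h : q.Convergence) (hκ : 1 ≤ q.κ) :
    ((q.bulk - q.ω₁) / (1 + q.ω₁)) ^ 2 * q.κ⁻¹ < 1 := by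
  have hω₁ := h.ω₁_pos
  have quotient_nonneg : 0 ≤ (q.bulk - q.ω₁) / (1 + q.ω₁) :=
    div_nonneg (sub_nonneg.2 h.ω₁_lt.le) (by positivity)
  have quotient_lt : (q.bulk - q.ω₁) / (1 + q.ω₁) < 1 := by
    rw [div_lt_one (by positivity)]
    linarith [h.bulk_lt]
  exact (mul_le_of_le_one_right (sq_nonneg _) (inv_le_one_of_one_le₀ hκ)).trans_lt
    (pow_lt_one₀ quotient_nonneg quotient_lt two_ne_zero)

theorem tol_sq_le_one (h : q.Convergence) (hκ : 1 ≤ q.κ) :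
    (q.ω₂ / (1 - q.ω₁)) ^ 2 * q.κ ≤ 1 :=
  ((h.tol_sq_lt hκ).trans (h.bulk_sq_lt hκ)).le

theorem ω₂_le_one (h : q.Convergence) (hκ : 1 ≤ q.κ) : q.ω₂ ≤ 1 := by
  have quotient_sq_le : (q.ω₂ / (1 - q.ω₁)) ^ 2 ≤ 1 :=
    (le_mul_of_one_le_right (sq_nonneg _) hκ).trans (h.tol_sq_le_one hκ)
  have quotient_le : q.ω₂ / (1 - q.ω₁) ≤ 1 :=
    (sq_le_one_iff₀ h.tol_quotient_pos.le).1 quotient_sq_le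
  rw [div_le_one (sub_pos.2 h.ω₁_lt_one)] at quotient_le
  linarith [h.ω₁_pos]

theorem radicand_pos (h : q.Convergence) (hκ : 1 ≤ q.κ) :
    0 < 1 - ((q.bulk - q.ω₁) / (1 + q.ω₁)) ^ 2 * q.κ⁻¹ + (q.ω₂ / (1 - q.ω₁)) ^ 2 * q.κ :=
  add_pos_of_pos_of_nonneg (sub_pos.2 (h.bulk_sq_lt hκ)) (by positivity)

theorem ϑ_sq (h : q.Convergence) (hκ : 1 ≤ q.κ) :
    q.ϑ ^ 2 = 1 - ((q.bulk - q.ω₁) / (1 + q.ω₁)) ^ 2 * q.κ⁻¹ +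
      (q.ω₂ / (1 - q.ω₁)) ^ 2 * q.κ :=
  Real.sq_sqrt (h.radicand_pos hκ).le

theorem ϑ_pos (h : q.Convergence) (hκ : 1 ≤ q.κ) : 0 < q.ϑ := Real.sqrt_pos.2 (h.radicand_pos hκ)

theorem ϑ_lt_one (h : q.Convergence) (hκ : 1 ≤ q.κ) : q.ϑ < 1 := by
  rw [ϑ, Real.sqrt_lt' one_pos]
  linarith [h.tol_sq_lt hκ]

theorem ϑ_sq_pow_le_one (h : q.Convergence) (hκ : 1 ≤ q.κ) (m : ℕ) : (q.ϑ ^ 2) ^ m ≤ 1 :=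
  pow_le_one₀ (sq_nonneg _) (pow_le_one₀ (h.ϑ_pos hκ).le (h.ϑ_lt_one hκ).le)

theorem ϑ_sq_pow_M_le (h : q.Convergence) (hκ : 1 ≤ q.κ) :
    (q.ϑ ^ 2) ^ q.M ≤ q.ω₃ ^ 2 * q.κ⁻¹ := by
  have hω₃ := h.ω₃_pos
  have hϑ := h.ϑ_pos hκ
  have κ_pos : 0 < q.κ := one_pos.trans_le hκ
  have pow_le : q.ϑ ^ q.M ≤ q.ω₃ * q.κ ^ (-1 / 2 : ℝ) :=
    pow_le_of_ceil_abs_log_div_log_le hϑ (h.ϑ_lt_one hκ) (by positivity) h.M_ge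
  calc (q.ϑ ^ 2) ^ q.M = (q.ϑ ^ q.M) ^ 2 := pow_right_comm _ _ _
    _ ≤ (q.ω₃ * q.κ ^ (-1 / 2 : ℝ)) ^ 2 := pow_le_pow_left₀ (by positivity) pow_le 2
    _ = q.ω₃ ^ 2 * q.κ⁻¹ := by
      rw [mul_pow, ← Real.rpow_mul_natCast κ_pos.le]
      norm_num [Real.rpow_neg_one]

theorem sqrt_mul_two_mul_ω₃_lt (h : q.Convergence) (hd : 2 ≤ d)
    (hω₅ : √d * (1 + √(2 * d - 3)) * q.ω₃ < q.ω₅) : √d * (2 * q.ω₃) < q.ω₅ := by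
  have hω₃ := h.ω₃_pos
  have hd' : (2 : ℝ) ≤ d := by exact_mod_cast hd
  have one_le_sqrt : 1 ≤ √(2 * (d : ℝ) - 3) := Real.one_le_sqrt.2 (by linarith)
  refine lt_of_le_of_lt ?_ hω₅
  rw [mul_assoc]
  gcongr
  linarith

theorem sqrt_mul_ω₃_lt (h : q.Convergence) (hd : 2 ≤ d)
    (hω₅ : √d * (1 + √(2 * d - 3)) * q.ω₃ < q.ω₅) : √d * (9 / 5 * q.ω₃) < q.ω₅ := by
  have hω₃ := h.ω₃_pos
  refine lt_of_le_of_lt ?_ (h.sqrt_mul_two_mul_ω₃_lt hd hω₅)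
  gcongr
  norm_num

theorem three_mul_ω₃_le (h : q.Convergence) (hd : 2 ≤ d) (hω₄ : √(2 * d - 3) * q.ω₃ < q.ω₄)
    (hω₅ : √d * (1 + √(2 * d - 3)) * q.ω₃ < q.ω₅) : 3 * q.ω₃ ≤ q.ω₄ + q.ω₅ := by
  have hω₃ := h.ω₃_pos
  have hd' : (2 : ℝ) ≤ d := by exact_mod_cast hd
  have ω₃_le : q.ω₃ ≤ √(2 * (d : ℝ) - 3) * q.ω₃ :=
    le_mul_of_one_le_left hω₃.le (Real.one_le_sqrt.2 (by linarith))
  have two_mul_le : 2 * q.ω₃ ≤ √(d : ℝ) * (2 * q.ω₃) :=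
    le_mul_of_one_le_left (by positivity) (Real.one_le_sqrt.2 (by linarith))
  linarith [h.sqrt_mul_two_mul_ω₃_lt hd hω₅]

end Convergence

end Params

section Expansion

variable {d : ℕ} {J : Type*} {K b : ℝ} {Λ Λ' : Fin d → Finset J} {r v w : L2 (MIdx d J)}

theorem IsExpand.box_subset (h : IsExpand K Λ r b Λ') : box Λ ⊆ box Λ' := by
  classical
  obtain ⟨Γ, -, hΛ'⟩ := h
  intro l hl j
  rw [hΛ' j]
  exact Finset.mem_union_left _ (hl j)

theorem IsExpand.bulk_le (h : IsExpand K Λ r b Λ') (hb : b ^ 2 ≤ 1) :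
    b * ‖r‖ ≤ ‖restr (box Λ') r‖ := by
  classical
  obtain ⟨Γ, ⟨htail, -⟩, hΛ'⟩ := h
  have box_subset : box Γ ⊆ box Λ' := fun l hl j => by
    rw [hΛ' j]
    exact Finset.mem_union_right _ (hl j)
  refine le_trans ?_ (norm_restr_mono box_subset r)
  have rest_le := pow_le_pow_left₀ (norm_nonneg _) ((norm_sub_restr_box_le r Γ).trans htail) 2
  rw [mul_pow, Real.sq_sqrt (sub_nonneg.2 hb)] at rest_le
  refine le_of_sq_le_sq ?_ (norm_nonneg _)
  rw [mul_pow]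
  linarith [norm_sq_restr_add (box Γ) r]

theorem IsCoarse.norm_sub_le {ε : ℝ} (h : IsCoarse K v ε w) : ‖v - w‖ ≤ ε := by
  obtain ⟨Γ, ⟨htail, -⟩, rfl⟩ := h
  exact (norm_sub_restr_box_le v Γ).trans htail

theorem suppIn_box_of_support_contraction_subset
    (h : ∀ j, Function.support (contraction j v) ⊆ (Λ j : Set J)) : SuppIn (box Λ) v := by
  intro l hl
  by_contra hv
  exact hl fun j => h j ((contraction_ne_zero_iff j v (l j)).2 ⟨l, rfl, hv⟩)

end Expansion

section Convergence

variable {d R : ℕ} {J : Type*} {P : Problem d R J} {q : Params d J}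

namespace Problem

theorem Equation.one_le_κ (h : P.Equation q.lmin q.lmax) : 1 ≤ q.κ :=
  (one_le_div h.lmin_pos).2 h.lmin_le

theorem IsRES.norm_le {cRes ω₁ : ℝ} {v r : L2 (MIdx d J)} (h : P.IsRES cRes ω₁ v r) :
    ‖P.fδ - P.Aδ v - r‖ ≤ ω₁ * ‖r‖ := by
  rcases h with ⟨hv, rfl⟩ | h
  · simp [hv]
  · exact h.1

end Problem

/-- A bound for the squared energy norm of the errors in the `k`-th outer iteration. It is `9 / 4`
times the bound `lmax * (6 / 5 * (ω₀k k / lmin)) ^ 2` for the energy at the start of that iteration,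
so that it also covers the loss caused by the inexact solution of the first Galerkin system. -/
def energyBound (q : Params d J) (k : ℕ) : ℝ := q.κ / q.lmin * (9 / 5 * q.ω₀k k) ^ 2

/-- The invariant of the algorithm at the iteration `(k, m)` with the index set `Λ`, the iterate `u`
and the estimate `ρ` of the norm of its residual: after the next Galerkin solution the energy of the
error has been reduced by `m` contractions with the factor `ϑ ^ 2`. -/
structure IterateBounds (P : Problem d R J) (q : Params d J) (k m : ℕ) (Λ : Fin d → Finset J)
    (u : L2 (MIdx d J)) (ρ : ℝ) : Prop where
  suppIn : SuppIn (box Λ) u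
  le_M : m ≤ q.M
  energy_le : energy P.Aδ (P.uδ - u) ≤ energyBound q k
  energy_solve_le_pow_mul : ∀ u', IsPCG P.Aδ P.fδ u (box Λ) (q.ω₂ * ρ) u' →
    energy P.Aδ (P.uδ - u') ≤ (q.ϑ ^ 2) ^ m * energyBound q k

theorem energyBound_nonneg (heq : P.Equation q.lmin q.lmax) (k : ℕ) : 0 ≤ energyBound q k :=
  mul_nonneg (div_nonneg (zero_le_one.trans heq.one_le_κ) heq.lmin_pos.le) (sq_nonneg _)

theorem norm_le_of_energy_le (hconv : q.Convergence) (heq : P.Equation q.lmin q.lmax) {k : ℕ}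
    {e : L2 (MIdx d J)} {c : ℝ} (hc : 0 ≤ c)
    (h : energy P.Aδ e ≤ c ^ 2 * q.κ⁻¹ * energyBound q k) :
    ‖e‖ ≤ 9 / 5 * c * q.lmin⁻¹ * q.ω₀k k := by
  have hl := heq.lmin_pos
  have κ_pos : 0 < q.κ := one_pos.trans_le heq.one_le_κ
  have hx := hconv.ω₀k_pos k
  have bound_eq : c ^ 2 * q.κ⁻¹ * energyBound q k =
      q.lmin * (9 / 5 * c * q.lmin⁻¹ * q.ω₀k k) ^ 2 := by
    unfold energyBound
    field_simp
  refine le_of_sq_le_sq ?_ (by positivity)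
  exact le_of_mul_le_mul_left ((heq.lower e).trans (h.trans_eq bound_eq)) hl

theorem norm_le_of_energy_le_energyBound (hconv : q.Convergence) (heq : P.Equation q.lmin q.lmax)
    {k : ℕ} {e : L2 (MIdx d J)} (h : energy P.Aδ e ≤ energyBound q k) :
    ‖e‖ ≤ 9 / 5 * q.κ * q.lmin⁻¹ * q.ω₀k k := by
  have hκ := heq.one_le_κ
  refine norm_le_of_energy_le hconv heq (zero_le_one.trans hκ)
    (h.trans (le_mul_of_one_le_left (energyBound_nonneg heq k) ?_))
  rwa [sq, mul_assoc, mul_inv_cancel₀ (by linarith), mul_one]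

namespace IterateBounds

variable {k m : ℕ} {Λ Λ' : Fin d → Finset J} {u u' r r' v w : L2 (MIdx d J)} {ρ : ℝ}

theorem energy_solve_le (hconv : q.Convergence) (heq : P.Equation q.lmin q.lmax)
    (h : IterateBounds P q k m Λ u ρ) (solve : IsPCG P.Aδ P.fδ u (box Λ) (q.ω₂ * ρ) u') :
    energy P.Aδ (P.uδ - u') ≤ energyBound q k :=
  (h.energy_solve_le_pow_mul u' solve).trans
    (mul_le_of_le_one_left (energyBound_nonneg heq k) (hconv.ϑ_sq_pow_le_one heq.one_le_κ m))

theorem norm_error_finished (hconv : q.Convergence) (heq : P.Equation q.lmin q.lmax)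
    (h : IterateBounds P q k m Λ u ρ) (solve : IsPCG P.Aδ P.fδ u (box Λ) (q.ω₂ * ρ) u')
    (estimate : P.IsRES q.cRes q.ω₁ u' r)
    (finished : (1 + q.ω₁) * ‖r‖ ≤ q.ω₃ * q.ω₀k k ∨ m = q.M) :
    ‖P.uδ - u'‖ ≤ 9 / 5 * q.ω₃ * q.lmin⁻¹ * q.ω₀k k := by
  have hl := heq.lmin_pos
  have hω₃ := hconv.ω₃_pos
  have hx := hconv.ω₀k_pos k
  rcases finished with small | rfl
  · have residual_le : ‖P.Aδ (P.uδ - u')‖ ≤ q.ω₃ * q.ω₀k k := by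
      have res := estimate.norm_le
      rw [← heq.apply_sub] at res
      linarith [norm_le_norm_add_norm_sub' (P.Aδ (P.uδ - u')) r]
    calc ‖P.uδ - u'‖ ≤ q.lmin⁻¹ * (q.ω₃ * q.ω₀k k) := by
          rw [le_inv_mul_iff₀ hl]
          exact (heq.spectralBounds.lmin_mul_norm_le _).trans residual_le
      _ = 1 * (q.ω₃ * q.lmin⁻¹ * q.ω₀k k) := by ring
      _ ≤ 9 / 5 * (q.ω₃ * q.lmin⁻¹ * q.ω₀k k) :=
        mul_le_mul_of_nonneg_right (by norm_num) (by positivity)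
      _ = 9 / 5 * q.ω₃ * q.lmin⁻¹ * q.ω₀k k := by ring
  · exact norm_le_of_energy_le hconv heq hω₃.le ((h.energy_solve_le_pow_mul u' solve).trans
      (mul_le_mul_of_nonneg_right (hconv.ϑ_sq_pow_M_le heq.one_le_κ) (energyBound_nonneg heq k)))

theorem of_energy_le (heq : P.Equation q.lmin q.lmax) (hu : SuppIn (box Λ) u)
    (henergy : energy P.Aδ (P.uδ - u) ≤ energyBound q k / 2)
    (hρ : (q.ω₂ * ρ) ^ 2 / q.lmin ≤ energyBound q k / 2) : IterateBounds P q k 0 Λ u ρ where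
  suppIn := hu
  le_M := Nat.zero_le _
  energy_le := henergy.trans (half_le_self (energyBound_nonneg heq k))
  energy_solve_le_pow_mul u' solve := by
    have hres : ‖(suppSubmodule (box Λ)).starProjection (P.Aδ (P.uδ - u'))‖ ≤ q.ω₂ * ρ := by
      rw [starProjection_suppSubmodule, heq.apply_sub]
      exact solve.norm_residual_le
    have := heq.spectralBounds.energy_le_of_residual_le
      ((suppSubmodule (box Λ)).sub_mem (solve.suppIn hu) hu) hres
    rw [pow_zero]
    linarith

theorem init (hconv : q.Convergence) (heq : P.Equation q.lmin q.lmax) (hω₀ : ‖P.fδ‖ ≤ q.ω₀) :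
    IterateBounds P q 0 0 q.Λ₀ 0 q.ω₀ := by
  have hl := heq.lmin_pos
  have hω₀_sq : 0 ≤ q.ω₀ ^ 2 / q.lmin := by positivity
  have le_bound : q.ω₀ ^ 2 / q.lmin ≤ energyBound q 0 / 2 := by
    have bound_eq : energyBound q 0 / 2 = 81 / 50 * q.κ * (q.ω₀ ^ 2 / q.lmin) := by
      rw [energyBound, Params.ω₀k]
      ring
    rw [bound_eq]
    exact le_mul_of_one_le_left hω₀_sq (by linarith [heq.one_le_κ])
  refine of_energy_le heq ((suppSubmodule _).zero_mem) (le_trans ?_ le_bound)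
    (le_trans ?_ le_bound)
  · rw [sub_zero, le_div_iff₀' hl]
    refine (heq.spectralBounds.lmin_mul_energy_le P.uδ).trans ?_
    rw [heq.solution]
    exact pow_le_pow_left₀ (norm_nonneg _) hω₀ 2
  · rw [mul_pow, mul_div_assoc]
    exact mul_le_of_le_one_left hω₀_sq
      (pow_le_one₀ hconv.ω₂_pos.le (hconv.ω₂_le_one heq.one_le_κ))

theorem inner (hconv : q.Convergence) (heq : P.Equation q.lmin q.lmax)
    (h : IterateBounds P q k m Λ u ρ) (solve : IsPCG P.Aδ P.fδ u (box Λ) (q.ω₂ * ρ) u')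
    (estimate : P.IsRES q.cRes q.ω₁ u' r) (not_last : m ≠ q.M)
    (expand : IsExpand q.K Λ r q.bulk Λ') : IterateBounds P q k (m + 1) Λ' u' ‖r‖ where
  suppIn := (solve.suppIn h.suppIn).mono expand.box_subset
  le_M := Nat.lt_of_le_of_ne h.le_M not_last
  energy_le := h.energy_solve_le hconv heq solve
  energy_solve_le_pow_mul u'' solve' := by
    have hu' : SuppIn (box Λ') u' := (solve.suppIn h.suppIn).mono expand.box_subset
    have bulk_sq_le : q.bulk ^ 2 ≤ 1 :=
      pow_le_one₀ (hconv.ω₁_pos.trans hconv.ω₁_lt).le hconv.bulk_lt.le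
    have hr : ‖P.Aδ (P.uδ - u') - r‖ ≤ q.ω₁ * ‖r‖ := by
      rw [heq.apply_sub]
      exact estimate.norm_le
    have hres : ‖(suppSubmodule (box Λ')).starProjection (P.Aδ (P.uδ - u''))‖ ≤ q.ω₂ * ‖r‖ := by
      rw [starProjection_suppSubmodule, heq.apply_sub]
      exact solve'.norm_residual_le
    have hbulk : q.bulk * ‖r‖ ≤ ‖(suppSubmodule (box Λ')).starProjection r‖ := by
      rw [starProjection_suppSubmodule]
      exact expand.bulk_le bulk_sq_le
    have step := heq.spectralBounds.energy_step hconv.ω₁_pos hconv.ω₁_lt hconv.ω₁_lt_one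
      ((suppSubmodule (box Λ')).sub_mem (solve'.suppIn hu') hu') hr
      hbulk hres
    rw [← Params.κ, ← hconv.ϑ_sq heq.one_le_κ] at step
    rw [pow_succ', mul_assoc]
    exact step.trans
      (mul_le_mul_of_nonneg_left (h.energy_solve_le_pow_mul u' solve) (sq_nonneg _))

theorem norm_error_outer (hconv : q.Convergence) (heq : P.Equation q.lmin q.lmax)
    (hω : 3 * q.ω₃ ≤ q.ω₄ + q.ω₅) (h : IterateBounds P q k m Λ u ρ)
    (solve : IsPCG P.Aδ P.fδ u (box Λ) (q.ω₂ * ρ) u') (estimate : P.IsRES q.cRes q.ω₁ u' r)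
    (finished : (1 + q.ω₁) * ‖r‖ ≤ q.ω₃ * q.ω₀k k ∨ m = q.M)
    (trunc : IsTrunc q.tree u' (q.ω₄ * q.lmin⁻¹ * q.ω₀k k) w)
    (coarse : IsCoarse q.K w (q.ω₅ * q.lmin⁻¹ * q.ω₀k k) v) :
    ‖P.uδ - v‖ ≤ 6 / 5 * (q.lmin⁻¹ * q.ω₀k (k + 1)) := by
  have hx : 0 ≤ q.lmin⁻¹ * q.ω₀k k :=
    mul_nonneg (inv_nonneg.2 heq.lmin_pos.le) (hconv.ω₀k_pos k).le
  have trunc_error : ‖u' - w‖ ≤ q.ω₄ * q.lmin⁻¹ * q.ω₀k k := by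
    obtain ⟨-, -, -, trunc_error⟩ := trunc
    exact trunc_error
  calc ‖P.uδ - v‖ = ‖(P.uδ - u') + (u' - w) + (w - v)‖ := by
        rw [sub_add_sub_cancel, sub_add_sub_cancel]
    _ ≤ 9 / 5 * q.ω₃ * q.lmin⁻¹ * q.ω₀k k + q.ω₄ * q.lmin⁻¹ * q.ω₀k k +
        q.ω₅ * q.lmin⁻¹ * q.ω₀k k :=
      norm_add₃_le.trans (add_le_add (add_le_add
        (h.norm_error_finished hconv heq solve estimate finished) trunc_error) coarse.norm_sub_le)
    _ = (9 / 5 * q.ω₃ + q.ω₄ + q.ω₅) * (q.lmin⁻¹ * q.ω₀k k) := by ring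
    _ ≤ 6 / 5 * (q.ω₃ + q.ω₄ + q.ω₅) * (q.lmin⁻¹ * q.ω₀k k) :=
      mul_le_mul_of_nonneg_right (by linarith) hx
    _ = 6 / 5 * (q.lmin⁻¹ * q.ω₀k (k + 1)) := by rw [Params.ω₀k_succ]; ring

theorem outer (hconv : q.Convergence) (heq : P.Equation q.lmin q.lmax)
    (hv : SuppIn (box Λ) v) (herr : ‖P.uδ - v‖ ≤ 6 / 5 * (q.lmin⁻¹ * q.ω₀k k))
    (estimate : P.IsRES q.cRes q.ω₁ v r) : IterateBounds P q k 0 Λ v ‖r‖ := by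
  have hspec := heq.spectralBounds
  have energy_le : energy P.Aδ (P.uδ - v) ≤ energyBound q k / 2 := by
    have hl := heq.lmin_pos
    have bound_eq : q.lmax * (6 / 5 * (q.lmin⁻¹ * q.ω₀k k)) ^ 2 = 4 / 9 * energyBound q k := by
      rw [energyBound, Params.κ]
      field_simp
      ring
    have upper : energy P.Aδ (P.uδ - v) ≤ q.lmax * ‖P.uδ - v‖ ^ 2 := heq.upper _
    have := upper.trans (mul_le_mul_of_nonneg_left
      (pow_le_pow_left₀ (norm_nonneg _) herr 2) hspec.lmax_pos.le)
    linarith [energyBound_nonneg heq k]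
  refine of_energy_le heq hv energy_le (le_trans ?_ energy_le)
  have residual_ge : (1 - q.ω₁) * ‖r‖ ≤ ‖P.Aδ (P.uδ - v)‖ := by
    have res := estimate.norm_le
    rw [← heq.apply_sub] at res
    linarith [norm_le_norm_add_norm_sub (P.Aδ (P.uδ - v)) r]
  exact (hspec.sq_div_lmin_le_of_le_norm (sub_pos.2 hconv.ω₁_lt_one) (norm_nonneg r)
    residual_ge).trans (mul_le_of_le_one_left (hspec.energy_nonneg _)
      (hconv.tol_sq_le_one heq.one_le_κ))

end IterateBounds

theorem iterateBounds_of_reach (hconv : q.Convergence) (heq : P.Equation q.lmin q.lmax)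
    (hω₀ : ‖P.fδ‖ ≤ q.ω₀) (hω : 3 * q.ω₃ ≤ q.ω₄ + q.ω₅) {ε : ℝ} {k m : ℕ}
    {Λ : Fin d → Finset J} {u : L2 (MIdx d J)} {ρ : ℝ} (h : Reach P q ε k m Λ u ρ) :
    IterateBounds P q k m Λ u ρ := by
  induction h with
  | init => exact .init hconv heq hω₀
  | inner _ solve estimate _ _ not_last expand ih =>
    exact ih.inner hconv heq solve estimate not_last expand
  | outer _ solve estimate _ finished trunc coarse supp estimate' ih =>
    exact .outer hconv heq (suppIn_box_of_support_contraction_subset fun j => (supp j).ge)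
      (ih.norm_error_outer hconv heq hω solve estimate finished trunc coarse) estimate'

end Convergence

/-! ### Sizes of the index sets -/

section Sizes

variable {d R : ℕ} {J : Type*}

section Coarsening

variable {K b ε : ℝ} {Λ Λ' F G : Fin d → Finset J} {r u u' v w : L2 (MIdx d J)}

theorem IsCoarse.sum_card_le (h : IsCoarse K w ε v)
    (hΛ : ∀ j, (Λ j : Set J) = Function.support (contraction j v)) (hF : tail w F ≤ ε) :
    ∑ j, ((Λ j).card : ℝ) ≤ K * ∑ j, ((F j).card : ℝ) := by
  obtain ⟨Γ, ⟨-, minimal⟩, rfl⟩ := h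
  refine (Finset.sum_le_sum fun j _ => ?_).trans (minimal F hF)
  refine Nat.cast_le.2 (Finset.card_le_card fun y hy => ?_)
  rw [← Finset.mem_coe, hΛ j] at hy
  obtain ⟨l, rfl, hl⟩ := (contraction_ne_zero_iff _ _ _).1 hy
  by_contra hn
  exact hl (restr_of_notMem (fun hl' : l ∈ box Γ => hn (hl' j)) w)

theorem IsExpand.sum_card_le (h : IsExpand K Λ r b Λ') (hG : SuppIn (box G) r) :
    ∑ j, ((Λ' j).card : ℝ) ≤ ∑ j, ((Λ j).card : ℝ) + K * ∑ j, ((G j).card : ℝ) := by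
  classical
  obtain ⟨Γ, ⟨-, minimal⟩, hΛ'⟩ := h
  refine le_trans ?_ (add_le_add_right (minimal G ((tail_eq_zero hG).le.trans (by positivity))) _)
  rw [← Finset.sum_add_distrib]
  refine Finset.sum_le_sum fun j _ => ?_
  rw [hΛ' j]
  exact_mod_cast Finset.card_union_le _ _

theorem IsTrunc.tail_le_sqrt_mul {t : DimTree d} (ht : t.IsDimTree) (h : IsTrunc t u' ε w)
    (hb : 0 ≤ b) (hF : ∀ j, ‖contraction j u - restr (F j : Set J) (contraction j u)‖ ≤ b) :
    tail w F ≤ √d * (b + ‖u - u'‖) := by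
  refine tail_le w F (by positivity) fun j => ?_
  let outside : Set (MIdx d J) := {l | l j ∈ {y | y ∉ F j}}
  calc ‖restr outside w‖ ≤ ‖restr outside u'‖ := h.norm_restr_le ht j {y | y ∉ F j}
    _ = ‖restr outside u - restr outside (u - u')‖ := by rw [restr_sub, sub_sub_cancel]
    _ ≤ ‖restr outside u‖ + ‖restr outside (u - u')‖ := norm_sub_le _ _
    _ ≤ b + ‖u - u'‖ :=
      add_le_add ((norm_contraction_sub_restr j (F j) u).ge.trans (hF j)) (HTAWGM.norm_restr_le _ _)

theorem exists_coarse_sum_card_le {s : ℝ} (hs : 0 < s)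
    (hu : ∀ j, asNorm s (contraction j u) < ⊤) (hd : 0 < d) {t : DimTree d} (ht : t.IsDimTree)
    {a : ℝ} (hK : 0 ≤ K) (hab : √d * a < b) :
    ∃ C : ℝ, 0 ≤ C ∧ ∀ (x ε : ℝ) (u' w v : L2 (MIdx d J)) (Λ : Fin d → Finset J), 0 < x →
      ‖u - u'‖ ≤ a * x → IsTrunc t u' ε w → IsCoarse K w (b * x) v →
      (∀ j, (Λ j : Set J) = Function.support (contraction j v)) →
      ∑ j, ((Λ j).card : ℝ) ≤ C * x ^ (-1 / s) := by
  have hsd : 0 < √(d : ℝ) := Real.sqrt_pos.2 (Nat.cast_pos.2 hd)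
  choose c hc approx using fun j => exists_card_le_of_asNorm_lt_top hs (hu j)
  set θ := (b - √d * a) / √d with hθ
  have θ_pos : 0 < θ := div_pos (sub_pos.2 hab) hsd
  have quotient_nonneg : ∀ j, 0 ≤ c j / θ := fun j => div_nonneg (hc j).le θ_pos.le
  refine ⟨K * ∑ j, (c j / θ) ^ (1 / s), mul_nonneg hK (Finset.sum_nonneg fun j _ =>
    Real.rpow_nonneg (quotient_nonneg j) _), fun x ε u' w v Λ hx herr htrunc hcoarse hΛ => ?_⟩
  choose F hF F_card using fun j => approx j (θ * x) (by positivity)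
  have tail_le : tail w F ≤ b * x := by
    refine (htrunc.tail_le_sqrt_mul ht (by positivity) hF).trans ?_
    refine (mul_le_mul_of_nonneg_left (add_le_add_right herr _) hsd.le).trans_eq ?_
    rw [hθ]
    field_simp
    ring
  have F_card_le : ∀ j, ((F j).card : ℝ) ≤ (c j / θ) ^ (1 / s) * x ^ (-1 / s) := fun j => by
    refine (F_card j).trans_eq ?_
    rw [neg_div, Real.rpow_neg hx.le, ← div_eq_mul_inv,
      ← Real.div_rpow (quotient_nonneg j) hx.le, div_div]
  calc ∑ j, ((Λ j).card : ℝ) ≤ K * ∑ j, ((F j).card : ℝ) := hcoarse.sum_card_le hΛ tail_le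
    _ ≤ K * ∑ j, (c j / θ) ^ (1 / s) * x ^ (-1 / s) :=
      mul_le_mul_of_nonneg_left (Finset.sum_le_sum fun j _ => F_card_le j) hK
    _ = K * (∑ j, (c j / θ) ^ (1 / s)) * x ^ (-1 / s) := by rw [← Finset.sum_mul, mul_assoc]

end Coarsening

section Iterations

variable {P : Problem d R J} {q : Params d J} {s : ℝ}

theorem exists_reach_zero_sum_card_le (hd : 0 < d) (heq : P.Equation q.lmin q.lmax) (hs : 0 < s)
    (hconv : q.Convergence) (hω₀ : ‖P.fδ‖ ≤ q.ω₀) (hω : 3 * q.ω₃ ≤ q.ω₄ + q.ω₅)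
    (hω₅ : √d * (9 / 5 * q.ω₃) < q.ω₅) (hu : ∀ j, asNorm s (contraction j P.uδ) < ⊤) :
    ∃ C : ℝ, 0 ≤ C ∧ ∀ (ε : ℝ) (k : ℕ) (Λ : Fin d → Finset J) (u : L2 (MIdx d J)) (ρ : ℝ),
      Reach P q ε k 0 Λ u ρ → ∑ j, ((Λ j).card : ℝ) ≤ C * q.ω₀k k ^ (-1 / s) := by
  have hab : √d * (9 / 5 * q.ω₃ * q.lmin⁻¹) < q.ω₅ * q.lmin⁻¹ := by
    rw [← mul_assoc]
    exact mul_lt_mul_of_pos_right hω₅ (inv_pos.2 heq.lmin_pos)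
  obtain ⟨C, hC, coarse_le⟩ :=
    exists_coarse_sum_card_le hs hu hd hconv.tree (zero_le_one.trans hconv.K_ge) hab
  set S := ∑ j, ((q.Λ₀ j).card : ℝ)
  have hS : 0 ≤ S := Finset.sum_nonneg fun _ _ => Nat.cast_nonneg _
  have hSω₀ : 0 ≤ S * q.ω₀ ^ (1 / s) := mul_nonneg hS (Real.rpow_nonneg hconv.ω₀_pos.le _)
  refine ⟨C + S * q.ω₀ ^ (1 / s), add_nonneg hC hSω₀, fun ε k Λ u ρ h => ?_⟩
  have hx := hconv.ω₀k_pos k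
  have hx_pow : 0 ≤ q.ω₀k k ^ (-1 / s) := Real.rpow_nonneg hx.le _
  rw [add_mul]
  cases h with
  | init =>
    refine le_add_of_nonneg_of_le (mul_nonneg hC hx_pow) ?_
    rw [mul_assoc]
    exact le_mul_of_one_le_right hS (one_le_rpow_mul_rpow_neg hs hx (hconv.ω₀k_le 0))
  | @outer k _ _ _ _ u' _ w _ _ _ prev solve estimate _ finished trunc coarse supp =>
    have herr := (iterateBounds_of_reach hconv heq hω₀ hω prev).norm_error_finished
      hconv heq solve estimate finished
    refine le_add_of_le_of_nonneg ?_ (mul_nonneg hSω₀ hx_pow)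
    refine (coarse_le _ _ u' w u Λ (hconv.ω₀k_pos k) herr trunc coarse supp).trans ?_
    exact mul_le_mul_of_nonneg_left (Real.rpow_le_rpow_of_nonpos hx (hconv.ω₀k_succ_le k)
      (div_nonpos_of_nonpos_of_nonneg (by norm_num) hs.le)) hC

theorem exists_reach_succ_sum_card_le (hscal : P.ScalingValid) (hsep : P.Separable)
    (heq : P.Equation q.lmin q.lmax) (hs : 0 < s)
    (hscheme : ∀ n j, IsCompressionScheme s (P.compHat n j) (P.compressed n j))
    (hrhs : P.RhsApproximable s) (hconv : q.Convergence) (hω₀ : ‖P.fδ‖ ≤ q.ω₀)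
    (hω : 3 * q.ω₃ ≤ q.ω₄ + q.ω₅) (hu : ∀ j, asNorm s (contraction j P.uδ) < ⊤) {C : ℝ}
    (hC : 0 ≤ C) {m : ℕ}
    (hm : ∀ (ε : ℝ) (k : ℕ) (Λ : Fin d → Finset J) (u : L2 (MIdx d J)) (ρ : ℝ),
      Reach P q ε k m Λ u ρ → ∑ j, ((Λ j).card : ℝ) ≤ C * q.ω₀k k ^ (-1 / s)) :
    ∃ C' : ℝ, 0 ≤ C' ∧ ∀ (ε : ℝ) (k : ℕ) (Λ : Fin d → Finset J) (u : L2 (MIdx d J)) (ρ : ℝ),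
      Reach P q ε k (m + 1) Λ u ρ → ∑ j, ((Λ j).card : ℝ) ≤ C' * q.ω₀k k ^ (-1 / s) := by
  have hl := heq.lmin_pos
  have hω₃ := hconv.ω₃_pos
  have hω₁ := hconv.ω₁_pos
  have hκ := zero_le_one.trans heq.one_le_κ
  have hK : 0 ≤ q.K := zero_le_one.trans hconv.K_ge
  obtain ⟨C', hC', residual_support_le⟩ :=
    P.exists_residual_support_le_rpow hscal hsep hs hscheme hrhs hu
      (Problem.asNorm_rhs_lt_top hscal hsep heq hs hscheme hu) hconv.cRes_pos hC
      (C₂ := 9 / 5 * q.κ * q.lmin⁻¹) (by positivity)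
      (c₃ := q.ω₃ / (1 + q.ω₁)) (by positivity) q.ω₁ hconv.ω₀_pos.le
  refine ⟨C + q.K * C', by positivity, fun ε k Λ u ρ h => ?_⟩
  cases h with
  | @inner _ _ Λ₁ _ u₁ _ r ρ₁ prev solve estimate _ not_small _ expand =>
    have bounds := iterateBounds_of_reach hconv heq hω₀ hω prev
    have herr := norm_le_of_energy_le_energyBound hconv heq (bounds.energy_solve_le hconv heq solve)
    have residual_ge : q.ω₃ / (1 + q.ω₁) * q.ω₀k k ≤ ‖r‖ := by
      rw [div_mul_eq_mul_div, div_le_iff₀' (by positivity)]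
      exact not_small.le
    have prev_le := hm ε k Λ₁ u₁ ρ₁ prev
    obtain ⟨G, hG, G_card⟩ := residual_support_le _ Λ₁ u r (hconv.ω₀k_pos k) (hconv.ω₀k_le k)
      (solve.suppIn bounds.suppIn) prev_le herr estimate residual_ge
    rw [add_mul, mul_assoc]
    exact (expand.sum_card_le hG).trans (add_le_add prev_le (mul_le_mul_of_nonneg_left G_card hK))

theorem exists_reach_sum_card_le (hd : 0 < d) (hscal : P.ScalingValid) (hsep : P.Separable)
    (heq : P.Equation q.lmin q.lmax) (hs : 0 < s)
    (hscheme : ∀ n j, IsCompressionScheme s (P.compHat n j) (P.compressed n j))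
    (hrhs : P.RhsApproximable s) (hconv : q.Convergence) (hω₀ : ‖P.fδ‖ ≤ q.ω₀)
    (hω : 3 * q.ω₃ ≤ q.ω₄ + q.ω₅) (hω₅ : √d * (9 / 5 * q.ω₃) < q.ω₅)
    (hu : ∀ j, asNorm s (contraction j P.uδ) < ⊤) :
    ∃ C : ℝ, 0 ≤ C ∧ ∀ (ε : ℝ) (k m : ℕ) (Λ : Fin d → Finset J) (u : L2 (MIdx d J)) (ρ : ℝ),
      Reach P q ε k m Λ u ρ → ∑ j, ((Λ j).card : ℝ) ≤ C * q.ω₀k k ^ (-1 / s) := by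
  have fixed_inner : ∀ m : ℕ, ∃ C : ℝ, 0 ≤ C ∧ ∀ (ε : ℝ) (k : ℕ) (Λ : Fin d → Finset J)
      (u : L2 (MIdx d J)) (ρ : ℝ), Reach P q ε k m Λ u ρ →
        ∑ j, ((Λ j).card : ℝ) ≤ C * q.ω₀k k ^ (-1 / s) := fun m => by
    induction m with
    | zero => exact exists_reach_zero_sum_card_le hd heq hs hconv hω₀ hω hω₅ hu
    | succ m ih =>
      obtain ⟨C, hC, hm⟩ := ih
      exact exists_reach_succ_sum_card_le hscal hsep heq hs hscheme hrhs hconv hω₀ hω hu hC hm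
  choose C hC sum_card_le using fixed_inner
  refine ⟨∑ m ∈ Finset.range (q.M + 1), C m, Finset.sum_nonneg fun m _ => hC m,
    fun ε k m Λ u ρ h => (sum_card_le m ε k Λ u ρ h).trans ?_⟩
  have m_le := (iterateBounds_of_reach hconv heq hω₀ hω h).le_M
  exact mul_le_mul_of_nonneg_right (Finset.single_le_sum (fun m _ => hC m)
    (Finset.mem_range_succ_iff.2 m_le)) (Real.rpow_nonneg (hconv.ω₀k_pos k).le _)

theorem exists_reach_sum_card_le_norm_error (hd : 0 < d) (hscal : P.ScalingValid)
    (hsep : P.Separable) (heq : P.Equation q.lmin q.lmax) (hs : 0 < s)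
    (hscheme : ∀ n j, IsCompressionScheme s (P.compHat n j) (P.compressed n j))
    (hrhs : P.RhsApproximable s) (hconv : q.Convergence) (hω₀ : ‖P.fδ‖ ≤ q.ω₀)
    (hω : 3 * q.ω₃ ≤ q.ω₄ + q.ω₅) (hω₅ : √d * (9 / 5 * q.ω₃) < q.ω₅)
    (hu : ∀ j, asNorm s (contraction j P.uδ) < ⊤) :
    ∃ C : ℝ, 0 < C ∧ ∀ (ε : ℝ) (k m : ℕ) (Λ : Fin d → Finset J) (u : L2 (MIdx d J)) (ρ : ℝ),
      Reach P q ε k m Λ u ρ → u ≠ P.uδ →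
        ∑ j, ((Λ j).card : ℝ) ≤ C * ‖P.uδ - u‖ ^ (-1 / s) := by
  obtain ⟨C, hC, sum_card_le⟩ :=
    exists_reach_sum_card_le hd hscal hsep heq hs hscheme hrhs hconv hω₀ hω hω₅ hu
  have hl := heq.lmin_pos
  have hκ : 0 < q.κ := one_pos.trans_le heq.one_le_κ
  set c := (9 / 5 * q.κ * q.lmin⁻¹)⁻¹
  have hc : 0 < c := by positivity
  refine ⟨(C + 1) * c ^ (-1 / s),
    mul_pos (by linarith) (Real.rpow_pos_of_pos hc _), fun ε k m Λ u ρ h hne => ?_⟩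
  have error_pos : 0 < ‖P.uδ - u‖ := norm_pos_iff.2 (sub_ne_zero.2 hne.symm)
  have error_le : c * ‖P.uδ - u‖ ≤ q.ω₀k k :=
    (inv_mul_le_iff₀ (by positivity)).2 (norm_le_of_energy_le_energyBound hconv heq
      (iterateBounds_of_reach hconv heq hω₀ hω h).energy_le)
  calc ∑ j, ((Λ j).card : ℝ) ≤ C * q.ω₀k k ^ (-1 / s) := sum_card_le ε k m Λ u ρ h
    _ ≤ (C + 1) * (c ^ (-1 / s) * ‖P.uδ - u‖ ^ (-1 / s)) :=
      mul_le_mul (by linarith) (rpow_neg_le_of_mul_le hs hc error_pos error_le)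
        (Real.rpow_nonneg (hconv.ω₀k_pos k).le _) (by linarith)
    _ = (C + 1) * c ^ (-1 / s) * ‖P.uδ - u‖ ^ (-1 / s) := (mul_assoc _ _ _).symm

end Iterations

end Sizes

/-! ### Vanishing solutions -/

section Vanishing

variable {d R : ℕ} {J : Type*} {P : Problem d R J} {q : Params d J}

theorem eq_zero_of_sum_toReal_asNorm_eq_zero {s : ℝ} {v : L2 (MIdx d J)} (hd : 0 < d) (hs : 0 ≤ s)
    (hv : ∀ j, asNorm s (contraction j v) < ⊤)
    (h : ∑ j, (asNorm s (contraction j v)).toReal = 0) : v = 0 := by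
  let j : Fin d := ⟨0, hd⟩
  have toReal_eq_zero : (asNorm s (contraction j v)).toReal = 0 :=
    (Finset.sum_eq_zero_iff_of_nonneg fun _ _ => ENNReal.toReal_nonneg).1 h j (Finset.mem_univ j)
  have asNorm_eq_zero := ((ENNReal.toReal_eq_zero_iff _).1 toReal_eq_zero).resolve_right (hv j).ne
  rw [← norm_eq_zero, ← norm_contraction j, eq_zero_of_asNorm_eq_zero hs asNorm_eq_zero, norm_zero]

theorem not_lt_of_solve_zero (hconv : q.Convergence) (hf : P.fδ = 0) {ε ρ : ℝ} (hε : 0 ≤ ε)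
    (hρ : 0 ≤ ρ) {Λ : Set (MIdx d J)} {u' r : L2 (MIdx d J)}
    (solve : IsPCG P.Aδ P.fδ 0 Λ (q.ω₂ * ρ) u') (estimate : P.IsRES q.cRes q.ω₁ u' r) :
    ¬ ε < (1 + q.ω₁) * ‖r‖ := by
  have u'_eq : u' = 0 := solve.eq_of_residual_le <| by
    rw [hf, map_zero, sub_zero]
    exact (norm_restr_le _ _).trans (norm_zero.le.trans (mul_nonneg hconv.ω₂_pos.le hρ))
  have res := estimate.norm_le
  rw [u'_eq, hf, map_zero, sub_zero, zero_sub, norm_neg] at res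
  have r_norm : ‖r‖ = 0 := by nlinarith [norm_nonneg r, hconv.ω₁_lt_one]
  rw [r_norm, mul_zero]
  exact hε.not_gt

theorem eq_zero_of_reach_of_solution_eq_zero (heq : P.Equation q.lmin q.lmax)
    (hconv : q.Convergence) (h₀ : P.uδ = 0) {ε : ℝ} (hε : 0 ≤ ε) {k m : ℕ}
    {Λ : Fin d → Finset J} {u : L2 (MIdx d J)} {ρ : ℝ} (h : Reach P q ε k m Λ u ρ) :
    u = 0 ∧ 0 ≤ ρ := by
  have hf : P.fδ = 0 := by rw [← heq.solution, h₀, map_zero]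
  induction h with
  | init => exact ⟨rfl, hconv.ω₀_pos.le⟩
  | inner _ solve estimate not_done _ _ _ ih =>
    obtain ⟨rfl, hρ⟩ := ih
    exact absurd not_done (not_lt_of_solve_zero hconv hf hε hρ solve estimate)
  | outer _ solve estimate not_done _ _ _ _ _ ih =>
    obtain ⟨rfl, hρ⟩ := ih
    exact absurd not_done (not_lt_of_solve_zero hconv hf hε hρ solve estimate)

end Vanishing

end HTAWGM

end

open HTAWGM in
theorem proposition4_general {d R : ℕ} {J : Type*} (hd : 0 < d)
    (P : Problem d R J) (q : Params d J) (s : ℝ)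
    (hscal : P.ScalingValid) (hsep : P.Separable) (heq : P.Equation q.lmin q.lmax) (hs : 0 < s)
    (hscheme : ∀ n j, IsCompressionScheme s (P.compHat n j) (P.compressed n j))
    (hrhs : P.RhsApproximable s) (hconv : q.Convergence) (hω₀ : ‖P.fδ‖ ≤ q.ω₀)
    (hω : 3 * q.ω₃ ≤ q.ω₄ + q.ω₅) (hω₅ : √d * (9 / 5 * q.ω₃) < q.ω₅)
    (husparse : ∀ j, asNorm s (contraction j P.uδ) < ⊤) :
    ∃ C : ℝ, 0 < C ∧
      ∀ (ε : ℝ), 0 < ε → ∀ (k m : ℕ) (Λ : Fin d → Finset J) (u : L2 (MIdx d J)) (ρ : ℝ),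
        Reach P q ε k m Λ u ρ → u ≠ P.uδ →
          ∑ j, ((Λ j).card : ℝ) ≤
            C * ‖P.uδ - u‖ ^ (-1 / s) *
              (∑ j, (asNorm s (contraction j P.uδ)).toReal) ^ (1 / s) := by
  set S := ∑ j, (asNorm s (contraction j P.uδ)).toReal
  have hS : 0 ≤ S := Finset.sum_nonneg fun _ _ => ENNReal.toReal_nonneg
  rcases hS.eq_or_lt' with S_eq | S_pos
  · have uδ_eq := eq_zero_of_sum_toReal_asNorm_eq_zero hd hs.le husparse S_eq
    refine ⟨1, one_pos, fun ε hε k m Λ u ρ reach hne => absurd ?_ hne⟩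
    rw [uδ_eq]
    exact (eq_zero_of_reach_of_solution_eq_zero heq hconv uδ_eq hε.le reach).1
  · obtain ⟨C, hC, sum_card_le⟩ := exists_reach_sum_card_le_norm_error hd hscal hsep heq hs hscheme
      hrhs hconv hω₀ hω hω₅ husparse
    have S_pow_pos : 0 < S ^ (1 / s) := Real.rpow_pos_of_pos S_pos _
    refine ⟨C / S ^ (1 / s), div_pos hC S_pow_pos, fun ε _ k m Λ u ρ reach hne => ?_⟩
    rw [div_mul_eq_mul_div, div_mul_cancel₀ _ S_pow_pos.ne']
    exact sum_card_le ε k m Λ u ρ reach hne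

open HTAWGM in
theorem proposition4 {d R : ℕ} {J : Type*} (hd : 2 ≤ d)
    (P : Problem d R J) (q : Params d J) (s sstar : ℝ) (γ : ℕ → ℝ)
    -- the preconditioned operator equation
    (hscal : P.ScalingValid) (hsep : P.Separable) (heq : P.Equation q.lmin q.lmax)
    -- compressibility of the one-dimensional components, and the compression that is used
    (hs : 0 < s) (hs' : s < sstar)
    (hcompress : ∀ n j, IsCompressible sstar (P.compHat n j))
    (hscheme : ∀ n j, IsCompressionScheme s (P.compHat n j) (P.compressed n j))
    -- approximability of the right-hand side
    (hrhs : P.RhsApproximable s)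
    -- parameters of the algorithm
    (hconv : q.Convergence) (hω₀ : ‖P.fδ‖ ≤ q.ω₀)
    (hω₄ : √(2 * d - 3) * q.ω₃ < q.ω₄) (hω₅ : √d * (1 + √(2 * d - 3)) * q.ω₃ < q.ω₅)
    -- approximability of the solution
    (hγ0 : γ 0 = 1) (hγpos : ∀ n, 0 < γ n) (hγmono : StrictMono γ)
    (hγadm : BddAbove (Set.range fun n => γ (n + 1) / γ n))
    (hurank : MemRankClass q.tree γ P.uδ)
    (husparse : ∀ j, asNorm s (contraction j P.uδ) < ⊤) :
    ∃ C : ℝ, 0 < C ∧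
      ∀ (ε : ℝ), 0 < ε → ∀ (k m : ℕ) (Λ : Fin d → Finset J) (u : L2 (MIdx d J)) (ρ : ℝ),
        Reach P q ε k m Λ u ρ → u ≠ P.uδ →
          ∑ j, ((Λ j).card : ℝ) ≤
            C * ‖P.uδ - u‖ ^ (-1 / s) *
              (∑ j, (asNorm s (contraction j P.uδ)).toReal) ^ (1 / s) :=
  proposition4_general (by lia) P q s hscal hsep heq hs hscheme hrhs hconv hω₀
    (hconv.three_mul_ω₃_le hd hω₄ hω₅) (hconv.sqrt_mul_ω₃_lt hd hω₅) husparse
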